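/- Let $\Gamma$ be a finite connected core (1PI) graph with edge set $E$, $n=\#E$; loops, multiple edges and marked two-point vertices of kinetic type are allowed. For a set of edges (subgraph) $\gamma\subseteq E$ let $h_1(\gamma)=\dim H_1(\gamma,\mathbb Q)$; $\gamma$ is *core* if removing any edge lowers $h_1$, and $$\mathrm{sdd}(\gamma)=4h_1(\gamma)-2\,\#\gamma+2\,\#\{\text{vertices of kinetic type in }\gamma\}.$$ Let $\psi_\Gamma=\sum_T\prod_{e\notin T}A_e$ ($T$ the spanning trees), $X_\Gamma=\{\psi_\Gamma=0\}\subset\mathbb P(\Gamma)=\mathbb P^{n-1}$, and $\Omega=\sum_i(-1)^iA_i\,dA_1\wedge\cdots\widehat{dA_i}\cdots\wedge dA_n$. Let $\pi:P(\Gamma)\to\mathbb P(\Gamma)$ be the iterated blowup of the coordinate linear spaces $L_\gamma=\{A_e=0,\ e\in\gamma\}$, $\gamma\subsetneq\Gamma$ non-empty core, with exceptional divisors $E_\gamma$ and strict transforms $D_e$ of the coordinate divisors. It is a smooth toric variety with affine charts given by a maximal flag of proper core subgraphs together with an edge chosen in each layer; the coordinates are an equation of $E_\gamma$ for each $\gamma$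 in the flag and an equation of $D_e$ for each edge $e$ not chosen. Fix $C^1$ metrics on the normal bundles of all toric divisors $E_\gamma$, $D_e$; they induce compatible metrics on the line-bundle summands of the normal bundles of their intersections. *Chains.* To a flag $\Gamma_p\subsetneq\cdots\subsetneq\Gamma_1\subsetneq\Gamma$ of non-empty core subgraphs ($p\ge0$) belongs $V=E_{\Gamma_1}\cap\cdots\cap E_{\Gamma_p}$ ($V=P(\Gamma)$ if $p=0$). The torus-equivariant retraction of an open neighbourhood of $V$ to $V$ identifies this neighbourhood with a sum $\mathcal L_1\oplus\dots\oplus\mathcal L_p$ of line bundles on $V$, and similarly for each irreducible toric divisor $V_1=V\cap E_\gamma$ or $V\cap D_e$ of $V$. Let $\sigma_V^{\varepsilon}\subset V(\mathbb R^{>0})$ be the set of positive points whose fibre coordinate over each such $V_1$ has length $\ge\varepsilon$, and let $\tau^\varepsilon_V$ be the product of the $p$ circle bundles of radius $\varepsilon$ in the $\mathcal L_i$, restricted to $\sigma_V^\varepsilon$. It is regarded as a chain on $\mathbb P(\Gamma)$ through $\pi$. More generally, for $\kappa>0$ consider the chains obtained by replacing the base $\sigma_V^\varepsilon$ by any measurable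 $B\subseteq\sigma_V^{\kappa\varepsilon}$ (modifications of the base along its boundary). Let also $\sigma_\varepsilon=\sigma_{\varepsilon,q}$ be the image in $\mathbb P(\Gamma)$ of the simplex with vertices $r_k=p_k+\varepsilon q_k$, where $p_k$ ($k\in E$) are the coordinate vectors and $q_k\in\mathbb R^n$. *Forms.* Let $\omega_\Gamma=\dfrac{G}{\psi_\Gamma^m}\,\Omega$ with $G\in\mathbb C[A_e]$ homogeneous, $\deg G+n=m\,h_1(\Gamma)$, be an algebraic $(n-1)$-form with poles along $X_\Gamma$. It *has log poles only* if $\pi^*\omega_\Gamma$ has at most a logarithmic pole along every $E_\gamma$. **Lemma.** Assume $\mathrm{sdd}(\gamma)\le2$ for all non-empty connected core subgraphs $\gamma\subseteq\Gamma$. (i) If $\omega_\Gamma$ has log poles only, then for every $\kappa>0$ there are $k\in\mathbb N$, $M\in\mathbb R$ and $\varepsilon_0\in(0,1)$ such that for all $0<\varepsilon<\varepsilon_0$, all flags (including the empty one), all chains $\tau=\tau_V^\varepsilon$, all their modifications with base $B\subseteq\sigma_V^{\kappa\varepsilon}$, and all $\tau=\sigma_{\varepsilon,q}$ with $1-\varepsilon_0<q_{kj}\le1$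 for all $k,j$: the chain $\tau$ does not meet $X_\Gamma$, $\omega_\Gamma$ is integrable over $\tau$, and $$\Big|\int_{\tau}\omega_\Gamma\Big|\le M\,\big|\log|\varepsilon|\big|^k .$$ (ii) If there are no vertices of kinetic type, $\mathrm{sdd}(\Gamma)=0$, and $\mathrm{sdd}(\gamma)\le0$ for all non-empty connected core subgraphs $\gamma$, then the same conclusion holds for $\omega_\Gamma=\Omega/\psi_\Gamma^2$. -/

import Mathlib

open scoped BigOperators

noncomputable section

/-- A finite graph with vertex set `V` and set of internal edges `E`; loops (tadpoles) and multiple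
edges are allowed.  The orientation `src`, `tgt` of the edges is auxiliary.  `kin` is the set of
(two-point) vertices of kinetic type.  External edges play no role for the objects below and are not
recorded.  A subgraph is a set of edges. -/
structure FeynmanGraph (V E : Type*) where
  src : E → V
  tgt : E → V
  kin : Finset V

namespace FeynmanGraph

variable {V E : Type*} [Fintype V] [DecidableEq V] [Fintype E] [DecidableEq E]

/-- The boundary map `ℚ^S → ℚ^V` of the subgraph with edge set `S`. -/
def boundary (Γ : FeynmanGraph V E) (S : Finset E) : (S → ℚ) →ₗ[ℚ] (V → ℚ) :=
  Fintype.linearCombination ℚ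
    (fun e : S => (Pi.single (Γ.tgt e) 1 - Pi.single (Γ.src e) 1 : V → ℚ))

/-- The loop number `|S| = dim H_1(S, ℚ)`. -/
def h1 (Γ : FeynmanGraph V E) (S : Finset E) : ℕ :=
  Module.finrank ℚ (LinearMap.ker (Γ.boundary S))

/-- A subgraph is core (one-particle irreducible) if removing any edge lowers the loop number. -/
def IsCore (Γ : FeynmanGraph V E) (S : Finset E) : Prop :=
  ∀ e ∈ S, Γ.h1 (S.erase e) < Γ.h1 S

/-- `v` is an end point of an edge of `S`. -/
def Incident (Γ : FeynmanGraph V E) (S : Finset E) (v : V) : Prop :=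
  ∃ e ∈ S, Γ.src e = v ∨ Γ.tgt e = v

/-- `v` and `w` can be joined by a path of edges of `S`. -/
def Linked (Γ : FeynmanGraph V E) (S : Finset E) : V → V → Prop :=
  Relation.EqvGen (fun v w => ∃ e ∈ S, Γ.src e = v ∧ Γ.tgt e = w)

/-- Connectedness of the subgraph with edge set `S` (its vertices are the ends of its edges). -/
def ConnectedOn (Γ : FeynmanGraph V E) (S : Finset E) : Prop :=
  ∀ v w, Γ.Incident S v → Γ.Incident S w → Γ.Linked S v w

/-- Connectedness of the whole graph. -/
def Connected (Γ : FeynmanGraph V E) : Prop :=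
  ∀ v w, Γ.Linked Finset.univ v w

open Classical in
/-- Superficial degree of divergence `4 h_1 - 2 #edges + 2 #(vertices of kinetic type)`. -/
def sdd (Γ : FeynmanGraph V E) (S : Finset E) : ℤ :=
  4 * (Γ.h1 S : ℤ) - 2 * (S.card : ℤ) + 2 * ((Γ.kin.filter (fun v => Γ.Incident S v)).card : ℤ)

/-- Spanning trees: no loops, and all vertices are connected. -/
def IsSpanningTree (Γ : FeynmanGraph V E) (T : Finset E) : Prop :=
  Γ.h1 T = 0 ∧ ∀ v w, Γ.Linked T v w

open Classical in
/-- The graph polynomial `ψ_Γ = ∑_T ∏_{e ∉ T} A_e`. -/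
def psi (Γ : FeynmanGraph V E) : MvPolynomial E ℂ :=
  ∑ T ∈ Finset.univ.filter (fun T : Finset E => Γ.IsSpanningTree T),
    ∏ e ∈ Finset.univ \ T, MvPolynomial.X e

/-- A flag `Γ_p ⊊ ⋯ ⊊ Γ_1 ⊊ Γ` of non-empty proper core subgraphs, as a finite set (`p = 0` is
allowed).  It stands for the orbit closure `V = E_{Γ_1} ∩ ⋯ ∩ E_{Γ_p}` in the iterated blowup `P(Γ)`
of the coordinate linear spaces `A_e = 0, e ∈ γ` (`γ` a proper core subgraph); the empty flag
stands for `V = P(Γ)`. -/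
def IsFlag (Γ : FeynmanGraph V E) (C : Finset (Finset E)) : Prop :=
  (∀ γ ∈ C, γ.Nonempty ∧ γ ≠ Finset.univ ∧ Γ.IsCore γ) ∧
    ∀ γ ∈ C, ∀ δ ∈ C, γ ⊆ δ ∨ δ ⊆ γ

/-- A maximal cone of the fan of `P(Γ)`, i.e. an affine toric chart: a maximal flag of core
subgraphs together with one edge in each layer of `⋯ ⊊ Γ_1 ⊊ Γ` (the layer of `γ` consists of the
edges of `γ` in no smaller member of the flag).  The rays of the cone are the `e(γ) = ∑_{e ∈ γ} e`,
`γ` in the flag, and the edges which have not been chosen. -/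
structure Chart (Γ : FeynmanGraph V E) where
  flag : Finset (Finset E)
  isFlag : Γ.IsFlag flag
  maximal : ∀ C : Finset (Finset E), Γ.IsFlag C → flag ⊆ C → C = flag
  edge : Finset E → E
  edge_mem : ∀ γ ∈ insert Finset.univ flag, edge γ ∈ γ
  edge_notMem : ∀ γ ∈ insert Finset.univ flag, ∀ δ ∈ flag, δ ⊂ γ → edge γ ∉ δ

namespace Chart

variable {Γ : FeynmanGraph V E}

/-- The chosen edge of the top layer; it serves to normalize homogeneous coordinates. -/
def top (σ : Γ.Chart) : E := σ.edge Finset.univ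

/-- All chosen edges. -/
def chosen (σ : Γ.Chart) : Finset E := (insert Finset.univ σ.flag).image σ.edge

/-- The chart, followed by the blowing down `P(Γ) → ℙ(Γ)`, in homogeneous coordinates.  The `n - 1`
coordinates are indexed by the edges `f ≠ σ.top`: the one with index `σ.edge γ`, `γ` in the flag, is
an equation of the exceptional divisor `E_γ`, the one with index `f` not chosen is an equation of
the strict transform of the coordinate divisor `A_f = 0`.  The value at `σ.top` is not used. -/
def toProj {K : Type*} [CommSemiring K] (σ : Γ.Chart) (z : E → K) : E → K := fun e =>
  (∏ γ ∈ σ.flag.filter (fun γ => e ∈ γ), z (σ.edge γ)) * (if e ∈ σ.chosen then 1 else z e)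

/-- The coordinate `f` of `σ` and the coordinate `f'` of `σ'` are equations of the same
toric divisor of `P(Γ)`. -/
def SameDivisor (σ : Γ.Chart) (f : E) (σ' : Γ.Chart) (f' : E) : Prop :=
  (∃ γ ∈ σ.flag, γ ∈ σ'.flag ∧ f = σ.edge γ ∧ f' = σ'.edge γ) ∨
    (f = f' ∧ f ∉ σ.chosen ∧ f ∉ σ'.chosen)

end Chart

/-- Two vectors are homogeneous coordinates of the same positive point of projective space. -/
def SamePoint (a b : E → ℝ) : Prop := ∃ c : ℝ, 0 < c ∧ ∀ e, a e = c * b e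

/-- The coordinates `z` with those in `F` replaced by zero. -/
def zeroOn (F : Finset E) (z : E → ℝ) : E → ℝ := fun f => if f ∈ F then 0 else z f

/-- Metrics on the normal line bundles of all the toric divisors of `P(Γ)` (exceptional divisors
`E_γ` and strict transforms `D_e` of coordinate divisors), on the non-negative real points.
`weight σ f` is the length of the normal vector `∂/∂z_f` along the divisor `z_f = 0` in the chart
`σ`; `glue` says that the length of `z_f ∂/∂z_f` does not depend on the chart.  The summands of
the normal bundle of an intersection of exceptional divisors carry the restricted metrics, so that
the metrics are compatible for inclusions of orbit closures. -/
structure ToricMetric (Γ : FeynmanGraph V E) where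
  weight : Γ.Chart → E → (E → ℝ) → ℝ
  contDiffOn : ∀ σ f, f ≠ σ.top → ContDiffOn ℝ 1 (weight σ f) {z | ∀ e, 0 ≤ z e}
  pos : ∀ σ f, f ≠ σ.top → ∀ z : E → ℝ, (∀ e, 0 ≤ z e) → 0 < weight σ f z
  glue : ∀ (σ σ' : Γ.Chart) (f f' : E), σ.SameDivisor f σ' f' →
    ∀ z z' : E → ℝ, (∀ e, 0 < z e) → (∀ e, 0 < z' e) →
      SamePoint (σ.toProj z) (σ'.toProj z') →
      z f * weight σ f (zeroOn {f} z) = z' f' * weight σ' f' (zeroOn {f'} z')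

/-- Coefficient, with respect to the parameters `t`, of the pullback of
`ω = (G / ψ^m) Ω`, `Ω = ∑ ± A_i dA_1 ∧ ⋯ ^ ⋯ ∧ dA_n`, under a parametrization `Φ` in
homogeneous coordinates: `Ω` pulls back to the determinant with rows `Φ` (in place `e₀`) and the
partial derivatives of `Φ`. -/
def pullback (Γ : FeynmanGraph V E) (G : MvPolynomial E ℂ) (m : ℕ) (e₀ : E)
    (Φ : ({f : E // f ≠ e₀} → ℝ) → E → ℂ) (t : {f : E // f ≠ e₀} → ℝ) : ℂ :=
  MvPolynomial.eval (Φ t) G / (MvPolynomial.eval (Φ t) Γ.psi) ^ m *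
    (Matrix.of fun f j : E =>
      if h : f = e₀ then Φ t j else fderiv ℝ Φ t (Pi.single ⟨f, h⟩ 1) j).det

/-- For the chain with parametrization `Φ` and parameter domain `D`: it does not meet the
hypersurface `X_Γ`, the integral of `ω = (G / ψ^m) Ω` over it exists and is bounded by `M`. -/
def IntegralBound (Γ : FeynmanGraph V E) (G : MvPolynomial E ℂ) (m : ℕ) (e₀ : E)
    (Φ : ({f : E // f ≠ e₀} → ℝ) → E → ℂ) (D : Set ({f : E // f ≠ e₀} → ℝ)) (M : ℝ) : Prop :=
  (∀ t ∈ D, MvPolynomial.eval (Φ t) Γ.psi ≠ 0) ∧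
  MeasureTheory.IntegrableOn (Γ.pullback G m e₀ Φ) D ∧
  ‖∫ t in D, Γ.pullback G m e₀ Φ t‖ ≤ M

/-- The pullback of `Ω` to a chart of `P(Γ)`, as a polynomial in the chart coordinates. -/
def chartJacobian {Γ : FeynmanGraph V E} (σ : Γ.Chart) : MvPolynomial E ℂ :=
  (Matrix.of fun f j : E =>
    if f = σ.top then σ.toProj (MvPolynomial.X : E → MvPolynomial E ℂ) j
    else MvPolynomial.pderiv f (σ.toProj (MvPolynomial.X : E → MvPolynomial E ℂ) j)).det

/-- The pullback of `ω = (G / ψ^m) Ω` to `P(Γ)` has at most logarithmic poles along the exceptional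
divisors: in each chart, and for each exceptional divisor `x = 0` of that chart, `x` times the
coefficient of the pullback is a quotient `P / Q` with `Q` not divisible by `x`. -/
def HasLogPoles (Γ : FeynmanGraph V E) (G : MvPolynomial E ℂ) (m : ℕ) : Prop :=
  ∀ σ : Γ.Chart, ∀ γ ∈ σ.flag, ∃ P Q : MvPolynomial E ℂ,
    ¬ (MvPolynomial.X (σ.edge γ) ∣ Q) ∧
    MvPolynomial.X (σ.edge γ) *
        (MvPolynomial.bind₁ (σ.toProj (MvPolynomial.X : E → MvPolynomial E ℂ)) G *
          chartJacobian σ) * Q =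
      P * (MvPolynomial.bind₁ (σ.toProj (MvPolynomial.X : E → MvPolynomial E ℂ)) Γ.psi) ^ m

/-- The simplex with vertices `r_k = p_k + ε q_k`, with `p_k` the coordinate vectors; the
barycentric coordinate of `e₀` is one minus the sum of the others. -/
def simplexMap (e₀ : E) (q : E → E → ℝ) (ε : ℝ) (t : {f : E // f ≠ e₀} → ℝ) : E → ℂ := fun j =>
  ((∑ k : E, (if h : k = e₀ then 1 - ∑ f, t f else t ⟨k, h⟩) *
      ((if k = j then 1 else 0) + ε * q k j) : ℝ) : ℂ)

/-- The standard simplex of parameters. -/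
def simplexDomain (e₀ : E) : Set ({f : E // f ≠ e₀} → ℝ) :=
  {t | (∀ f, 0 ≤ t f) ∧ ∑ f, t f ≤ 1}

namespace Chart

variable {Γ : FeynmanGraph V E}

/-- Parameters on a tube: an angle for each coordinate belonging to the flag `C`, and a positive
coordinate on the orbit closure `V` for each of the others. -/
abbrev Param (σ : Γ.Chart) : Type _ := {f : E // f ≠ σ.top} → ℝ

/-- The coordinates belonging to the members of the flag `C`. -/
def fibre (σ : Γ.Chart) (C : Finset (Finset E)) : Finset E := C.image σ.edge

/-- The real point with coordinate `x` along the fibre of the normal bundle of `V`, lying over the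
point of `V` given by the parameters. -/
def point (σ : Γ.Chart) (C : Finset (Finset E)) (x : ℝ) (t : σ.Param) : E → ℝ := fun f =>
  if h : f = σ.top then 1 else if f ∈ σ.fibre C then x else t ⟨f, h⟩

open Classical in
/-- The cutoff: `η` at exceptional divisors and `ε` at strict transforms of coordinate
divisors. -/
def cutoff (σ : Γ.Chart) (η ε : ℝ) (f : E) : ℝ :=
  if f ∈ σ.chosen then η else ε

/-- The real chain `σ_V^{η,ε} ⊂ V(ℝ_{>0})` for the orbit closure `V` of the flag `C`: for every
irreducible toric divisor `V₁ = V ∩ {z'_f = 0}` of `V`, seen in any chart containing it, the length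
of the fibre coordinate of the line bundle around `V₁` is at least the cutoff.  (The parameters
which are angles are not restricted here.) -/
def base (σ : Γ.Chart) (g : Γ.ToricMetric) (C : Finset (Finset E)) (η ε : ℝ) : Set σ.Param :=
  {t | (∀ f : {f : E // f ≠ σ.top}, (f : E) ∉ σ.fibre C → 0 < t f) ∧
    ∀ σ' : Γ.Chart, C ⊆ σ'.flag → ∀ z' : E → ℝ, (∀ e, 0 < z' e) →
      SamePoint (σ'.toProj z') (σ.toProj (σ.point C 1 t)) →
      ∀ f, f ≠ σ'.top → f ∉ σ'.fibre C →
        σ'.cutoff η ε f ≤ z' f * g.weight σ' f (zeroOn (insert f (σ'.fibre C)) z')}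

/-- The domain of the angles. -/
def angles (σ : Γ.Chart) (C : Finset (Finset E)) : Set σ.Param :=
  {t | ∀ f : {f : E // f ≠ σ.top}, (f : E) ∈ σ.fibre C → t f ∈ Set.Icc 0 (2 * Real.pi)}

/-- The product of the circle bundles of radius `η` over `V(ℝ_{>0})`, in the direct sum
of normal line bundles of `V`. -/
def tubeMap (σ : Γ.Chart) (g : Γ.ToricMetric) (C : Finset (Finset E)) (η : ℝ) (t : σ.Param) :
    E → ℂ :=
  σ.toProj (fun f =>
    if h : f = σ.top then 1
    else if f ∈ σ.fibre C then
      ((η / g.weight σ f (σ.point C 0 t) : ℝ) : ℂ) * Complex.exp (Complex.I * (t ⟨f, h⟩ : ℂ))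
    else (t ⟨f, h⟩ : ℂ))

end Chart

/-- Logarithmic growth, as `ε → 0`, of the integrals of `ω = (G / ψ^m) Ω` over
* the chain `σ_ε`, which is the simplex with vertices `r_k = p_k + ε q_k`;
* the chains `τ_V^{ε,ε}` for all orbit closures `V` of flags of core subgraphs, that is the product
  of circle bundles of radius `ε` over `σ_V^{ε,ε}` (parametrized in any chart meeting `V`);
* the chains obtained from these by modifying the base `σ_V^{ε,ε}` along its boundary, in such a way
  that it stays at distances at least `κ ε` from the toric divisors of `V`. -/
def LogGrowth (Γ : FeynmanGraph V E) (g : Γ.ToricMetric) (G : MvPolynomial E ℂ) (m : ℕ) : Prop :=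
  ∀ κ : ℝ, 0 < κ → ∃ (k : ℕ) (M ε₀ : ℝ), 0 < ε₀ ∧ ε₀ < 1 ∧ ∀ ε : ℝ, 0 < ε → ε < ε₀ →
    (∀ (e₀ : E) (q : E → E → ℝ), (∀ i j, 1 - ε₀ < q i j ∧ q i j ≤ 1) →
      Γ.IntegralBound G m e₀ (simplexMap e₀ q ε) (simplexDomain e₀) (M * |Real.log (|ε|)| ^ k)) ∧
    (∀ C : Finset (Finset E), Γ.IsFlag C → ∀ σ : Γ.Chart, C ⊆ σ.flag →
      Γ.IntegralBound G m σ.top (σ.tubeMap g C ε) (σ.base g C ε ε ∩ σ.angles C)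
        (M * |Real.log (|ε|)| ^ k)) ∧
    (∀ C : Finset (Finset E), Γ.IsFlag C → ∀ σ : Γ.Chart, C ⊆ σ.flag →
      ∀ B : Set σ.Param, MeasurableSet B → B ⊆ σ.base g C (κ * ε) (κ * ε) ∩ σ.angles C →
        Γ.IntegralBound G m σ.top (σ.tubeMap g C ε) B (M * |Real.log (|ε|)| ^ k))

end FeynmanGraph

end

open scoped BigOperators

noncomputable section

set_option linter.unusedSectionVars false

namespace FeynmanGraph

variable {V E : Type*} [Fintype V] [DecidableEq V] [Fintype E] [DecidableEq E]

/-! ### Cycle spaces -/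

/-! Write ω = u · Ω/∏A_e with u = G ∏A_e / ψ^m (`logCoeff`). The degree condition makes u
homogeneous of degree 0, so it can be evaluated in any chart and after any rescaling. The blowing
down is monomial in a chart, so Ω/∏A_e pulls back to a non-zero constant times ∏ dz_f/z_f. The
estimate thus splits into a bound for u on the chains and the elementary fact that the integral of ∏
dt/t over a box [x, 1/x]^k, with x a power of ε up to a constant, is a power of |log ε|.

Bound for u. In a chart, ψ becomes ∏ z_γ^{h_1(γ)} times `strictPsi`. The edges not chosen in the
chart form a spanning tree (`isSpanningTree`), whose term in `strictPsi` is 1; the other terms are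
monomials with non-negative coefficients. Hence `strictPsi` ≥ 1 at non-negative real points, and by
uniform continuity it stays away from 0 near the real unit cube. Logarithmic poles mean that the
numerator absorbs the monomial to the power m, which leaves a polynomial over a power of `strictPsi`
(`logCoeff_toProj`). As there are finitely many charts, u is bounded near all the unit cubes
(`exists_bound`). In (ii) the absorption is the inequality 2 h_1(γ) ≤ #γ.

Covering. Deleting greedily an edge with the largest coordinate and passing to the core produces a
chart in which a given positive point has coordinates at most 1; this can be done relative to a
prescribed flag C (`IsFlag.exists_chart`). For a point of a tube, rescaling the fibre coordinates
acts on homogeneous coordinates in the same way in all charts, and gluing of the metrics gives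
radius ε/weight in the new chart too. So the point lies within O(ε) of a real cube. The distance
conditions on the base bound the base coordinates there below by a multiple of ε, whence the
original coordinates lie between powers of ε and their inverses (`exists_adapted_coords`).

The simplex consists of positive real points, where u is bounded. There A_j is at least the
barycentric coordinate b_j plus ε/2, and the integral of 1/∏(b_j + ε/2) is logarithmic because the
b_j sum to 1 (`exists_dominating_simplex`). -/

/-- The rational cycles supported on `S`, as functions on all edges. -/
def cycles (Γ : FeynmanGraph V E) (S : Finset E) : Submodule ℚ (E → ℚ) where
  carrier := {x | (∑ e, x e • (Pi.single (Γ.tgt e) 1 - Pi.single (Γ.src e) 1 : V → ℚ) = 0) ∧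
    ∀ e, e ∉ S → x e = 0}
  zero_mem' := by simp
  add_mem' := by
    rintro x y ⟨hx, hx'⟩ ⟨hy, hy'⟩
    refine ⟨?_, fun e he => by simp [hx' e he, hy' e he]⟩
    simp only [Pi.add_apply, add_smul, Finset.sum_add_distrib, hx, hy, add_zero]
  smul_mem' := by
    rintro c x ⟨hx, hx'⟩
    refine ⟨?_, fun e he => by simp [hx' e he]⟩
    simp only [Pi.smul_apply, smul_eq_mul, mul_smul, ← Finset.smul_sum, hx, smul_zero]

variable {Γ : FeynmanGraph V E} {S T : Finset E}

theorem cycles_mono (h : S ⊆ T) : Γ.cycles S ≤ Γ.cycles T := fun _ hx =>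
  ⟨hx.1, fun e he => hx.2 e fun h' => he (h h')⟩

/-- Extension by zero puts all cycle spaces inside one space, so that loop numbers are compared
through inclusions of submodules. -/
theorem h1_eq_finrank_cycles (Γ : FeynmanGraph V E) (S : Finset E) :
    Γ.h1 S = Module.finrank ℚ (Γ.cycles S) := by
  have key : ∀ x : S → ℚ, ∑ e : E, (if h : e ∈ S then x ⟨e, h⟩ else 0) •
      (Pi.single (Γ.tgt e) 1 - Pi.single (Γ.src e) 1 : V → ℚ) = Γ.boundary S x := by
    intro x
    rw [boundary, Fintype.linearCombination_apply, Finset.univ_eq_attach,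
      ← Finset.sum_subset (Finset.subset_univ S), ← Finset.sum_attach]
    · exact Finset.sum_congr rfl fun e _ => by simp
    · intro e _ he; simp [he]
  refine LinearEquiv.finrank_eq
    { toFun := fun x => ⟨fun e => if h : e ∈ S then x.1 ⟨e, h⟩ else 0, ?_, ?_⟩
      map_add' := ?_
      map_smul' := ?_
      invFun := fun y => ⟨fun e => y.1 e, ?_⟩
      left_inv := ?_
      right_inv := ?_ }
  · have := key x.1
    rw [LinearMap.mem_ker.1 x.2] at this
    exact this
  · intro e he; simp [he]
  · intro x y; ext e; by_cases h : e ∈ S <;> simp [h]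
  · intro c x; ext e; by_cases h : e ∈ S <;> simp [h]
  · rw [LinearMap.mem_ker, ← key, ← y.2.1]
    refine Finset.sum_congr rfl fun e _ => ?_
    by_cases h : e ∈ S
    · simp [h]
    · simp [h, y.2.2 e h]
  · intro x; ext e; simp
  · intro y; ext e
    by_cases h : e ∈ S
    · simp [h]
    · simp [h, y.2.2 e h]

theorem h1_mono (h : S ⊆ T) : Γ.h1 S ≤ Γ.h1 T := by
  rw [h1_eq_finrank_cycles, h1_eq_finrank_cycles]
  exact Submodule.finrank_mono (cycles_mono h)

theorem h1_empty (Γ : FeynmanGraph V E) : Γ.h1 ∅ = 0 := by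
  rw [h1_eq_finrank_cycles, Submodule.finrank_eq_zero, eq_bot_iff]
  intro x hx
  exact funext fun e => hx.2 e (Finset.notMem_empty e)

theorem cycles_eq_bot (h : Γ.h1 S = 0) : Γ.cycles S = ⊥ := by
  rwa [h1_eq_finrank_cycles, Submodule.finrank_eq_zero] at h

/-- The cycles avoiding `e` are the kernel of a single linear functional, the coefficient at `e`. -/
theorem h1_le_h1_erase_add_one (S : Finset E) (e : E) : Γ.h1 S ≤ Γ.h1 (S.erase e) + 1 := by
  rw [h1_eq_finrank_cycles, h1_eq_finrank_cycles]
  set f : Γ.cycles S →ₗ[ℚ] ℚ := (LinearMap.proj e).comp (Γ.cycles S).subtype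
  have h1 := f.finrank_range_add_finrank_ker
  have h2 : Module.finrank ℚ (LinearMap.range f) ≤ 1 := by
    simpa using Submodule.finrank_le (LinearMap.range f)
  have h3 : Module.finrank ℚ (LinearMap.ker f) ≤ Module.finrank ℚ (Γ.cycles (S.erase e)) := by
    rw [(Submodule.equivMapOfInjective (Γ.cycles S).subtype Subtype.val_injective
      (LinearMap.ker f)).finrank_eq]
    refine Submodule.finrank_mono ?_
    rintro _ ⟨x, hx, rfl⟩
    refine ⟨x.2.1, fun e' he' => ?_⟩
    by_cases h : e' = e
    · subst h; exact hx
    · exact x.2.2 e' fun h' => he' (Finset.mem_erase.2 ⟨h, h'⟩)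
  omega

theorem h1_erase_lt_iff {e : E} :
    Γ.h1 (S.erase e) < Γ.h1 S ↔ ∃ x ∈ Γ.cycles S, x e ≠ 0 := by
  constructor
  · intro h
    by_contra! hx
    refine h.not_ge ?_
    rw [h1_eq_finrank_cycles, h1_eq_finrank_cycles]
    refine Submodule.finrank_mono fun x hxS => ⟨hxS.1, fun e' he' => ?_⟩
    by_cases h : e' = e
    · subst h; exact hx x hxS
    · exact hxS.2 e' fun h' => he' (Finset.mem_erase.2 ⟨h, h'⟩)
  · rintro ⟨x, hx, hxe⟩
    rw [h1_eq_finrank_cycles, h1_eq_finrank_cycles]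
    refine Submodule.finrank_lt_finrank_of_lt
      (lt_of_le_of_ne (cycles_mono (Finset.erase_subset _ _)) fun h => ?_)
    rw [← h] at hx
    exact hxe (hx.2 e (Finset.notMem_erase e S))

theorem isCore_iff : Γ.IsCore S ↔ ∀ e ∈ S, ∃ x ∈ Γ.cycles S, x e ≠ 0 :=
  forall₂_congr fun _ _ => h1_erase_lt_iff

open Classical in
/-- The largest core subgraph of `S`. -/
def coreOf (Γ : FeynmanGraph V E) (S : Finset E) : Finset E :=
  Finset.univ.filter fun e => ∃ x ∈ Γ.cycles S, x e ≠ 0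

theorem mem_coreOf {e : E} : e ∈ Γ.coreOf S ↔ ∃ x ∈ Γ.cycles S, x e ≠ 0 := by
  simp [coreOf]

theorem coreOf_subset (Γ : FeynmanGraph V E) (S : Finset E) : Γ.coreOf S ⊆ S := by
  intro e he
  obtain ⟨x, hx, hxe⟩ := mem_coreOf.1 he
  by_contra h
  exact hxe (hx.2 e h)

theorem cycles_coreOf (Γ : FeynmanGraph V E) (S : Finset E) :
    Γ.cycles (Γ.coreOf S) = Γ.cycles S := by
  refine le_antisymm (cycles_mono (Γ.coreOf_subset S)) fun x hx => ⟨hx.1, fun e he => ?_⟩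
  by_contra h
  exact he (mem_coreOf.2 ⟨x, hx, h⟩)

theorem h1_coreOf (Γ : FeynmanGraph V E) (S : Finset E) : Γ.h1 (Γ.coreOf S) = Γ.h1 S := by
  rw [h1_eq_finrank_cycles, h1_eq_finrank_cycles, cycles_coreOf]

theorem isCore_coreOf (Γ : FeynmanGraph V E) (S : Finset E) : Γ.IsCore (Γ.coreOf S) := by
  rw [isCore_iff, cycles_coreOf]
  exact fun e he => mem_coreOf.1 he

theorem IsCore.subset_coreOf (hS : Γ.IsCore S) (h : S ⊆ T) : S ⊆ Γ.coreOf T := fun e he => by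
  obtain ⟨x, hx, hxe⟩ := isCore_iff.1 hS e he
  exact mem_coreOf.2 ⟨x, cycles_mono h hx, hxe⟩

theorem IsCore.h1_lt (hT : Γ.IsCore T) (h : S ⊂ T) : Γ.h1 S < Γ.h1 T := by
  obtain ⟨e, heT, heS⟩ := Finset.exists_of_ssubset h
  exact (h1_mono (Finset.subset_erase.2 ⟨h.1, heS⟩)).trans_lt (hT e heT)

theorem IsCore.h1_erase (hS : Γ.IsCore S) {e : E} (he : e ∈ S) :
    Γ.h1 (S.erase e) + 1 = Γ.h1 S := by
  have := hS e he
  have := Γ.h1_le_h1_erase_add_one S e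
  omega

theorem h1_le_h1_inter_add (S T : Finset E) : Γ.h1 S ≤ Γ.h1 (S ∩ T) + (S \ T).card := by
  induction h : (S \ T).card generalizing S with
  | zero =>
    rw [Finset.card_eq_zero, Finset.sdiff_eq_empty_iff_subset] at h
    rw [Finset.inter_eq_left.2 h, add_zero]
  | succ n ih =>
    obtain ⟨e, he⟩ : (S \ T).Nonempty := Finset.card_pos.1 (by omega)
    have he' := Finset.mem_sdiff.1 he
    have h1 : S.erase e \ T = (S \ T).erase e := by
      ext f; simp only [Finset.mem_sdiff, Finset.mem_erase]; tauto
    have h2 : S.erase e ∩ T = S ∩ T := by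
      ext f
      simp only [Finset.mem_inter, Finset.mem_erase]
      exact ⟨fun h => ⟨h.1.2, h.2⟩, fun h => ⟨⟨fun h' => he'.2 (h' ▸ h.2), h.1⟩, h.2⟩⟩
    have h3 := ih (S.erase e) (by rw [h1, Finset.card_erase_of_mem he, h, Nat.add_sub_cancel])
    rw [h2] at h3
    have := Γ.h1_le_h1_erase_add_one S e
    omega

theorem h1_le_card_sdiff (hT : Γ.h1 T = 0) (S : Finset E) : Γ.h1 S ≤ (S \ T).card := by
  have h1 := Γ.h1_le_h1_inter_add S T
  have h2 : Γ.h1 (S ∩ T) ≤ Γ.h1 T := h1_mono Finset.inter_subset_right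
  omega

/-- A cycle pairs to zero with the coboundary of any function `χ` on vertices. -/
theorem sum_mul_sub_eq_zero {x : E → ℚ} (hx : x ∈ Γ.cycles S) (χ : V → ℚ) :
    ∑ e, x e * (χ (Γ.tgt e) - χ (Γ.src e)) = 0 := by
  have h := congrArg (fun y : V → ℚ => ∑ v, y v * χ v) hx.1
  simp only [Finset.sum_apply, Pi.smul_apply, Pi.sub_apply, smul_eq_mul, Pi.zero_apply, zero_mul,
    Finset.sum_const_zero, Finset.sum_mul] at h
  rw [Finset.sum_comm] at h
  rw [← h]
  refine Finset.sum_congr rfl fun e _ => ?_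
  simp only [mul_assoc, ← Finset.mul_sum, sub_mul, Finset.sum_sub_distrib, Pi.single_apply,
    ite_mul, one_mul, zero_mul, Finset.sum_ite_eq', Finset.mem_univ, if_true]

/-- The ends of an edge on a cycle are related by any equivalence relation which relates the ends
of the other edges of the cycle. -/
theorem rel_of_cycle {r : V → V → Prop} (hr : Equivalence r) {x : E → ℚ} (hx : x ∈ Γ.cycles S)
    {e : E} (hxe : x e ≠ 0) (h : ∀ f ∈ S, f ≠ e → r (Γ.src f) (Γ.tgt f)) :
    r (Γ.src e) (Γ.tgt e) := by
  classical
  by_contra hne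
  -- Pair with the indicator function of the class of `src e`: its coboundary vanishes on the other
  -- edges of `S`, so only the term of `e` would survive.
  have h0 := sum_mul_sub_eq_zero hx (fun v => if r (Γ.src e) v then 1 else 0)
  rw [Finset.sum_eq_single e] at h0
  · simp [hne, hr.refl, hxe] at h0
  · intro f _ hf
    by_cases hfS : f ∈ S
    · have : r (Γ.src e) (Γ.tgt f) ↔ r (Γ.src e) (Γ.src f) :=
        ⟨fun h' => hr.trans h' (hr.symm (h f hfS hf)), fun h' => hr.trans h' (h f hfS hf)⟩
      simp [this]
    · simp [hx.2 f hfS]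
  · simp

theorem linked_equivalence (Γ : FeynmanGraph V E) (S : Finset E) : Equivalence (Γ.Linked S) :=
  Relation.EqvGen.is_equivalence _

theorem linked_of_mem {e : E} (he : e ∈ S) : Γ.Linked S (Γ.src e) (Γ.tgt e) :=
  Relation.EqvGen.rel _ _ ⟨e, he, rfl, rfl⟩

/-- If the ends of all edges of `S` are linked by `T`, then linking by `S` implies linking by `T`. -/
theorem Linked.trans_of_forall {v w : V} (hvw : Γ.Linked S v w)
    (h : ∀ e ∈ S, Γ.Linked T (Γ.src e) (Γ.tgt e)) : Γ.Linked T v w := by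
  induction hvw with
  | rel a b hab => obtain ⟨e, he, rfl, rfl⟩ := hab; exact h e he
  | refl a => exact (Γ.linked_equivalence T).refl a
  | symm a b _ ih => exact (Γ.linked_equivalence T).symm ih
  | trans a b c _ _ ih1 ih2 => exact (Γ.linked_equivalence T).trans ih1 ih2

/-! ### Additivity over connected components -/

/-- The part of a cycle lying in a union of connected components is a cycle. -/
theorem restrict_mem_cycles {x : E → ℚ} (hx : x ∈ Γ.cycles S) (p : V → Prop) [DecidablePred p]
    (hp : ∀ e ∈ S, p (Γ.src e) ↔ p (Γ.tgt e)) :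
    (fun e => if p (Γ.src e) then x e else 0) ∈
      Γ.cycles (S.filter fun e => p (Γ.src e)) := by
  refine ⟨?_, fun e he => ?_⟩
  · ext u
    have h0 := congrFun hx.1 u
    simp only [Finset.sum_apply, Pi.smul_apply, Pi.sub_apply, smul_eq_mul, Pi.zero_apply] at h0 ⊢
    by_cases hu : p u
    · refine Eq.trans (Finset.sum_congr rfl fun e _ => ?_) h0
      by_cases he : p (Γ.src e)
      · simp [he]
      · by_cases heS : e ∈ S
        · have h1 : u ≠ Γ.src e := fun h => he (h ▸ hu)
          have h2 : u ≠ Γ.tgt e := fun h => he ((hp e heS).2 (h ▸ hu))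
          simp [h1, h2]
        · simp [hx.2 e heS]
    · refine Finset.sum_eq_zero fun e _ => ?_
      by_cases he : p (Γ.src e)
      · by_cases heS : e ∈ S
        · have h1 : u ≠ Γ.src e := fun h => hu (h ▸ he)
          have h2 : u ≠ Γ.tgt e := fun h => hu (h ▸ (hp e heS).1 he)
          simp [h1, h2]
        · simp [hx.2 e heS]
      · simp [he]
  · by_cases h : p (Γ.src e)
    · have : e ∉ S := fun h' => he (Finset.mem_filter.2 ⟨h', h⟩)
      simp [hx.2 e this]
    · simp [h]

theorem IsCore.filter (hS : Γ.IsCore S) (p : V → Prop) [DecidablePred p]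
    (hp : ∀ e ∈ S, p (Γ.src e) ↔ p (Γ.tgt e)) : Γ.IsCore (S.filter fun e => p (Γ.src e)) := by
  rw [isCore_iff]
  intro e he
  obtain ⟨x, hx, hxe⟩ := isCore_iff.1 hS e (Finset.mem_filter.1 he).1
  exact ⟨_, restrict_mem_cycles hx p hp, by simpa [(Finset.mem_filter.1 he).2] using hxe⟩

theorem h1_le_add_filter (p : V → Prop) [DecidablePred p]
    (hp : ∀ e ∈ S, p (Γ.src e) ↔ p (Γ.tgt e)) :
    Γ.h1 S ≤ Γ.h1 (S.filter fun e => p (Γ.src e)) + Γ.h1 (S.filter fun e => ¬ p (Γ.src e)) := by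
  simp only [h1_eq_finrank_cycles]
  refine le_trans (Submodule.finrank_mono ?_) (Submodule.finrank_add_le_finrank_add_finrank _ _)
  intro x hx
  refine Submodule.mem_sup.2 ⟨_, restrict_mem_cycles hx p hp, _,
    restrict_mem_cycles hx (fun v => ¬ p v) (fun e he => not_congr (hp e he)), ?_⟩
  ext e
  by_cases h : p (Γ.src e) <;> simp [h]

/-- A linear bound on the loop numbers of connected core subgraphs extends to all core subgraphs. -/
theorem two_mul_h1_le_card
    (h : ∀ γ : Finset E, γ.Nonempty → Γ.IsCore γ → Γ.ConnectedOn γ → 2 * Γ.h1 γ ≤ γ.card)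
    (γ : Finset E) (hγ : Γ.IsCore γ) : 2 * Γ.h1 γ ≤ γ.card := by
  classical
  induction γ using Finset.strongInduction with
  | H γ ih =>
    rcases γ.eq_empty_or_nonempty with rfl | hne
    · simp [h1_empty]
    by_cases hc : Γ.ConnectedOn γ
    · exact h γ hne hγ hc
    simp only [ConnectedOn, not_forall] at hc
    obtain ⟨v, w, ⟨e, he, hev⟩, ⟨f, hf, hfw⟩, hvw⟩ := hc
    have hE := Γ.linked_equivalence γ
    -- Both ends of an edge lie in the same component, so the component of `v` and its complement
    -- split `γ` into two smaller core subgraphs.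
    have hp : ∀ e ∈ γ, Γ.Linked γ v (Γ.src e) ↔ Γ.Linked γ v (Γ.tgt e) := fun e he =>
      ⟨fun h' => hE.trans h' (linked_of_mem he), fun h' => hE.trans h' (hE.symm (linked_of_mem he))⟩
    have h1 : Γ.Linked γ v (Γ.src e) := by
      rcases hev with rfl | rfl
      · exact hE.refl _
      · exact hE.symm (linked_of_mem he)
    have h2 : ¬ Γ.Linked γ v (Γ.src f) := by
      intro h'
      rcases hfw with rfl | rfl
      · exact hvw h'
      · exact hvw (hE.trans h' (linked_of_mem hf))
    have hs1 : (γ.filter fun e => Γ.Linked γ v (Γ.src e)) ⊂ γ :=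
      Finset.filter_ssubset.2 ⟨f, hf, h2⟩
    have hs2 : (γ.filter fun e => ¬ Γ.Linked γ v (Γ.src e)) ⊂ γ :=
      Finset.filter_ssubset.2 ⟨e, he, not_not.2 h1⟩
    have i1 := ih _ hs1 (hγ.filter _ hp)
    have i2 := ih _ hs2 (hγ.filter (fun u => ¬ Γ.Linked γ v u) fun e he => not_congr (hp e he))
    have i3 := Γ.h1_le_add_filter (Γ.Linked γ v) hp
    have i4 := Finset.card_filter_add_card_filter_not (s := γ) (fun e => Γ.Linked γ v (Γ.src e))
    omega

namespace Chart
variable (σ : Γ.Chart)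

/-! ### Combinatorics of charts -/

/-- Finiteness makes the constants found chart by chart uniform. -/
instance : Finite Γ.Chart :=
  Finite.of_injective (fun σ : Γ.Chart => (σ.flag, σ.edge)) fun σ τ h => by
    cases σ; cases τ; simp only [Prod.mk.injEq] at h; obtain ⟨rfl, rfl⟩ := h; rfl

/-- The members of the flag, together with the whole graph. -/
def layers : Finset (Finset E) := insert Finset.univ σ.flag

variable {σ} {γ δ : Finset E} {e f : E}

theorem flag_subset_layers : σ.flag ⊆ σ.layers := Finset.subset_insert _ _

theorem univ_mem_layers : Finset.univ ∈ σ.layers := Finset.mem_insert_self _ _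

theorem univ_notMem_flag : Finset.univ ∉ σ.flag := fun h => (σ.isFlag.1 _ h).2.1 rfl

theorem edge_mem_self (h : γ ∈ σ.layers) : σ.edge γ ∈ γ := σ.edge_mem γ h

theorem layers_total (hγ : γ ∈ σ.layers) (hδ : δ ∈ σ.layers) : γ ⊆ δ ∨ δ ⊆ γ := by
  rcases Finset.mem_insert.1 hγ with rfl | hγ
  · exact Or.inr (Finset.subset_univ _)
  rcases Finset.mem_insert.1 hδ with rfl | hδ
  · exact Or.inl (Finset.subset_univ _)
  exact σ.isFlag.2 _ hγ _ hδ

theorem edge_mem_iff (hγ : γ ∈ σ.layers) (hδ : δ ∈ σ.layers) : σ.edge γ ∈ δ ↔ γ ⊆ δ := by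
  refine ⟨fun h => ?_, fun h => h (edge_mem_self hγ)⟩
  by_contra hn
  have hs : δ ⊂ γ := ⟨(layers_total hγ hδ).resolve_left hn, hn⟩
  have hδ' : δ ∈ σ.flag := (Finset.mem_insert.1 hδ).resolve_left fun h' => by
    subst h'; exact hn (Finset.subset_univ _)
  exact σ.edge_notMem γ hγ δ hδ' hs h

theorem edge_injOn : Set.InjOn σ.edge σ.layers := fun _ hγ _ hδ h =>
  ((edge_mem_iff hγ hδ).1 (h ▸ edge_mem_self hδ)).antisymm
    ((edge_mem_iff hδ hγ).1 (h ▸ edge_mem_self hγ))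

theorem edge_ne_top (h : γ ∈ σ.flag) : σ.edge γ ≠ σ.top := fun h' =>
  univ_notMem_flag (edge_injOn (flag_subset_layers h) univ_mem_layers h' ▸ h)

theorem mem_chosen : f ∈ σ.chosen ↔ ∃ γ ∈ σ.layers, σ.edge γ = f := Finset.mem_image

theorem edge_mem_chosen (h : γ ∈ σ.layers) : σ.edge γ ∈ σ.chosen := mem_chosen.2 ⟨γ, h, rfl⟩

theorem top_mem_chosen : σ.top ∈ σ.chosen := edge_mem_chosen univ_mem_layers

variable (σ) in
theorem exists_up (f : E) (hf : f ≠ σ.top) :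
    ∃ γ ∈ σ.layers, (f ∈ γ ∧ f ≠ σ.edge γ) ∧
      ∀ δ ∈ σ.layers, f ∈ δ → f ≠ σ.edge δ → γ ⊆ δ := by
  obtain ⟨γ, hγ, hmin⟩ := Finset.exists_min_image (σ.layers.filter fun γ => f ∈ γ ∧ f ≠ σ.edge γ)
    Finset.card ⟨Finset.univ, by simpa [univ_mem_layers, top] using hf⟩
  simp only [Finset.mem_filter] at hγ hmin
  refine ⟨γ, hγ.1, hγ.2, fun δ hδ h1 h2 => ?_⟩
  rcases layers_total hγ.1 hδ with h | h
  · exact h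
  · exact (Finset.eq_of_subset_of_card_le h (hmin δ ⟨hδ, h1, h2⟩)).ge

open Classical in
/-- The chosen edge of the smallest layer that contains `f` and in which `f` is not chosen. -/
def parent (σ : Γ.Chart) (f : E) : E :=
  if hf : f = σ.top then σ.top else σ.edge (σ.exists_up f hf).choose

theorem exists_parent (hf : f ≠ σ.top) :
    ∃ γ ∈ σ.layers, (f ∈ γ ∧ f ≠ σ.edge γ) ∧
      (∀ δ ∈ σ.layers, f ∈ δ → f ≠ σ.edge δ → γ ⊆ δ) ∧ σ.parent f = σ.edge γ := by
  refine ⟨(σ.exists_up f hf).choose, (σ.exists_up f hf).choose_spec.1,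
    (σ.exists_up f hf).choose_spec.2.1, (σ.exists_up f hf).choose_spec.2.2, ?_⟩
  rw [parent, dif_neg hf]

theorem parent_mem_chosen (hf : f ≠ σ.top) : σ.parent f ∈ σ.chosen := by
  obtain ⟨γ, hγ, -, -, h⟩ := exists_parent hf
  exact h ▸ edge_mem_chosen hγ

/-- The layers form a chain, so those containing `f` without choosing it are exactly the ones above
the smallest of them, whose chosen edge is the parent. -/
theorem parent_mem_iff (hf : f ≠ σ.top) (hδ : δ ∈ σ.layers) :
    σ.parent f ∈ δ ↔ f ∈ δ ∧ f ≠ σ.edge δ := by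
  obtain ⟨γ, hγ, ⟨h1, h2⟩, hmin, h⟩ := exists_parent hf
  rw [h, edge_mem_iff hγ hδ]
  refine ⟨fun hs => ⟨hs h1, fun he => ?_⟩, fun h' => hmin δ hδ h'.1 h'.2⟩
  have : δ ⊆ γ := (edge_mem_iff hδ hγ).1 (he ▸ h1)
  exact h2 (hs.antisymm this ▸ he)

/-- The recursion for the blowing down: every homogeneous coordinate is the product of a
coordinate of the chart and the homogeneous coordinate of its parent. -/
theorem toProj_eq_mul {K : Type*} [CommSemiring K] (z : E → K) (hf : f ≠ σ.top) :
    σ.toProj z f = z f * σ.toProj z (σ.parent f) := by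
  simp only [toProj, if_pos (parent_mem_chosen hf), mul_one]
  by_cases hc : f ∈ σ.chosen
  · obtain ⟨γ, hγ, rfl⟩ := mem_chosen.1 hc
    have hγ' : γ ∈ σ.flag := (Finset.mem_insert.1 hγ).resolve_left fun h => hf (h ▸ rfl)
    -- If `f` is the chosen edge of `γ`, the flag members containing `f` are those containing its
    -- parent, together with `γ`.
    have : σ.flag.filter (fun δ => σ.edge γ ∈ δ) =
        insert γ (σ.flag.filter fun δ => σ.parent (σ.edge γ) ∈ δ) := by
      ext δ
      simp only [Finset.mem_filter, Finset.mem_insert]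
      constructor
      · rintro ⟨h1, h2⟩
        by_cases h : δ = γ
        · exact Or.inl h
        · refine Or.inr ⟨h1, (parent_mem_iff hf (flag_subset_layers h1)).2 ⟨h2, fun h3 => h ?_⟩⟩
          exact (edge_injOn hγ (flag_subset_layers h1) h3).symm
      · rintro (rfl | ⟨h1, h2⟩)
        · exact ⟨hγ', edge_mem_self hγ⟩
        · exact ⟨h1, ((parent_mem_iff hf (flag_subset_layers h1)).1 h2).1⟩
    rw [this, Finset.prod_insert, if_pos hc, mul_one]
    rw [Finset.mem_filter, parent_mem_iff hf hγ]
    tauto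
  · rw [if_neg hc, mul_comm]
    congr 2
    refine Finset.filter_congr fun δ hδ => ?_
    rw [parent_mem_iff hf (flag_subset_layers hδ)]
    exact ⟨fun h => ⟨h, fun h' => hc (h' ▸ edge_mem_chosen (flag_subset_layers hδ))⟩, fun h => h.1⟩

theorem toProj_top {K : Type*} [CommSemiring K] (z : E → K) : σ.toProj z σ.top = 1 := by
  rw [toProj, if_pos top_mem_chosen, mul_one]
  refine Finset.prod_eq_one fun γ hγ => ?_
  rw [Finset.mem_filter] at hγ
  exact absurd (Finset.eq_univ_iff_forall.1 (Finset.univ_subset_iff.1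
    ((edge_mem_iff univ_mem_layers (flag_subset_layers hγ.1)).1 hγ.2)))
    fun h => (σ.isFlag.1 γ hγ.1).2.1 (Finset.eq_univ_iff_forall.2 h)

/-- The parent relation is well-founded. -/
theorem parent_induction {P : E → Prop} (top : P σ.top)
    (step : ∀ f, f ≠ σ.top → P (σ.parent f) → P f) (f : E) : P f := by
  -- The number of layers containing `f` without choosing it drops strictly at the parent.
  induction h : (σ.layers.filter fun γ => f ∈ γ ∧ f ≠ σ.edge γ).card using
    Nat.strong_induction_on generalizing f with
  | _ n ih =>
    by_cases hf : f = σ.top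
    · exact hf ▸ top
    refine step f hf (ih _ ?_ _ rfl)
    obtain ⟨γ, hγ, h1, -, hp⟩ := exists_parent hf
    rw [← h]
    refine Finset.card_lt_card (Finset.ssubset_iff_of_subset ?_ |>.2 ⟨γ, ?_, ?_⟩)
    · intro δ hδ
      rw [Finset.mem_filter] at hδ ⊢
      exact ⟨hδ.1, (parent_mem_iff hf hδ.1).1 hδ.2.1⟩
    · exact Finset.mem_filter.2 ⟨hγ, h1⟩
    · rw [Finset.mem_filter, hp]; tauto

/-- The product of homogeneous coordinates in terms of the coordinates of a chart. -/
theorem prod_toProj {K : Type*} [CommSemiring K] (z : E → K) (S : Finset E) :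
    ∏ e ∈ S, σ.toProj z e =
      (∏ γ ∈ σ.flag, z (σ.edge γ) ^ (S ∩ γ).card) * ∏ e ∈ S \ σ.chosen, z e := by
  simp only [toProj, Finset.prod_mul_distrib]
  congr 1
  · simp only [Finset.prod_filter]
    rw [Finset.prod_comm]
    refine Finset.prod_congr rfl fun γ _ => ?_
    rw [← Finset.prod_filter, Finset.prod_const, Finset.filter_mem_eq_inter]
  · rw [← Finset.filter_notMem_eq_sdiff, Finset.prod_filter]
    exact Finset.prod_congr rfl fun e _ => by by_cases h : e ∈ σ.chosen <;> simp [h]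

theorem prod_ne_top {K : Type*} [CommMonoid K] (z : E → K) :
    ∏ f : {f : E // f ≠ σ.top}, z f =
      (∏ γ ∈ σ.flag, z (σ.edge γ)) * ∏ e ∈ Finset.univ \ σ.chosen, z e := by
  have h1 : ∏ f : {f : E // f ≠ σ.top}, z f = ∏ f ∈ Finset.univ.erase σ.top, z f :=
    (Finset.prod_subtype _ (by simp) _).symm
  have h2 : Finset.univ.erase σ.top = σ.flag.image σ.edge ∪ (Finset.univ \ σ.chosen) := by
    ext f
    have : f ∈ σ.chosen ↔ f = σ.top ∨ f ∈ σ.flag.image σ.edge := by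
      rw [chosen, Finset.image_insert, Finset.mem_insert]; rfl
    simp only [Finset.mem_erase, Finset.mem_univ, and_true, Finset.mem_union, Finset.mem_sdiff,
      true_and, this]
    refine ⟨fun h => ?_, ?_⟩
    · tauto
    · rintro (h | h)
      · obtain ⟨γ, hγ, rfl⟩ := Finset.mem_image.1 h
        exact edge_ne_top hγ
      · tauto
  rw [h1, h2, Finset.prod_union, Finset.prod_image]
  · exact fun γ hγ δ hδ h => edge_injOn (flag_subset_layers hγ) (flag_subset_layers hδ) h
  · rw [Finset.disjoint_left]
    intro f hf
    obtain ⟨γ, hγ, rfl⟩ := Finset.mem_image.1 hf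
    simp [edge_mem_chosen (flag_subset_layers hγ)]

/-! ### The spanning tree of a chart -/

theorem isCore_of_mem_layers (hcore : Γ.IsCore Finset.univ) (h : γ ∈ σ.layers) : Γ.IsCore γ := by
  rcases Finset.mem_insert.1 h with rfl | h
  · exact hcore
  · exact (σ.isFlag.1 γ h).2.2

theorem subset_erase_edge (hγ : γ ∈ σ.layers) (hδ : δ ∈ σ.layers) (h : δ ⊂ γ) :
    δ ⊆ γ.erase (σ.edge γ) :=
  Finset.subset_erase.2 ⟨h.1, fun h' => h.2 ((edge_mem_iff hγ hδ).1 h')⟩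

/-- In a maximal flag, the next smaller member is obtained by deleting the chosen edge. -/
theorem coreOf_erase_edge_mem (hcore : Γ.IsCore Finset.univ) (hγ : γ ∈ σ.layers)
    (hne : (Γ.coreOf (γ.erase (σ.edge γ))).Nonempty) :
    Γ.coreOf (γ.erase (σ.edge γ)) ∈ σ.flag := by
  set X := Γ.coreOf (γ.erase (σ.edge γ))
  have hXγ : X ⊆ γ.erase (σ.edge γ) := Γ.coreOf_subset _
  -- Comparability with the whole flag, so that maximality applies: a member below `γ` avoids the
  -- chosen edge and is core, hence lies in `X`; any other member contains `γ`.
  have hcmp : ∀ δ ∈ σ.flag, δ ⊆ X ∨ X ⊆ δ := by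
    intro δ hδ
    have hδ' := flag_subset_layers hδ
    by_cases h : δ ⊂ γ
    · exact Or.inl ((isCore_of_mem_layers hcore hδ').subset_coreOf (subset_erase_edge hγ hδ' h))
    · right
      refine hXγ.trans ((Finset.erase_subset _ _).trans ?_)
      rcases layers_total hγ hδ' with h' | h'
      · exact h'
      · by_contra h''
        exact h ⟨h', h''⟩
  have hflag : Γ.IsFlag (insert X σ.flag) := by
    constructor
    · intro δ hδ
      rcases Finset.mem_insert.1 hδ with rfl | hδ
      · refine ⟨hne, fun h => ?_, Γ.isCore_coreOf _⟩
        have := hXγ (h ▸ Finset.mem_univ (σ.edge γ))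
        exact Finset.notMem_erase _ _ this
      · exact σ.isFlag.1 δ hδ
    · intro δ hδ δ' hδ'
      rcases Finset.mem_insert.1 hδ with h1 | h1 <;> rcases Finset.mem_insert.1 hδ' with h2 | h2
      · exact Or.inl (h1.trans h2.symm).le
      · exact h1 ▸ (hcmp δ' h2).symm
      · exact h2 ▸ hcmp δ h1
      · exact σ.isFlag.2 δ h1 δ' h2
  rw [← σ.maximal _ hflag (Finset.subset_insert _ _)]
  exact Finset.mem_insert_self _ _

/-- The loop number of a layer is the number of edges chosen in it. -/
theorem h1_eq_card_inter_chosen (hcore : Γ.IsCore Finset.univ) (hγ : γ ∈ σ.layers) :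
    Γ.h1 γ = (γ ∩ σ.chosen).card := by
  induction γ using Finset.strongInduction with
  | H γ ih =>
    have he := edge_mem_self hγ
    have hXγ := Γ.coreOf_subset (γ.erase (σ.edge γ))
    have h1 : Γ.h1 γ = Γ.h1 (Γ.coreOf (γ.erase (σ.edge γ))) + 1 := by
      rw [h1_coreOf, (isCore_of_mem_layers hcore hγ).h1_erase he]
    have h2 : γ ∩ σ.chosen =
        insert (σ.edge γ) (Γ.coreOf (γ.erase (σ.edge γ)) ∩ σ.chosen) := by
      ext f
      rw [Finset.mem_insert, Finset.mem_inter, Finset.mem_inter]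
      constructor
      · rintro ⟨h3, h4⟩
        obtain ⟨δ, hδ, rfl⟩ := mem_chosen.1 h4
        by_cases h : δ = γ
        · exact Or.inl (h ▸ rfl)
        · have hδγ : δ ⊂ γ := ((edge_mem_iff hδ hγ).1 h3).ssubset_of_ne h
          exact Or.inr ⟨(isCore_of_mem_layers hcore hδ).subset_coreOf
            (subset_erase_edge hγ hδ hδγ) (edge_mem_self hδ), h4⟩
      · rintro (rfl | ⟨h3, h4⟩)
        · exact ⟨he, edge_mem_chosen hγ⟩
        · exact ⟨Finset.erase_subset _ _ (hXγ h3), h4⟩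
    have h3 : σ.edge γ ∉ Γ.coreOf (γ.erase (σ.edge γ)) ∩ σ.chosen := fun h =>
      Finset.notMem_erase _ _ (hXγ (Finset.mem_inter.1 h).1)
    rw [h2, Finset.card_insert_of_notMem h3, h1]
    rcases (Γ.coreOf (γ.erase (σ.edge γ))).eq_empty_or_nonempty with h | h
    · rw [h, h1_empty, Finset.empty_inter, Finset.card_empty]
    · rw [ih _ (hXγ.trans_ssubset (Finset.erase_ssubset he))
        (flag_subset_layers (coreOf_erase_edge_mem hcore hγ h))]

/-- The edges which are not chosen in a chart form a spanning tree. -/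
theorem isSpanningTree (hconn : Γ.Connected) (hcore : Γ.IsCore Finset.univ) (σ : Γ.Chart) :
    Γ.IsSpanningTree (Finset.univ \ σ.chosen) := by
  constructor
  · have h1 : ∀ γ ∈ σ.layers, Γ.cycles (γ \ σ.chosen) = ⊥ := by
      intro γ
      induction γ using Finset.strongInduction with
      | H γ ih =>
        intro hγ
        have hXγ := Γ.coreOf_subset (γ.erase (σ.edge γ))
        set X := Γ.coreOf (γ.erase (σ.edge γ)) with hX
        have h2 : γ \ σ.chosen ⊆ γ.erase (σ.edge γ) := fun f hf => by
          rw [Finset.mem_sdiff] at hf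
          exact Finset.mem_erase.2 ⟨fun h => hf.2 (h ▸ edge_mem_chosen hγ), hf.1⟩
        have h3 : Γ.cycles (γ \ σ.chosen) ≤ Γ.cycles (X \ σ.chosen) := by
          intro x hx
          refine ⟨hx.1, fun e he => ?_⟩
          by_cases heX : e ∈ X
          · refine hx.2 e fun h => he (Finset.mem_sdiff.2 ⟨heX, (Finset.mem_sdiff.1 h).2⟩)
          · have := cycles_mono h2 hx
            rw [← cycles_coreOf] at this
            exact this.2 e heX
        rcases X.eq_empty_or_nonempty with h | h
        · rw [h, Finset.empty_sdiff, cycles_eq_bot Γ.h1_empty] at h3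
          exact eq_bot_iff.2 h3
        · rw [ih X (hXγ.trans_ssubset (Finset.erase_ssubset (edge_mem_self hγ)))
            (flag_subset_layers (coreOf_erase_edge_mem hcore hγ h))] at h3
          exact eq_bot_iff.2 h3
    rw [h1_eq_finrank_cycles, h1 _ univ_mem_layers, finrank_bot]
  · have h1 : ∀ γ ∈ σ.layers, Γ.Linked (Finset.univ \ σ.chosen)
        (Γ.src (σ.edge γ)) (Γ.tgt (σ.edge γ)) := by
      intro γ
      induction γ using Finset.strongInduction with
      | H γ ih =>
        intro hγ
        obtain ⟨x, hx, hxe⟩ :=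
          isCore_iff.1 (isCore_of_mem_layers hcore hγ) _ (edge_mem_self hγ)
        refine rel_of_cycle (Γ.linked_equivalence _) hx hxe fun f hf hne => ?_
        by_cases hc : f ∈ σ.chosen
        · obtain ⟨δ, hδ, rfl⟩ := mem_chosen.1 hc
          exact ih δ (((edge_mem_iff hδ hγ).1 hf).ssubset_of_ne fun h => hne (h ▸ rfl)) hδ
        · exact linked_of_mem (by simpa using hc)
    intro v w
    refine (hconn v w).trans_of_forall fun e _ => ?_
    by_cases hc : e ∈ σ.chosen
    · obtain ⟨γ, hγ, rfl⟩ := mem_chosen.1 hc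
      exact h1 γ hγ
    · exact linked_of_mem (by simpa using hc)

/-! ### The graph polynomial in a chart -/

open Classical in
/-- The equation of the strict transform of the graph hypersurface in a chart. -/
def strictPsi {K : Type*} [CommSemiring K] (σ : Γ.Chart) (z : E → K) : K :=
  ∑ T ∈ Finset.univ.filter (fun T : Finset E => Γ.IsSpanningTree T),
    (∏ γ ∈ σ.flag, z (σ.edge γ) ^ (((Finset.univ \ T) ∩ γ).card - Γ.h1 γ)) *
      ∏ e ∈ (Finset.univ \ T) \ σ.chosen, z e

/-- The monomial `∏ z_γ ^ h_1(γ)`. -/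
def loopMonomial {K : Type*} [CommMonoid K] (σ : Γ.Chart) (z : E → K) : K :=
  ∏ γ ∈ σ.flag, z (σ.edge γ) ^ Γ.h1 γ

open Classical in
theorem sum_toProj_eq {K : Type*} [CommSemiring K] (σ : Γ.Chart) (z : E → K) :
    ∑ T ∈ Finset.univ.filter (fun T : Finset E => Γ.IsSpanningTree T),
      ∏ e ∈ Finset.univ \ T, σ.toProj z e = σ.loopMonomial z * σ.strictPsi z := by
  rw [strictPsi, Finset.mul_sum]
  refine Finset.sum_congr rfl fun T hT => ?_
  rw [prod_toProj, ← mul_assoc, loopMonomial, ← Finset.prod_mul_distrib]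
  congr 1
  refine Finset.prod_congr rfl fun γ _ => ?_
  rw [← pow_add]
  congr 1
  -- A forest misses at least h_1(γ) edges of `γ`; hence the natural subtraction in `strictPsi` is
  -- never truncated.
  have h := Γ.h1_le_card_sdiff (Finset.mem_filter.1 hT).2.1 γ
  have h' : (Finset.univ \ T) ∩ γ = γ \ T := by ext; simp [and_comm]
  rw [h']
  omega

theorem eval_psi_toProj (σ : Γ.Chart) (z : E → ℂ) :
    MvPolynomial.eval (σ.toProj z) Γ.psi = σ.loopMonomial z * σ.strictPsi z := by
  rw [← sum_toProj_eq, psi]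
  simp

theorem bind₁_psi_toProj (σ : Γ.Chart) :
    MvPolynomial.bind₁ (σ.toProj (MvPolynomial.X : E → MvPolynomial E ℂ)) Γ.psi =
      σ.loopMonomial MvPolynomial.X * σ.strictPsi MvPolynomial.X := by
  rw [← sum_toProj_eq, psi]
  simp

/-- All terms are non-negative, and the spanning tree of unchosen edges contributes exactly 1: its
complement meets `γ` in h_1(γ) edges, so every exponent vanishes. This positivity keeps the chains
away from X_Γ. -/
theorem one_le_strictPsi (hconn : Γ.Connected) (hcore : Γ.IsCore Finset.univ) (σ : Γ.Chart)
    (z : E → ℝ) (hz : ∀ e, 0 ≤ z e) : 1 ≤ σ.strictPsi z := by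
  classical
  have hnn : ∀ T : Finset E, 0 ≤
      (∏ γ ∈ σ.flag, z (σ.edge γ) ^ (((Finset.univ \ T) ∩ γ).card - Γ.h1 γ)) *
        ∏ e ∈ (Finset.univ \ T) \ σ.chosen, z e := fun T =>
    mul_nonneg (Finset.prod_nonneg fun γ _ => pow_nonneg (hz _) _)
      (Finset.prod_nonneg fun e _ => hz e)
  have h := Finset.single_le_sum (fun T _ => hnn T)
    (Finset.mem_filter.2 ⟨Finset.mem_univ _, isSpanningTree hconn hcore σ⟩)
  refine le_trans (le_of_eq ?_) h
  have h1 : Finset.univ \ (Finset.univ \ σ.chosen) = σ.chosen := by ext; simp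
  rw [h1, Finset.sdiff_self, Finset.prod_empty, mul_one]
  refine (Finset.prod_eq_one fun γ hγ => ?_).symm
  rw [h1_eq_card_inter_chosen hcore (flag_subset_layers hγ), Finset.inter_comm, Nat.sub_self,
    pow_zero]

theorem strictPsi_ofReal (σ : Γ.Chart) (z : E → ℝ) :
    σ.strictPsi (fun e => (z e : ℂ)) = (σ.strictPsi z : ℝ) := by
  simp [strictPsi]

theorem continuous_strictPsi (σ : Γ.Chart) : Continuous (fun z : E → ℂ => σ.strictPsi z) := by
  unfold strictPsi
  fun_prop

end Chart


/-! ### Existence of a chart in which a given positive point has small coordinates -/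

/-- Every set of edges has an edge in its top layer with respect to a flag, with maximal
coordinate among those. -/
theorem IsFlag.exists_max_edge {C : Finset (Finset E)} (hC : Γ.IsFlag C) (a : E → ℝ)
    {γ : Finset E} (hγ : γ.Nonempty) :
    ∃ e ∈ γ, (∀ δ ∈ C, δ ⊂ γ → e ∉ δ) ∧ ∀ f ∈ γ, (∀ δ ∈ C, δ ⊂ γ → f ∉ δ) → a f ≤ a e := by
  have hne : (γ.filter fun f => ∀ δ ∈ C, δ ⊂ γ → f ∉ δ).Nonempty := by
    rcases (C.filter fun δ => δ ⊂ γ).eq_empty_or_nonempty with h | h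
    · obtain ⟨f, hf⟩ := hγ
      refine ⟨f, Finset.mem_filter.2 ⟨hf, fun δ hδ hs => ?_⟩⟩
      exact absurd (Finset.mem_filter.2 ⟨hδ, hs⟩) (h ▸ Finset.notMem_empty δ)
    · obtain ⟨δ₀, hδ₀, hmax⟩ := Finset.exists_max_image _ Finset.card h
      simp only [Finset.mem_filter] at hδ₀ hmax
      obtain ⟨f, hf, hf'⟩ := Finset.exists_of_ssubset hδ₀.2
      refine ⟨f, Finset.mem_filter.2 ⟨hf, fun δ hδ hs hfδ => hf' ?_⟩⟩
      rcases hC.2 δ hδ δ₀ hδ₀.1 with h' | h'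
      · exact h' hfδ
      · rwa [Finset.eq_of_subset_of_card_le h' (hmax δ ⟨hδ, hs⟩)]
  obtain ⟨e, he, hmax⟩ := Finset.exists_max_image _ a hne
  simp only [Finset.mem_filter] at he hmax
  exact ⟨e, he.1, he.2, fun f hf h => hmax f ⟨hf, h⟩⟩

/-- Relative sector decomposition: a positive point has a chart, whose flag contains a given one,
in which its coordinates not belonging to the given flag are at most one. -/
theorem IsFlag.exists_chart {C : Finset (Finset E)} (hC : Γ.IsFlag C) [Nonempty E]
    (hcore : Γ.IsCore Finset.univ) (a : E → ℝ) :
    ∃ σ : Γ.Chart, C ⊆ σ.flag ∧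
      ∀ f, f ≠ σ.top → f ∉ σ.fibre C → a f ≤ a (σ.parent f) := by
  classical
  choose! edge hmem hnot hmax using fun (γ : Finset E) (hγ : γ.Nonempty) => hC.exists_max_edge a hγ
  -- Greedy construction: remove an edge with the largest coordinate among those lying in no smaller
  -- member of `C`, and pass to the core. Each step lowers the loop number by one.
  let s : ℕ → Finset E := fun n =>
    (fun γ => Γ.coreOf (γ.erase (edge γ)))^[n] Finset.univ
  have s0 : s 0 = Finset.univ := rfl
  have ss : ∀ n, s (n + 1) = Γ.coreOf ((s n).erase (edge (s n))) := fun n =>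
    Function.iterate_succ_apply' _ n _
  have score : ∀ n, Γ.IsCore (s n) := by
    intro n
    cases n with
    | zero => exact hcore
    | succ n => rw [ss]; exact Γ.isCore_coreOf _
  have ssub : ∀ n, s (n + 1) ⊆ (s n).erase (edge (s n)) := fun n => by
    rw [ss]; exact Γ.coreOf_subset _
  have santi : Antitone s := antitone_nat_of_succ_le fun n =>
    (ssub n).trans (Finset.erase_subset _ _)
  have sstrict : ∀ n, (s n).Nonempty → s (n + 1) ⊂ s n := fun n hn =>
    (ssub n).trans_ssubset (Finset.erase_ssubset (hmem _ hn))
  have sh1 : ∀ n, (s n).Nonempty → Γ.h1 (s (n + 1)) + 1 = Γ.h1 (s n) := fun n hn => by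
    rw [ss, h1_coreOf, (score n).h1_erase (hmem _ hn)]
  have sempty : ∃ n, s n = ∅ := by
    by_contra! hn
    have hd : ∀ n, (s n).card + n ≤ (s 0).card := by
      intro n
      induction n with
      | zero => simp
      | succ n ih =>
        have := Finset.card_lt_card (sstrict n (hn n))
        omega
    have := hd ((s 0).card + 1)
    omega
  have last : ∀ X : Finset E, X.Nonempty → ∃ n, X ⊆ s n ∧ ¬ X ⊆ s (n + 1) := by
    intro X hX
    by_contra! h
    obtain ⟨n, hn⟩ := sempty
    have hall : ∀ n, X ⊆ s n := by
      intro n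
      induction n with
      | zero => rw [s0]; exact Finset.subset_univ _
      | succ n ih => exact h n ih
    have := hall n
    rw [hn] at this
    exact hX.ne_empty (Finset.subset_empty.1 this)
  let F : Finset (Finset E) :=
    Finset.univ.filter fun γ : Finset E => γ.Nonempty ∧ γ ≠ Finset.univ ∧ ∃ n, γ = s n
  have hF : ∀ {γ}, γ ∈ F ↔ γ.Nonempty ∧ γ ≠ Finset.univ ∧ ∃ n, γ = s n := by simp [F]
  have hF' : ∀ {γ}, γ ∈ insert Finset.univ F → γ.Nonempty ∧ ∃ n, γ = s n := by
    intro γ hγ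
    rcases Finset.mem_insert.1 hγ with rfl | hγ
    · exact ⟨Finset.univ_nonempty, 0, rfl⟩
    · exact ⟨(hF.1 hγ).1, (hF.1 hγ).2.2⟩
  have hflag : Γ.IsFlag F := by
    constructor
    · intro γ hγ
      obtain ⟨h1, h2, n, rfl⟩ := hF.1 hγ
      exact ⟨h1, h2, score n⟩
    · intro γ hγ δ hδ
      obtain ⟨-, -, n, rfl⟩ := hF.1 hγ
      obtain ⟨-, -, k, rfl⟩ := hF.1 hδ
      rcases le_total n k with h | h
      · exact Or.inr (santi h)
      · exact Or.inl (santi h)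
  have hmaximal : ∀ D : Finset (Finset E), Γ.IsFlag D → F ⊆ D → D = F := by
    intro D hD hFD
    refine Finset.Subset.antisymm (fun X hX => ?_) hFD
    obtain ⟨hX1, hX2, hX3⟩ := hD.1 X hX
    obtain ⟨n, hn, hn'⟩ := last X hX1
    refine hF.2 ⟨hX1, hX2, n, ?_⟩
    by_contra hne
    have hlt : Γ.h1 X < Γ.h1 (s n) := (score n).h1_lt (hn.ssubset_of_ne hne)
    have hsn : (s n).Nonempty := hX1.mono hn
    have hs : s (n + 1) ⊂ X := by
      refine Finset.ssubset_iff_subset_ne.2 ⟨?_, fun h => hn' h.ge⟩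
      rcases (s (n + 1)).eq_empty_or_nonempty with h | h
      · rw [h]; exact Finset.empty_subset _
      · have : s (n + 1) ∈ F := hF.2 ⟨h, fun h' => (sstrict n hsn).2 (h' ▸ Finset.subset_univ _),
          n + 1, rfl⟩
        exact (hD.2 _ (hFD this) X hX).resolve_right hn'
    -- A core graph strictly between two consecutive terms would have loop number strictly between
    -- consecutive integers.
    have h2 : Γ.h1 (s (n + 1)) < Γ.h1 X := hX3.h1_lt hs
    have := sh1 n hsn
    omega
  have hCF : C ⊆ F := by
    intro X hX
    obtain ⟨hX1, hX2, hX3⟩ := hC.1 X hX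
    obtain ⟨n, hn, hn'⟩ := last X hX1
    refine hF.2 ⟨hX1, hX2, n, ?_⟩
    by_contra hne
    -- The edge removed from `s n` avoids the smaller members of `C`, so `X` survives into `s (n +
    -- 1)`, against the choice of `n`.
    refine hn' ?_
    rw [ss]
    exact hX3.subset_coreOf (Finset.subset_erase.2
      ⟨hn, hnot _ (hX1.mono hn) X hX (hn.ssubset_of_ne hne)⟩)
  let σ : Γ.Chart :=
    { flag := F
      isFlag := hflag
      maximal := hmaximal
      edge := edge
      edge_mem := fun γ hγ => hmem γ (hF' hγ).1
      edge_notMem := by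
        intro γ hγ δ hδ hs he
        obtain ⟨h1, n, rfl⟩ := hF' hγ
        obtain ⟨-, -, k, rfl⟩ := hF.1 hδ
        have hk : n + 1 ≤ k := by
          by_contra! h
          exact hs.2 (santi (Nat.lt_succ_iff.1 h))
        exact Finset.notMem_erase _ _ (ssub n (santi hk he)) }
  refine ⟨σ, hCF, fun f hf hfC => ?_⟩
  obtain ⟨γ, hγ, ⟨h1, h2⟩, hmin, hp⟩ := Chart.exists_parent hf
  rw [hp]
  -- If `f` lay in a member of `C` strictly below `γ`, minimality of `γ` would make `f` its chosen
  -- edge, hence a fibre coordinate. So `f` competed in the choice of the edge of `γ`.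
  refine hmax γ ⟨f, h1⟩ f h1 fun δ hδ hs hfδ => ?_
  have hδ' : δ ∈ σ.layers := Chart.flag_subset_layers (hCF hδ)
  exact hs.2 (hmin δ hδ' hfδ fun h => hfC (Finset.mem_image.2 ⟨δ, hδ, h.symm⟩))


/-! ### Homogeneity of the graph polynomial -/

theorem exists_path_of_linked {T : Finset E} {v w : V} (h : Γ.Linked T v w) :
    ∃ x : E → ℚ, (∑ e, x e • (Pi.single (Γ.tgt e) 1 - Pi.single (Γ.src e) 1 : V → ℚ) =
      Pi.single w 1 - Pi.single v 1) ∧ ∀ e, e ∉ T → x e = 0 := by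
  induction h with
  | rel a b h =>
    obtain ⟨e, he, rfl, rfl⟩ := h
    refine ⟨Pi.single e 1, ?_, fun f hf => ?_⟩
    · rw [Finset.sum_eq_single e]
      · simp
      · intro f _ hf; simp [hf]
      · simp
    · exact Pi.single_eq_of_ne (fun h : f = e => hf (h ▸ he)) _
  | refl a => exact ⟨0, by simp, fun _ _ => rfl⟩
  | symm a b _ ih =>
    obtain ⟨x, hx, hx'⟩ := ih
    refine ⟨-x, ?_, fun e he => by simp [hx' e he]⟩
    simp only [Pi.neg_apply, neg_smul, Finset.sum_neg_distrib, hx, neg_sub]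
  | trans a b c _ _ ih1 ih2 =>
    obtain ⟨x, hx, hx'⟩ := ih1
    obtain ⟨y, hy, hy'⟩ := ih2
    refine ⟨x + y, ?_, fun e he => by simp [hx' e he, hy' e he]⟩
    simp only [Pi.add_apply, add_smul, Finset.sum_add_distrib, hx, hy]
    abel

/-- Every edge outside the tree closes a cycle with a path in the tree, so removing it lowers the
loop number. -/
theorem IsSpanningTree.card_sdiff_le {T : Finset E} (hT : Γ.IsSpanningTree T) (S : Finset E)
    (hS : T ⊆ S) : (S \ T).card ≤ Γ.h1 S := by
  induction h : (S \ T).card generalizing S with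
  | zero => exact Nat.zero_le _
  | succ n ih =>
    obtain ⟨e, he⟩ : (S \ T).Nonempty := Finset.card_pos.1 (by omega)
    have he' := Finset.mem_sdiff.1 he
    have h1 : S.erase e \ T = (S \ T).erase e := by
      ext f; simp only [Finset.mem_sdiff, Finset.mem_erase]; tauto
    have h2 := ih (S.erase e) (Finset.subset_erase.2 ⟨hS, he'.2⟩)
      (by rw [h1, Finset.card_erase_of_mem he, h, Nat.add_sub_cancel])
    have h3 : Γ.h1 (S.erase e) < Γ.h1 S := by
      rw [h1_erase_lt_iff]
      obtain ⟨x, hx, hx'⟩ := exists_path_of_linked (hT.2 (Γ.src e) (Γ.tgt e))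
      refine ⟨x - Pi.single e 1, ⟨?_, fun f hf => ?_⟩, ?_⟩
      · simp only [Pi.sub_apply, sub_smul, Finset.sum_sub_distrib, hx]
        rw [Finset.sum_eq_single e]
        · simp
        · intro f _ hf; simp [hf]
        · simp
      · have hfe : f ≠ e := fun h => hf (h ▸ he'.1)
        simp [hx' f fun h => hf (hS h), hfe]
      · simp [hx' e he'.2]
    omega

theorem IsSpanningTree.card_compl {T : Finset E} (hT : Γ.IsSpanningTree T) :
    (Finset.univ \ T).card = Γ.h1 Finset.univ :=
  le_antisymm (hT.card_sdiff_le _ (Finset.subset_univ _)) (h1_le_card_sdiff hT.1 _)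

theorem psi_isHomogeneous (Γ : FeynmanGraph V E) :
    Γ.psi.IsHomogeneous (Γ.h1 Finset.univ) := by
  classical
  refine MvPolynomial.IsHomogeneous.sum _ _ _ fun T hT => ?_
  rw [← (Finset.mem_filter.1 hT).2.card_compl, Finset.card_eq_sum_ones]
  exact MvPolynomial.IsHomogeneous.prod _ _ _ fun e _ => MvPolynomial.isHomogeneous_X _ _

theorem eval_smul_of_isHomogeneous {G : MvPolynomial E ℂ} {d : ℕ} (hG : G.IsHomogeneous d) (c : ℂ)
    (A : E → ℂ) : MvPolynomial.eval (c • A) G = c ^ d * MvPolynomial.eval A G := by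
  rw [MvPolynomial.eval_eq', MvPolynomial.eval_eq', Finset.mul_sum]
  refine Finset.sum_congr rfl fun s hs => ?_
  have h : s.degree = d := (DFunLike.congr_fun Finsupp.degree_eq_weight_one s).trans
    (hG (MvPolynomial.mem_support_iff.1 hs))
  rw [Finsupp.degree_eq_sum] at h
  simp only [Pi.smul_apply, smul_eq_mul, mul_pow, Finset.prod_mul_distrib,
    Finset.prod_pow_eq_pow_sum]
  rw [h]
  ring

/-! ### The coefficient of ω relative to Ω/∏A_e, and its bounds in charts -/

/-- The coefficient of the form `ω = (G / ψ ^ m) Ω` with respect to `Ω / ∏ A_e`. -/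
def logCoeff (Γ : FeynmanGraph V E) (G : MvPolynomial E ℂ) (m : ℕ) (A : E → ℂ) : ℂ :=
  MvPolynomial.eval A G * (∏ e, A e) / MvPolynomial.eval A Γ.psi ^ m

theorem eval_psi_smul (c : ℂ) (A : E → ℂ) : MvPolynomial.eval (c • A) Γ.psi =
    c ^ Γ.h1 Finset.univ * MvPolynomial.eval A Γ.psi := eval_smul_of_isHomogeneous Γ.psi_isHomogeneous c A

theorem logCoeff_smul {G : MvPolynomial E ℂ} {d m : ℕ} (hG : G.IsHomogeneous d)
    (hd : d + Fintype.card E = m * Γ.h1 Finset.univ) {c : ℂ} (hc : c ≠ 0) (A : E → ℂ) :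
    Γ.logCoeff G m (c • A) = Γ.logCoeff G m A := by
  have h1 : MvPolynomial.eval (c • A) G = c ^ d * MvPolynomial.eval A G := 
    eval_smul_of_isHomogeneous hG c A
  have h2 : ∏ e, (c • A) e = c ^ Fintype.card E * ∏ e, A e := by
    simp [Finset.prod_mul_distrib]
  rw [logCoeff, logCoeff, h1, h2, eval_psi_smul, mul_pow, ← pow_mul, mul_comm (Γ.h1 _) m, ← hd,
    pow_add]
  have := pow_ne_zero d hc
  have := pow_ne_zero (Fintype.card E) hc
  rw [show c ^ d * MvPolynomial.eval A G * (c ^ Fintype.card E * ∏ e, A e) =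
    (c ^ d * c ^ Fintype.card E) * (MvPolynomial.eval A G * ∏ e, A e) by ring,
    mul_div_mul_left _ _ (by positivity)]

namespace Chart

variable (σ : Γ.Chart)

/-- The form has at most logarithmic poles, expressed by divisibility of polynomials. -/
def LogDivides (σ : Γ.Chart) (G : MvPolynomial E ℂ) (m : ℕ) : Prop :=
  σ.loopMonomial (MvPolynomial.X : E → MvPolynomial E ℂ) ^ m ∣
    MvPolynomial.bind₁ (σ.toProj (MvPolynomial.X : E → MvPolynomial E ℂ)) G *
      ∏ γ ∈ σ.flag, MvPolynomial.X (σ.edge γ) ^ γ.card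

theorem map_toProj {K L : Type*} [CommSemiring K] [CommSemiring L] (φ : K →+* L) (z : E → K)
    (e : E) : φ (σ.toProj z e) = σ.toProj (fun f => φ (z f)) e := by
  simp only [toProj, map_mul, map_prod]
  split_ifs <;> simp

theorem toProj_ofReal (z : E → ℝ) (e : E) :
    σ.toProj (fun f => (z f : ℂ)) e = (σ.toProj z e : ℝ) :=
  (σ.map_toProj Complex.ofRealHom z e).symm

theorem eval_loopMonomial (z : E → ℂ) : MvPolynomial.eval z
    (σ.loopMonomial (MvPolynomial.X : E → MvPolynomial E ℂ)) = σ.loopMonomial z := by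
  simp [loopMonomial]

theorem eval_bind₁_toProj (z : E → ℂ) (G : MvPolynomial E ℂ) : MvPolynomial.eval z
    (MvPolynomial.bind₁ (σ.toProj (MvPolynomial.X : E → MvPolynomial E ℂ)) G) =
      MvPolynomial.eval (σ.toProj z) G := by
  rw [MvPolynomial.eval, MvPolynomial.eval₂Hom_bind₁]
  congr 2
  ext e
  rw [map_toProj]
  simp

/-- The powers of the exceptional coordinates in ∏A_e and in G cancel the monomial factor of ψ^m;
only the strict transform remains in the denominator. -/
theorem logCoeff_toProj {σ : Γ.Chart} {G H : MvPolynomial E ℂ} {m : ℕ}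
    (hH : MvPolynomial.bind₁ (σ.toProj (MvPolynomial.X : E → MvPolynomial E ℂ)) G *
      (∏ γ ∈ σ.flag, MvPolynomial.X (σ.edge γ) ^ γ.card) =
        σ.loopMonomial (MvPolynomial.X : E → MvPolynomial E ℂ) ^ m * H) (z : E → ℂ)
    (hz : ∀ e, z e ≠ 0) :
    Γ.logCoeff G m (σ.toProj z) = MvPolynomial.eval z H *
      (∏ e ∈ Finset.univ \ σ.chosen, z e) / σ.strictPsi z ^ m := by
  have h := congrArg (MvPolynomial.eval z) hH
  simp only [map_mul, map_pow, eval_bind₁_toProj, eval_loopMonomial, map_prod,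
    MvPolynomial.eval_X] at h
  have hl : σ.loopMonomial z ≠ 0 := Finset.prod_ne_zero_iff.2 fun γ _ => pow_ne_zero _ (hz _)
  rw [logCoeff, prod_toProj, eval_psi_toProj]
  simp only [Finset.univ_inter]
  rw [← mul_assoc, h, mul_pow, mul_assoc, mul_div_mul_left _ _ (pow_ne_zero _ hl)]

theorem eval_psi_toProj_ne_zero {σ : Γ.Chart} {z : E → ℂ} (hz : ∀ e, z e ≠ 0)
    (h : σ.strictPsi z ≠ 0) : MvPolynomial.eval (σ.toProj z) Γ.psi ≠ 0 := by
  rw [eval_psi_toProj]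
  exact mul_ne_zero (Finset.prod_ne_zero_iff.2 fun γ _ => pow_ne_zero _ (hz _)) h

/-- By uniform continuity on the closed unit polydisc, `strictPsi` has absolute value at least 1/2
within `δ` of the real cube, where it is at least 1; the numerator is a polynomial. -/
theorem exists_bound_of_chart (hconn : Γ.Connected) (hcore : Γ.IsCore Finset.univ)
    {G : MvPolynomial E ℂ} {m : ℕ} (hG : σ.LogDivides G m) :
    ∃ δ M : ℝ, 0 < δ ∧ ∀ z : E → ℂ, (∀ e, z e ≠ 0) → (∀ e, ‖z e‖ ≤ 1) →
      (∃ y : E → ℝ, ∀ e, 0 ≤ y e ∧ y e ≤ 1 ∧ ‖z e - y e‖ < δ) →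
      MvPolynomial.eval (σ.toProj z) Γ.psi ≠ 0 ∧ ‖Γ.logCoeff G m (σ.toProj z)‖ ≤ M := by
  obtain ⟨H, hH⟩ := hG
  have hcpt : IsCompact (Metric.closedBall (0 : E → ℂ) 1) := isCompact_closedBall _ _
  obtain ⟨δ, hδ, hunif⟩ := Metric.uniformContinuousOn_iff.1
    (hcpt.uniformContinuousOn_of_continuous σ.continuous_strictPsi.continuousOn) (1 / 2)
    (by norm_num)
  obtain ⟨M, hM⟩ := hcpt.exists_bound_of_continuousOn
    (f := fun z : E → ℂ => MvPolynomial.eval z H * ∏ e ∈ Finset.univ \ σ.chosen, z e)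
    (Continuous.continuousOn (by
      have := MvPolynomial.continuous_eval (p := H)
      fun_prop))
  refine ⟨δ, M * 2 ^ m, hδ, fun z hz hz1 ⟨y, hy⟩ => ?_⟩
  have hzb : z ∈ Metric.closedBall (0 : E → ℂ) 1 := by
    rw [mem_closedBall_zero_iff, pi_norm_le_iff_of_nonneg zero_le_one]; exact hz1
  have hyb : (fun e => (y e : ℂ)) ∈ Metric.closedBall (0 : E → ℂ) 1 := by
    rw [mem_closedBall_zero_iff, pi_norm_le_iff_of_nonneg zero_le_one]
    intro e
    rw [Complex.norm_real, Real.norm_of_nonneg (hy e).1]; exact (hy e).2.1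
  have hdist : dist z (fun e => (y e : ℂ)) < δ := by
    rw [dist_pi_lt_iff hδ]
    intro e
    rw [dist_eq_norm]; exact (hy e).2.2
  have h1 := hunif z hzb _ hyb hdist
  rw [dist_eq_norm, strictPsi_ofReal] at h1
  have h2 : (1 : ℝ) ≤ ‖((σ.strictPsi y : ℝ) : ℂ)‖ := by
    rw [Complex.norm_real]
    exact (one_le_strictPsi hconn hcore σ y fun e => (hy e).1).trans (le_abs_self _)
  have h3 : 1 / 2 ≤ ‖σ.strictPsi z‖ := by
    have := norm_sub_norm_le ((σ.strictPsi y : ℝ) : ℂ) (σ.strictPsi z)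
    rw [norm_sub_rev] at this
    linarith
  have h4 : σ.strictPsi z ≠ 0 := norm_pos_iff.1 (by linarith)
  refine ⟨eval_psi_toProj_ne_zero hz h4, ?_⟩
  rw [logCoeff_toProj hH z hz, norm_div, norm_pow, div_le_iff₀ (by positivity)]
  have h5 : (1 : ℝ) ≤ 2 ^ m * ‖σ.strictPsi z‖ ^ m := by
    rw [← mul_pow]
    exact one_le_pow₀ (by linarith)
  have h6 := hM z hzb
  have h7 : 0 ≤ M := (norm_nonneg _).trans h6
  calc _ ≤ M * 1 := by rw [mul_one]; exact h6
    _ ≤ M * (2 ^ m * ‖σ.strictPsi z‖ ^ m) := mul_le_mul_of_nonneg_left h5 h7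
    _ = _ := by ring

/-- The coordinates of a positive point in a chart. -/
def coords (σ : Γ.Chart) (a : E → ℝ) (f : E) : ℝ := if f = σ.top then 1 else a f / a (σ.parent f)

variable {σ}

theorem coords_top (a : E → ℝ) : σ.coords a σ.top = 1 := if_pos rfl

theorem coords_pos {a : E → ℝ} (ha : ∀ e, 0 < a e) (f : E) : 0 < σ.coords a f := by
  unfold coords
  split_ifs
  · exact one_pos
  · exact div_pos (ha _) (ha _)

theorem toProj_coords {a : E → ℝ} (ha : ∀ e, 0 < a e) (e : E) :
    σ.toProj (σ.coords a) e = a e / a σ.top := by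
  induction e using parent_induction (σ := σ) with
  | top => rw [toProj_top, div_self (ha _).ne']
  | step f hf ih =>
    rw [toProj_eq_mul _ hf, ih, coords, if_neg hf, div_mul_div_cancel₀ (ha _).ne']

theorem toProj_pos {z : E → ℝ} (hz : ∀ e, 0 < z e) (e : E) : 0 < σ.toProj z e := by
  unfold toProj
  refine mul_pos (Finset.prod_pos fun γ _ => hz _) ?_
  split_ifs
  · exact one_pos
  · exact hz e

theorem coord_eq_div {z : E → ℝ} (hz : ∀ e, 0 < z e) {f : E} (hf : f ≠ σ.top) :
    z f = σ.toProj z f / σ.toProj z (σ.parent f) := by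
  rw [toProj_eq_mul z hf, mul_div_cancel_right₀ _ (toProj_pos hz _).ne']

/-! ### Rescaling the fibre coordinates -/

/-- Multiply the fibre coordinate belonging to `γ` by `l γ`, for all `γ` in `C`. -/
def scaleFibre {K : Type*} [CommMonoid K] (σ : Γ.Chart) (C : Finset (Finset E))
    (l : Finset E → K) (z : E → K) : E → K := fun f => z f * ∏ γ ∈ C with σ.edge γ = f, l γ

theorem scaleFibre_of_notMem {K : Type*} [CommMonoid K] {C : Finset (Finset E)}
    (l : Finset E → K) (z : E → K) {f : E} (hf : f ∉ σ.fibre C) :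
    σ.scaleFibre C l z f = z f := by
  rw [scaleFibre, Finset.filter_eq_empty_iff.2, Finset.prod_empty, mul_one]
  exact fun γ hγ h => hf (Finset.mem_image.2 ⟨γ, hγ, h⟩)

theorem scaleFibre_edge {K : Type*} [CommMonoid K] {C : Finset (Finset E)} (hC : C ⊆ σ.flag)
    (l : Finset E → K) (z : E → K) {γ : Finset E} (hγ : γ ∈ C) :
    σ.scaleFibre C l z (σ.edge γ) = z (σ.edge γ) * l γ := by
  have : (C.filter fun δ => σ.edge δ = σ.edge γ) = {γ} := by
    ext δ
    simp only [Finset.mem_filter, Finset.mem_singleton]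
    refine ⟨fun h => edge_injOn (flag_subset_layers (hC h.1)) (flag_subset_layers (hC hγ)) h.2, ?_⟩
    rintro rfl
    exact ⟨hγ, rfl⟩
  rw [scaleFibre, this, Finset.prod_singleton]

theorem top_notMem_fibre {C : Finset (Finset E)} (hC : C ⊆ σ.flag) : σ.top ∉ σ.fibre C := by
  intro h
  obtain ⟨γ, hγ, h⟩ := Finset.mem_image.1 h
  exact edge_ne_top (hC hγ) h

/-- Rescaling the fibre coordinates acts on homogeneous coordinates in a way which does not depend
on the chart. -/
theorem toProj_scaleFibre {K : Type*} [CommSemiring K] {C : Finset (Finset E)} (hC : C ⊆ σ.flag)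
    (l : Finset E → K) (z : E → K) (e : E) :
    σ.toProj (σ.scaleFibre C l z) e = σ.toProj z e * ∏ γ ∈ C with e ∈ γ, l γ := by
  induction e using parent_induction (σ := σ) with
  | top =>
    rw [toProj_top, toProj_top, Finset.filter_eq_empty_iff.2, Finset.prod_empty, mul_one]
    intro γ hγ h
    exact (σ.isFlag.1 γ (hC hγ)).2.1 (Finset.univ_subset_iff.1
      ((edge_mem_iff univ_mem_layers (flag_subset_layers (hC hγ))).1 h))
  | step f hf ih =>
    rw [toProj_eq_mul _ hf, ih, toProj_eq_mul z hf, scaleFibre]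
    have h1 : (C.filter fun γ => f ∈ γ) =
        (C.filter fun γ => σ.edge γ = f) ∪ (C.filter fun γ => σ.parent f ∈ γ) := by
      ext γ
      simp only [Finset.mem_union, Finset.mem_filter]
      constructor
      · rintro ⟨h1, h2⟩
        by_cases h : f = σ.edge γ
        · exact Or.inl ⟨h1, h.symm⟩
        · exact Or.inr ⟨h1, (parent_mem_iff hf (flag_subset_layers (hC h1))).2 ⟨h2, h⟩⟩
      · rintro (⟨h1, rfl⟩ | ⟨h1, h2⟩)
        · exact ⟨h1, edge_mem_self (flag_subset_layers (hC h1))⟩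
        · exact ⟨h1, ((parent_mem_iff hf (flag_subset_layers (hC h1))).1 h2).1⟩
    rw [h1, Finset.prod_union]
    · ring
    · rw [Finset.disjoint_left]
      intro γ hγ hγ'
      rw [Finset.mem_filter] at hγ hγ'
      exact ((parent_mem_iff hf (flag_subset_layers (hC hγ.1))).1 hγ'.2).2 hγ.2.symm

end Chart

theorem exists_pos_le_of_finite {ι : Type*} [Finite ι] (f : ι → ℝ) (hf : ∀ i, 0 < f i) :
    ∃ δ, 0 < δ ∧ ∀ i, δ ≤ f i := by
  obtain ⟨D, hD⟩ := Finite.exists_le fun i => (f i)⁻¹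
  refine ⟨(max D 1)⁻¹, by positivity, fun i => ?_⟩
  rw [inv_le_comm₀ (by positivity) (hf i)]
  exact (hD i).trans (le_max_left _ _)

/-- The logarithmic coefficient is bounded near the real points of the unit cubes in all charts. -/
theorem exists_bound (hconn : Γ.Connected) (hcore : Γ.IsCore Finset.univ)
    {G : MvPolynomial E ℂ} {d m : ℕ} (hhom : G.IsHomogeneous d)
    (hd : d + Fintype.card E = m * Γ.h1 Finset.univ) (hG : ∀ σ : Γ.Chart, σ.LogDivides G m) :
    ∃ δ M : ℝ, 0 < δ ∧ 0 ≤ M ∧ ∀ (σ : Γ.Chart) (c : ℂ) (z : E → ℂ), c ≠ 0 → (∀ e, z e ≠ 0) →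
      (∀ e, ‖z e‖ ≤ 1) → (∃ y : E → ℝ, ∀ e, 0 ≤ y e ∧ y e ≤ 1 ∧ ‖z e - y e‖ < δ) →
      MvPolynomial.eval (c • σ.toProj z) Γ.psi ≠ 0 ∧
        ‖Γ.logCoeff G m (c • σ.toProj z)‖ ≤ M := by
  choose δ M hδ h using fun σ : Γ.Chart => σ.exists_bound_of_chart hconn hcore (hG σ)
  obtain ⟨δ₀, hδ₀, hle⟩ := exists_pos_le_of_finite δ hδ
  obtain ⟨M₀, hM₀⟩ := Finite.exists_le M
  refine ⟨δ₀, max M₀ 0, hδ₀, le_max_right _ _, fun σ c z hc hz hz1 ⟨y, hy⟩ => ?_⟩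
  obtain ⟨h1, h2⟩ := h σ z hz hz1
    ⟨y, fun e => ⟨(hy e).1, (hy e).2.1, (hy e).2.2.trans_le (hle σ)⟩⟩
  rw [eval_psi_smul, logCoeff_smul hhom hd hc]
  exact ⟨mul_ne_zero (pow_ne_zero _ hc) h1, h2.trans ((hM₀ σ).trans (le_max_left _ _))⟩


namespace Chart

/-! ### The Jacobian of a chart -/

/-- The exponents of the coordinates of a chart in the homogeneous coordinates, with a row of ones
for the chosen edge of the top layer. -/
def exponents (σ : Γ.Chart) (f j : E) : ℂ :=
  if f = σ.top then 1
  else ((σ.toProj (fun g => if g = f then (Polynomial.X : Polynomial ℤ) else 1) j).natDegree : ℂ)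

variable {σ : Γ.Chart}

theorem exponents_top (f : E) : σ.exponents f σ.top = if f = σ.top then 1 else 0 := by
  simp [exponents, toProj_top]

theorem toProj_ne_zero {K : Type*} [CommRing K] [IsDomain K] {z : E → K} (hz : ∀ e, z e ≠ 0)
    (e : E) : σ.toProj z e ≠ 0 := by
  unfold toProj
  refine mul_ne_zero (Finset.prod_ne_zero_iff.2 fun γ _ => hz _) ?_
  split_ifs
  · exact one_ne_zero
  · exact hz e

/-- Additivity of degrees turns the multiplicative recursion of `toProj` along parents into an
additive one. -/
theorem exponents_eq_add (f : E) {j : E} (hj : j ≠ σ.top) :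
    σ.exponents f j = (if j = f then 1 else 0) + σ.exponents f (σ.parent j) := by
  simp only [exponents]
  by_cases hf : f = σ.top
  · simp [hf, hj]
  · rw [if_neg hf, if_neg hf, toProj_eq_mul _ hj]
    have hz : ∀ g, (if g = f then (Polynomial.X : Polynomial ℤ) else 1) ≠ 0 := by
      intro g; split_ifs
      · exact Polynomial.X_ne_zero
      · exact one_ne_zero
    rw [Polynomial.natDegree_mul (hz _) (toProj_ne_zero hz _), Nat.cast_add]
    congr 1
    split_ifs <;> simp

/-- For `v` in the left kernel, subtracting the column of the parent from the column of `j` leaves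
v_j = 0; the column of the top edge gives the remaining coordinate. -/
theorem det_exponents_ne_zero (σ : Γ.Chart) : (Matrix.of σ.exponents).det ≠ 0 := by
  intro h
  obtain ⟨v, hv, hv0⟩ := Matrix.exists_vecMul_eq_zero_iff.2 h
  refine hv (funext fun j => ?_)
  have h0 : ∀ j, ∑ f, v f * σ.exponents f j = 0 := fun j => congrFun hv0 j
  by_cases hj : j = σ.top
  · have := h0 j
    simpa [hj, exponents_top] using this
  · have h1 := h0 j
    simp only [exponents_eq_add _ hj, mul_add, Finset.sum_add_distrib, h0, add_zero] at h1
    simpa using h1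

theorem prod_ite_top {K : Type*} [CommMonoid K] (σ : Γ.Chart) (z : E → K) :
    ∏ f, (if f = σ.top then 1 else z f) = ∏ f : {f : E // f ≠ σ.top}, z f := by
  rw [← Finset.prod_erase Finset.univ (a := σ.top) (by simp),
    Finset.prod_subtype (p := fun f => f ≠ σ.top) _ (by simp)]
  exact Finset.prod_congr rfl fun f _ => if_neg f.2

theorem X_mul_pderiv_toProj {f : E} (hf : f ≠ σ.top) (j : E) :
    MvPolynomial.X f * MvPolynomial.pderiv f
        (σ.toProj (MvPolynomial.X : E → MvPolynomial E ℂ) j) =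
      σ.toProj (MvPolynomial.X : E → MvPolynomial E ℂ) j * MvPolynomial.C (σ.exponents f j) := by
  induction j using parent_induction (σ := σ) with
  | top => simp [toProj_top, exponents_top, hf]
  | step j hj ih =>
    rw [toProj_eq_mul _ hj, Derivation.leibniz, smul_eq_mul, smul_eq_mul, mul_add,
      mul_left_comm, ih, exponents_eq_add f hj, map_add, MvPolynomial.pderiv_X]
    by_cases h : j = f
    · subst h
      simp; ring
    · simp [h]; ring

/-- Multiplying row `f` by z_f turns its derivatives into z_f ∂/∂z_f, which acts on monomials by
their exponents. The monomials then factor out of the columns and a constant matrix remains. The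
unchosen coordinates occur once on both sides and are cancelled. -/
theorem prod_X_mul_chartJacobian (σ : Γ.Chart) :
    (∏ γ ∈ σ.flag, MvPolynomial.X (σ.edge γ)) * chartJacobian σ =
      MvPolynomial.C (Matrix.of σ.exponents).det * ∏ γ ∈ σ.flag, MvPolynomial.X (σ.edge γ) ^ γ.card := by
  have h1 : (∏ f : {f : E // f ≠ σ.top}, (MvPolynomial.X (f : E) : MvPolynomial E ℂ)) *
      chartJacobian σ = MvPolynomial.C (Matrix.of σ.exponents).det *
        ∏ j, σ.toProj (MvPolynomial.X : E → MvPolynomial E ℂ) j := by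
    rw [← prod_ite_top σ (fun f => (MvPolynomial.X f : MvPolynomial E ℂ)), chartJacobian,
      ← Matrix.det_mul_column, RingHom.map_det, mul_comm, ← Matrix.det_mul_row]
    congr 1
    ext1 f j
    simp only [Matrix.of_apply, RingHom.mapMatrix_apply, Matrix.map_apply]
    by_cases hf : f = σ.top
    · simp [hf, exponents]
    · rw [if_neg hf, if_neg hf, X_mul_pderiv_toProj hf]
  rw [prod_ne_top (fun f => (MvPolynomial.X f : MvPolynomial E ℂ)), prod_toProj] at h1
  simp only [Finset.univ_inter] at h1
  have h2 : ∏ e ∈ Finset.univ \ σ.chosen, (MvPolynomial.X e : MvPolynomial E ℂ) ≠ 0 :=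
    Finset.prod_ne_zero_iff.2 fun e _ => MvPolynomial.X_ne_zero e
  refine mul_right_cancel₀ h2 ?_
  rw [mul_right_comm, h1, mul_assoc]

/-! ### Logarithmic poles as divisibility -/

theorem logDivides_of_hasLogPoles {G : MvPolynomial E ℂ} {m : ℕ} (h : Γ.HasLogPoles G m)
    (σ : Γ.Chart) : σ.LogDivides G m := by
  rw [LogDivides, loopMonomial, ← Finset.prod_pow]
  refine Finset.prod_dvd_of_isRelPrime ?_ fun γ hγ => ?_
  · intro γ hγ δ hδ hne
    -- Powers of distinct coordinates are coprime, so divisibility can be checked for one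
    -- exceptional divisor at a time.
    refine IsRelPrime.pow (IsRelPrime.pow ?_)
    rw [(MvPolynomial.X_prime).irreducible.isRelPrime_iff_not_dvd, MvPolynomial.X_dvd_X]
    exact fun h => hne (edge_injOn (flag_subset_layers hγ) (flag_subset_layers hδ) h)
  · obtain ⟨P, Q, hQ, hPQ⟩ := h σ γ hγ
    have h1 : (MvPolynomial.X (σ.edge γ) ^ Γ.h1 γ) ^ m ∣ MvPolynomial.X (σ.edge γ) *
        (MvPolynomial.bind₁ (σ.toProj (MvPolynomial.X : E → MvPolynomial E ℂ)) G *
          chartJacobian σ) * Q := by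
      rw [hPQ, bind₁_psi_toProj]
      exact Dvd.dvd.mul_left (pow_dvd_pow_of_dvd (Dvd.dvd.mul_right
        (Finset.dvd_prod_of_mem (fun γ => MvPolynomial.X (σ.edge γ) ^ Γ.h1 γ) hγ) _) _) _
    rw [← pow_mul] at h1 ⊢
    have h2 := (MvPolynomial.X_prime).pow_dvd_of_dvd_mul_right _ hQ h1
    -- Multiplying by the other exceptional coordinates completes the product in front of the
    -- Jacobian, which then becomes a unit times the monomial of `LogDivides`.
    have h3 := h2.trans (mul_dvd_mul_right (Finset.dvd_prod_of_mem
      (fun γ => (MvPolynomial.X (σ.edge γ) : MvPolynomial E ℂ)) hγ) _)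
    rw [mul_left_comm, prod_X_mul_chartJacobian, mul_left_comm] at h3
    have hu : IsUnit (MvPolynomial.C (σ := E) (Matrix.of σ.exponents).det) :=
      (isUnit_iff_ne_zero.2 σ.det_exponents_ne_zero).map MvPolynomial.C
    exact hu.dvd_mul_left.1 h3

theorem logDivides_one_two (h : ∀ γ : Finset E, Γ.IsCore γ → 2 * Γ.h1 γ ≤ γ.card) (σ : Γ.Chart) :
    σ.LogDivides 1 2 := by
  rw [LogDivides, map_one, one_mul, loopMonomial, ← Finset.prod_pow]
  refine Finset.prod_dvd_prod_of_dvd _ _ fun γ hγ => ?_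
  rw [← pow_mul, mul_comm]
  exact pow_dvd_pow _ (h γ (σ.isFlag.1 γ hγ).2.2)

end Chart


/-! ### The pullback of the form to a tube -/

theorem det_eq_prod_diag {R : Type*} [CommRing R] (L : Matrix E E R) (F : Finset E)
    (h1 : ∀ f g, g ∉ F → f ≠ g → L f g = 0) (h2 : ∀ f ∈ F, ∀ g ∈ F, f ≠ g → L f g = 0) :
    L.det = ∏ f, L f f := by
  rw [Matrix.det_apply', Finset.sum_eq_single 1]
  · simp
  -- A permutation with non-zero contribution fixes everything outside `F`, hence preserves `F`, and
  -- is the identity there since that block is diagonal.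
  · intro π _ hπ
    obtain ⟨i, hi⟩ : ∃ i, L (π i) i = 0 := by
      by_contra! hne
      have h3 : ∀ i, i ∉ F → π i = i := fun i hi => by
        by_contra h
        exact hne i (h1 _ _ hi h)
      refine hπ (Equiv.ext fun i => ?_)
      by_cases hi : i ∈ F
      · by_cases hi' : π i ∈ F
        · by_contra h
          exact hne i (h2 _ hi' _ hi h)
        · exact π.injective (h3 _ hi')
      · exact h3 i hi
    exact mul_eq_zero_of_right _
      (Finset.prod_eq_zero (f := fun i => L (π i) i) (Finset.mem_univ i) hi)
  · simp

namespace Chart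

variable {σ : Γ.Chart}

/-- Logarithmic differentiation of a monomial, carried out along the parent recursion. -/
theorem hasFDerivAt_toProj {ζ : σ.Param → E → ℂ} {D : E → σ.Param →L[ℝ] ℂ} {t : σ.Param}
    (hD : ∀ f, HasFDerivAt (fun s => ζ s f) (D f) t) (h0 : ∀ f, ζ t f ≠ 0) (htop : D σ.top = 0)
    (j : E) : HasFDerivAt (fun s => σ.toProj (ζ s) j)
      (σ.toProj (ζ t) j • ∑ g, (σ.exponents g j * (ζ t g)⁻¹) • D g) t := by
  induction j using parent_induction (σ := σ) with
  | top =>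
    simp only [toProj_top]
    refine (hasFDerivAt_const _ _).congr_fderiv ?_
    rw [Finset.sum_eq_zero, smul_zero]
    intro g _
    ext v
    by_cases h : g = σ.top
    · simp [h, htop]
    · simp [exponents_top, h]
  | step j hj ih =>
    simp only [toProj_eq_mul _ hj]
    refine ((hD j).mul ih).congr_fderiv ?_
    ext v
    simp only [exponents_eq_add _ hj, add_mul, add_apply,
      smul_apply, sum_apply, smul_eq_mul,
      Finset.sum_add_distrib, ite_mul, one_mul, zero_mul, Finset.sum_ite_eq, Finset.mem_univ,
      if_true]
    linear_combination (-(σ.toProj (ζ t) (σ.parent j) * D j v)) * mul_inv_cancel₀ (h0 j)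

/-- The Jacobian is the matrix of logarithmic derivatives of the coordinates times the exponent
matrix, with columns scaled by `toProj`. The radii of the fibre coordinates in `F` may depend on
base parameters, but the first factor is still triangular, so these mixed derivatives do not
contribute. -/
theorem pullback_toProj {G : MvPolynomial E ℂ} {m : ℕ} {ζ : σ.Param → E → ℂ}
    {D : E → σ.Param →L[ℝ] ℂ} {t : σ.Param} (F : Finset E) (hF : σ.top ∉ F)
    (hD : ∀ f, HasFDerivAt (fun s => ζ s f) (D f) t) (h0 : ∀ f, ζ t f ≠ 0) (htop : D σ.top = 0)
    (h1 : ∀ (f : {f : E // f ≠ σ.top}) (g : E), g ∉ F → (f : E) ≠ g → D g (Pi.single f 1) = 0)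
    (h2 : ∀ (f : {f : E // f ≠ σ.top}), (f : E) ∈ F → ∀ g ∈ F, (f : E) ≠ g →
      D g (Pi.single f 1) = 0) :
    Γ.pullback G m σ.top (fun s => σ.toProj (ζ s)) t =
      Γ.logCoeff G m (σ.toProj (ζ t)) * ((Matrix.of σ.exponents).det *
        ∏ f : {f : E // f ≠ σ.top}, (ζ t f)⁻¹ * D f (Pi.single f 1)) := by
  set L : Matrix E E ℂ := Matrix.of fun f g =>
    if h : f = σ.top then (if g = σ.top then 1 else 0)
    else (ζ t g)⁻¹ * D g (Pi.single ⟨f, h⟩ 1) with hL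
  have hdL : L.det = ∏ f : {f : E // f ≠ σ.top}, (ζ t f)⁻¹ * D f (Pi.single f 1) := by
    rw [det_eq_prod_diag L F]
    · rw [← Finset.prod_erase Finset.univ (a := σ.top) (by simp [hL]),
        Finset.prod_subtype (p := fun f => f ≠ σ.top) _ (by simp)]
      exact Finset.prod_congr rfl fun f _ => by simp [hL, f.2]
    · intro f g hg hfg
      by_cases hf : f = σ.top
      · subst hf; simp [hL, hfg.symm]
      · simp [hL, hf, h1 ⟨f, hf⟩ g hg hfg]
    · intro f hf g hg hfg
      have hf' : f ≠ σ.top := fun h => hF (h ▸ hf)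
      simp [hL, hf', h2 ⟨f, hf'⟩ hf g hg hfg]
  have hder : ∀ v j, fderiv ℝ (fun s => σ.toProj (ζ s)) t v j =
      σ.toProj (ζ t) j * ∑ g, (σ.exponents g j * (ζ t g)⁻¹) * D g v := by
    intro v j
    rw [(hasFDerivAt_pi.2 fun j => hasFDerivAt_toProj hD h0 htop j).fderiv]
    simp
  have hM : (Matrix.of fun f j : E => if h : f = σ.top then σ.toProj (ζ t) j
      else fderiv ℝ (fun s => σ.toProj (ζ s)) t (Pi.single ⟨f, h⟩ 1) j) =
      Matrix.of fun f j => σ.toProj (ζ t) j * (L * Matrix.of σ.exponents) f j := by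
    ext1 f j
    simp only [Matrix.of_apply, Matrix.mul_apply]
    by_cases hf : f = σ.top
    · subst hf
      rw [dif_pos rfl, Finset.sum_eq_single σ.top]
      · simp [hL, exponents]
      · intro g _ hg; simp [hL, hg]
      · simp
    · rw [dif_neg hf, hder]
      congr 1
      refine Finset.sum_congr rfl fun g _ => ?_
      simp only [hL, Matrix.of_apply, dif_neg hf]
      ring
  rw [pullback, hM, Matrix.det_mul_row, Matrix.det_mul, hdL, logCoeff]
  ring

/-- The open set of parameters of a tube where the coordinates along the base are positive. -/
def posParam (σ : Γ.Chart) (C : Finset (Finset E)) : Set σ.Param :=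
  {t | ∀ f : {f : E // f ≠ σ.top}, (f : E) ∉ σ.fibre C → 0 < t f}

theorem isOpen_posParam (σ : Γ.Chart) (C : Finset (Finset E)) : IsOpen (σ.posParam C) := by
  simp only [posParam, Set.ofPred_forall]
  refine isOpen_iInter_of_finite fun f => isOpen_iInter_of_finite fun _ => ?_
  exact isOpen_lt continuous_const (continuous_apply f)

/-- The coordinates in the chart of a point of a tube. -/
def tubeCoord (σ : Γ.Chart) (g : Γ.ToricMetric) (C : Finset (Finset E)) (η : ℝ) (t : σ.Param)
    (f : E) : ℂ :=
  if h : f = σ.top then 1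
  else if f ∈ σ.fibre C then
    ((η / g.weight σ f (σ.point C 0 t) : ℝ) : ℂ) * Complex.exp (Complex.I * (t ⟨f, h⟩ : ℂ))
  else (t ⟨f, h⟩ : ℂ)

theorem point_nonneg {C : Finset (Finset E)} {t : σ.Param} (ht : t ∈ σ.posParam C) {x : ℝ}
    (hx : 0 ≤ x) (e : E) : 0 ≤ σ.point C x t e := by
  unfold point
  split_ifs with h1 h2
  · exact zero_le_one
  · exact hx
  · exact (ht ⟨e, h1⟩ h2).le

theorem point_pos {C : Finset (Finset E)} {t : σ.Param} (ht : t ∈ σ.posParam C) {x : ℝ}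
    (hx : 0 < x) (e : E) : 0 < σ.point C x t e := by
  unfold point
  split_ifs with h1 h2
  · exact zero_lt_one
  · exact hx
  · exact ht ⟨e, h1⟩ h2

theorem contDiffOn_weight_point (g : Γ.ToricMetric) (C : Finset (Finset E)) {f : E}
    (hf : f ≠ σ.top) : ContDiffOn ℝ 1 (fun t : σ.Param => g.weight σ f (σ.point C 0 t))
      (σ.posParam C) := by
  refine (g.contDiffOn σ f hf).comp (g := g.weight σ f) (f := fun t => σ.point C 0 t) ?_
    fun t ht => point_nonneg ht le_rfl
  refine (contDiff_pi.2 fun e => ?_).contDiffOn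
  unfold point
  split_ifs
  · exact contDiff_const
  · exact contDiff_const
  · exact contDiff_apply ℝ ℝ _

theorem weight_point_pos (g : Γ.ToricMetric) {C : Finset (Finset E)} {f : E} (hf : f ≠ σ.top)
    {t : σ.Param} (ht : t ∈ σ.posParam C) : 0 < g.weight σ f (σ.point C 0 t) :=
  g.pos σ f hf _ (point_nonneg ht le_rfl)

theorem tubeCoord_ne_zero (g : Γ.ToricMetric) {C : Finset (Finset E)} {η : ℝ} (hη : 0 < η)
    {t : σ.Param} (ht : t ∈ σ.posParam C) (f : E) : σ.tubeCoord g C η t f ≠ 0 := by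
  unfold tubeCoord
  split_ifs with h1 h2
  · exact one_ne_zero
  · exact mul_ne_zero (Complex.ofReal_ne_zero.2 (div_pos hη (weight_point_pos g h1 ht)).ne')
      (Complex.exp_ne_zero _)
  · exact Complex.ofReal_ne_zero.2 (ht ⟨f, h1⟩ h2).ne'

theorem exists_hasFDerivAt_tubeCoord (g : Γ.ToricMetric) {C : Finset (Finset E)} (η : ℝ)
    {t : σ.Param} (ht : t ∈ σ.posParam C) (f : E) :
    ∃ D : σ.Param →L[ℝ] ℂ, HasFDerivAt (fun s => σ.tubeCoord g C η s f) D t ∧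
      (f = σ.top → D = 0) ∧
      (f ∉ σ.fibre C → ∀ k : {f : E // f ≠ σ.top}, (k : E) ≠ f → D (Pi.single k 1) = 0) ∧
      (f ∉ σ.fibre C → ∀ k : {f : E // f ≠ σ.top}, (k : E) = f → D (Pi.single k 1) = 1) ∧
      (f ∈ σ.fibre C → ∀ k : {f : E // f ≠ σ.top}, (k : E) ∈ σ.fibre C → (k : E) ≠ f →
        D (Pi.single k 1) = 0) ∧
      (f ∈ σ.fibre C → ∀ k : {f : E // f ≠ σ.top}, (k : E) = f →
        D (Pi.single k 1) = Complex.I * σ.tubeCoord g C η t f) := by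
  by_cases h1 : f = σ.top
  · refine ⟨0, ?_, fun _ => rfl, fun _ _ _ => rfl, fun _ k hk => absurd (hk.trans h1) k.2,
      fun _ _ _ _ => rfl, fun _ k hk => absurd (hk.trans h1) k.2⟩
    simp only [tubeCoord, dif_pos h1]
    exact hasFDerivAt_const _ _
  have hproj : HasFDerivAt (fun s : σ.Param => (s ⟨f, h1⟩ : ℂ))
      (Complex.ofRealCLM.comp
      (ContinuousLinearMap.proj (R := ℝ) (φ := fun _ : {f : E // f ≠ σ.top} => ℝ) ⟨f, h1⟩)) t :=
    Complex.ofRealCLM.hasFDerivAt.comp t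
      (ContinuousLinearMap.proj (R := ℝ) (φ := fun _ : {f : E // f ≠ σ.top} => ℝ) ⟨f, h1⟩).hasFDerivAt
  by_cases h2 : f ∈ σ.fibre C
  · have hw := ((contDiffOn_weight_point g C h1).contDiffAt
      ((σ.isOpen_posParam C).mem_nhds ht)).differentiableAt one_ne_zero
    have hr : DifferentiableAt ℝ (fun s : σ.Param => η / g.weight σ f (σ.point C 0 s)) t :=
      by simpa only [div_eq_mul_inv] using (hw.fun_inv (weight_point_pos g h1 ht).ne').const_mul η
    -- The radius is evaluated at a point with all fibre coordinates set to zero, so it does not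
    -- depend on the angles.
    have hr0 : ∀ k : {f : E // f ≠ σ.top}, (k : E) ∈ σ.fibre C →
        fderiv ℝ (fun s : σ.Param => η / g.weight σ f (σ.point C 0 s)) t (Pi.single k 1) = 0 := by
      intro k hk
      have hl := hr.hasFDerivAt.hasLineDerivAt (Pi.single k 1)
      have hc : (fun x : ℝ => η / g.weight σ f (σ.point C 0 (t + x • Pi.single k 1))) =
          fun _ => η / g.weight σ f (σ.point C 0 t) := by
        funext x
        congr 2
        funext e
        simp only [point]
        split_ifs with h3 h4
        · rfl
        · rfl
        · have : (⟨e, h3⟩ : {f : E // f ≠ σ.top}) ≠ k := fun h => h4 (by rw [← h] at hk; exact hk)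
          simp [this]
      unfold HasLineDerivAt at hl
      rw [hc] at hl
      exact hl.unique (hasDerivAt_const _ _)
    have hr' := (Complex.ofRealCLM.hasFDerivAt).comp t hr.hasFDerivAt
    have hexp := (hproj.const_mul Complex.I).cexp
    have hz : σ.tubeCoord g C η t f = ((η / g.weight σ f (σ.point C 0 t) : ℝ) : ℂ) *
        Complex.exp (Complex.I * (t ⟨f, h1⟩ : ℂ)) := by
      simp only [tubeCoord, dif_neg h1, if_pos h2]
    refine ⟨_, (hr'.mul hexp).congr_of_eventuallyEq (Filter.Eventually.of_forall fun s => ?_),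
      fun h => absurd h h1, fun h => absurd h2 h, fun h => absurd h2 h, ?_, ?_⟩
    · simp [tubeCoord, dif_neg h1, if_pos h2]
    · intro _ k hk hkf
      have : (⟨f, h1⟩ : {f : E // f ≠ σ.top}) ≠ k := fun h => hkf (by rw [← h])
      simp [hr0 k hk, this]
    · intro _ k hk
      have hk' : k = ⟨f, h1⟩ := Subtype.ext hk
      have := hr0 k (by rw [hk]; exact h2)
      rw [hz]
      simp only [add_apply, smul_apply,
        ContinuousLinearMap.comp_apply, this]
      subst hk'
      simp
      ring
  · refine ⟨_, hproj.congr_of_eventuallyEq (Filter.Eventually.of_forall fun s => ?_),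
      fun h => absurd h h1, fun _ k hk => ?_, fun _ k hk => ?_, fun h => absurd h h2,
      fun h => absurd h h2⟩
    · simp [tubeCoord, h1, h2]
    · have : (⟨f, h1⟩ : {f : E // f ≠ σ.top}) ≠ k := fun h => hk (by rw [← h])
      simp [this]
    · have hk' : k = ⟨f, h1⟩ := Subtype.ext hk
      subst hk'
      simp

theorem tubeMap_eq (g : Γ.ToricMetric) (C : Finset (Finset E)) (η : ℝ) :
    σ.tubeMap g C η = fun t => σ.toProj (σ.tubeCoord g C η t) := rfl

/-- The logarithmic derivative is i for an angle and 1/t for a base coordinate; the radii and the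
derivatives of the metric drop out. -/
theorem pullback_tubeMap (g : Γ.ToricMetric) {C : Finset (Finset E)} (hC : C ⊆ σ.flag) {η : ℝ}
    (hη : 0 < η) (G : MvPolynomial E ℂ) (m : ℕ) {t : σ.Param} (ht : t ∈ σ.posParam C) :
    Γ.pullback G m σ.top (σ.tubeMap g C η) t =
      Γ.logCoeff G m (σ.tubeMap g C η t) * ((Matrix.of σ.exponents).det *
        ∏ f : {f : E // f ≠ σ.top}, if (f : E) ∈ σ.fibre C then Complex.I else (t f : ℂ)⁻¹) := by
  choose D hD h1 h2 h3 h4 h5 using exists_hasFDerivAt_tubeCoord (σ := σ) g (C := C) η ht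
  have h0 := tubeCoord_ne_zero g hη ht
  rw [tubeMap_eq, pullback_toProj (σ.fibre C) (top_notMem_fibre hC) hD h0 (h1 _ rfl)
    (fun k f hf hk => h2 f hf k hk) (fun k hk f hf hkf => h4 f hf k hk hkf)]
  congr 2
  refine Finset.prod_congr rfl fun f _ => ?_
  split_ifs with hf
  · rw [h5 _ hf f rfl, mul_comm Complex.I, inv_mul_cancel_left₀ (h0 _)]
  · rw [h3 _ hf f rfl, mul_one]
    simp [tubeCoord, f.2, hf]

theorem continuous_toProj (σ : Γ.Chart) (e : E) : Continuous fun z : E → ℂ => σ.toProj z e := by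
  unfold toProj
  split_ifs <;> fun_prop

theorem continuousOn_tubeMap (g : Γ.ToricMetric) (C : Finset (Finset E)) (η : ℝ) :
    ContinuousOn (σ.tubeMap g C η) (σ.posParam C) := by
  rw [tubeMap_eq, continuousOn_pi]
  intro e
  refine (σ.continuous_toProj e).comp_continuousOn (continuousOn_pi.2 fun f t ht => ?_)
  obtain ⟨D, hD, -⟩ := exists_hasFDerivAt_tubeCoord (σ := σ) g (C := C) η ht f
  exact hD.continuousAt.continuousWithinAt

end Chart


/-! ### Points of tubes in good charts -/

/-- Continuity and positivity on the compact unit cube, for finitely many charts and coordinates. -/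
theorem ToricMetric.exists_weight_bounds (g : Γ.ToricMetric) :
    ∃ w W : ℝ, 0 < w ∧ 0 < W ∧ ∀ (σ : Γ.Chart) (f : E), f ≠ σ.top → ∀ z : E → ℝ,
      (∀ e, 0 ≤ z e ∧ z e ≤ 1) → w ≤ g.weight σ f z ∧ g.weight σ f z ≤ W := by
  have hcpt : IsCompact (Set.Icc (0 : E → ℝ) 1) := isCompact_Icc
  have key : ∀ p : Γ.Chart × E, ∃ w W : ℝ, 0 < w ∧ (p.2 ≠ p.1.top → ∀ z : E → ℝ,
      (∀ e, 0 ≤ z e ∧ z e ≤ 1) → w ≤ g.weight p.1 p.2 z ∧ g.weight p.1 p.2 z ≤ W) := by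
    rintro ⟨σ, f⟩
    by_cases hf : f = σ.top
    · exact ⟨1, 1, one_pos, fun h => absurd hf h⟩
    have hc : ContinuousOn (g.weight σ f) (Set.Icc 0 1) :=
      (g.contDiffOn σ f hf).continuousOn.mono fun z hz => hz.1
    have hne : (Set.Icc (0 : E → ℝ) 1).Nonempty := ⟨0, le_rfl, zero_le_one⟩
    obtain ⟨z₁, hz₁, h₁⟩ := hcpt.exists_isMinOn hne hc
    obtain ⟨z₂, hz₂, h₂⟩ := hcpt.exists_isMaxOn hne hc
    refine ⟨g.weight σ f z₁, g.weight σ f z₂, g.pos σ f hf _ hz₁.1, fun _ z hz => ?_⟩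
    have hz' : z ∈ Set.Icc (0 : E → ℝ) 1 := ⟨fun e => (hz e).1, fun e => (hz e).2⟩
    exact ⟨h₁ hz', h₂ hz'⟩
  choose w W hw h using key
  obtain ⟨w₀, hw₀, hle⟩ := exists_pos_le_of_finite w hw
  obtain ⟨W₀, hW₀⟩ := Finite.exists_le W
  refine ⟨w₀, max W₀ 1, hw₀, by positivity, fun σ f hf z hz => ?_⟩
  have := h (σ, f) hf z hz
  exact ⟨(hle _).trans this.1, this.2.trans ((hW₀ _).trans (le_max_left _ _))⟩

namespace Chart

theorem scaleFibre_pos {σ : Γ.Chart} {C : Finset (Finset E)} {l : Finset E → ℝ}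
    (hl : ∀ γ, 0 < l γ) {z : E → ℝ} (hz : ∀ e, 0 < z e) (e : E) :
    0 < σ.scaleFibre C l z e := mul_pos (hz e) (Finset.prod_pos fun _ _ => hl _)

theorem continuousOn_weight_scaleFibre (g : Γ.ToricMetric) (σ : Γ.Chart) (C : Finset (Finset E))
    {f : E} (hf : f ≠ σ.top) {z : E → ℝ} (hz : ∀ e, 0 < z e) :
    ContinuousOn (fun s : ℝ => g.weight σ f (zeroOn {f} (σ.scaleFibre C (fun _ => s) z)))
      (Set.Ici 0) := by
  refine (g.contDiffOn σ f hf).continuousOn.comp (Continuous.continuousOn ?_) fun s hs e => ?_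
  · refine continuous_pi fun e => ?_
    unfold zeroOn scaleFibre
    split_ifs <;> fun_prop
  · unfold zeroOn scaleFibre
    split_ifs
    · exact le_rfl
    · exact mul_nonneg (hz e).le (Finset.prod_nonneg fun _ _ => hs)

theorem zeroOn_scaleFibre_zero (σ : Γ.Chart) {C : Finset (Finset E)} {γ : Finset E} (hγ : γ ∈ C)
    (z : E → ℝ) : zeroOn {σ.edge γ} (σ.scaleFibre C (fun _ => 0) z) = zeroOn (σ.fibre C) z := by
  funext e
  by_cases he : e ∈ σ.fibre C
  · obtain ⟨δ, hδ, h⟩ := Finset.mem_image.1 he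
    simp only [zeroOn, if_pos he, scaleFibre]
    rw [Finset.prod_eq_zero (i := δ) (Finset.mem_filter.2 ⟨hδ, h⟩) rfl, mul_zero, ite_self]
  · have : e ∉ ({σ.edge γ} : Finset E) := fun h =>
      he (Finset.mem_singleton.1 h ▸ Finset.mem_image_of_mem _ hγ)
    simp only [zeroOn, if_neg he, if_neg this]
    exact scaleFibre_of_notMem _ _ he

/-- The gluing condition for the metrics of the line bundles over an intersection of exceptional
divisors. -/
theorem glue_fibre (g : Γ.ToricMetric) {σ σ' : Γ.Chart} {C : Finset (Finset E)} (hC : C ⊆ σ.flag)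
    (hC' : C ⊆ σ'.flag) {z z' : E → ℝ} (hz : ∀ e, 0 < z e) (hz' : ∀ e, 0 < z' e)
    (h : SamePoint (σ.toProj z) (σ'.toProj z')) {γ : Finset E} (hγ : γ ∈ C) :
    z (σ.edge γ) * g.weight σ (σ.edge γ) (zeroOn (σ.fibre C) z) =
      z' (σ'.edge γ) * g.weight σ' (σ'.edge γ) (zeroOn (σ'.fibre C) z') := by
  have h1 := (continuousOn_weight_scaleFibre g σ C (edge_ne_top (hC hγ)) hz 0
    (Set.self_mem_Ici)).mono_left (nhdsWithin_mono 0 Set.Ioi_subset_Ici_self)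
  have h2 := (continuousOn_weight_scaleFibre g σ' C (edge_ne_top (hC' hγ)) hz' 0
    (Set.self_mem_Ici)).mono_left (nhdsWithin_mono 0 Set.Ioi_subset_Ici_self)
  simp only [zeroOn_scaleFibre_zero σ hγ] at h1
  simp only [zeroOn_scaleFibre_zero σ' hγ] at h2
  -- Apply `glue` after scaling all fibre coordinates by s > 0, cancel one factor s, and let s tend
  -- to 0.
  refine tendsto_nhds_unique_of_eventuallyEq (h1.const_mul _) (h2.const_mul _) ?_
  filter_upwards [self_mem_nhdsWithin] with s hs
  have hs' : (0 : ℝ) < s := hs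
  have hsame : SamePoint (σ.toProj (σ.scaleFibre C (fun _ => s) z))
      (σ'.toProj (σ'.scaleFibre C (fun _ => s) z')) := by
    obtain ⟨c, hc, h⟩ := h
    refine ⟨c, hc, fun e => ?_⟩
    rw [toProj_scaleFibre hC, toProj_scaleFibre hC', h, mul_assoc]
  have := g.glue σ σ' (σ.edge γ) (σ'.edge γ) (Or.inl ⟨γ, hC hγ, hC' hγ, rfl, rfl⟩) _ _
    (scaleFibre_pos (fun _ => hs') hz) (scaleFibre_pos (fun _ => hs') hz') hsame
  rw [scaleFibre_edge hC _ _ hγ, scaleFibre_edge hC' _ _ hγ, mul_right_comm,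
    mul_right_comm (z' _)] at this
  exact mul_right_cancel₀ hs'.ne' this

theorem toProj_bounds {σ : Γ.Chart} {x : ℝ} (hx : 0 < x) (hx1 : x ≤ 1) {z : E → ℝ}
    (hz : ∀ e, x ≤ z e ∧ z e ≤ 1) (e : E) :
    x ^ (Fintype.card (Finset E) + 1) ≤ σ.toProj z e ∧ σ.toProj z e ≤ 1 := by
  unfold toProj
  have h0 : ∀ e, 0 ≤ z e := fun e => hx.le.trans (hz e).1
  have h1 : x ^ Fintype.card (Finset E) ≤ ∏ γ ∈ σ.flag.filter (fun γ => e ∈ γ), z (σ.edge γ) := by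
    calc x ^ Fintype.card (Finset E) ≤ x ^ (σ.flag.filter (fun γ => e ∈ γ)).card :=
          pow_le_pow_of_le_one hx.le hx1 (Finset.card_le_univ _)
      _ = ∏ γ ∈ σ.flag.filter (fun γ => e ∈ γ), x := (Finset.prod_const _).symm
      _ ≤ _ := Finset.prod_le_prod (fun _ _ => hx.le) fun _ _ => (hz _).1
  have h2 : ∏ γ ∈ σ.flag.filter (fun γ => e ∈ γ), z (σ.edge γ) ≤ 1 :=
    Finset.prod_le_one (fun _ _ => h0 _) fun _ _ => (hz _).2
  have h3 : x ≤ (if e ∈ σ.chosen then 1 else z e) ∧ (if e ∈ σ.chosen then 1 else z e) ≤ 1 := by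
    split_ifs
    · exact ⟨hx1, le_rfl⟩
    · exact hz e
  have h4 := hx.le.trans h3.1
  refine ⟨?_, mul_le_one₀ h2 h4 h3.2⟩
  rw [pow_succ]
  exact mul_le_mul h1 h3.1 hx.le ((pow_pos hx _).le.trans h1)

theorem tubeCoord_eq_scaleFibre {σ : Γ.Chart} (g : Γ.ToricMetric) {C : Finset (Finset E)}
    (hC : C ⊆ σ.flag) (η : ℝ) (t : σ.Param) :
    σ.tubeCoord g C η t = σ.scaleFibre C (fun γ => σ.tubeCoord g C η t (σ.edge γ))
      (fun e => (σ.point C 1 t e : ℂ)) := by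
  funext f
  by_cases hf : f ∈ σ.fibre C
  · obtain ⟨γ, hγ, rfl⟩ := Finset.mem_image.1 hf
    rw [scaleFibre_edge hC _ _ hγ]
    simp [point, hf]
  · rw [scaleFibre_of_notMem _ _ hf]
    by_cases h : f = σ.top <;> simp [tubeCoord, point, hf, h]

theorem zeroOn_point {σ : Γ.Chart} {C : Finset (Finset E)} (hC : C ⊆ σ.flag) (t : σ.Param) :
    zeroOn (σ.fibre C) (σ.point C 1 t) = σ.point C 0 t := by
  funext e
  by_cases h : e = σ.top
  · have := top_notMem_fibre hC
    simp [zeroOn, point, h, this]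
  · by_cases h' : e ∈ σ.fibre C <;> simp [zeroOn, point, h, h']

theorem norm_tubeCoord_edge {σ : Γ.Chart} (g : Γ.ToricMetric) {C : Finset (Finset E)}
    (hC : C ⊆ σ.flag) {η : ℝ} (hη : 0 < η) {t : σ.Param} (ht : t ∈ σ.posParam C) {γ : Finset E}
    (hγ : γ ∈ C) : ‖σ.tubeCoord g C η t (σ.edge γ)‖ =
      η / g.weight σ (σ.edge γ) (σ.point C 0 t) := by
  have h1 := edge_ne_top (hC hγ)
  have h2 : σ.edge γ ∈ σ.fibre C := Finset.mem_image_of_mem _ hγ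
  rw [tubeCoord, dif_neg h1, if_pos h2, norm_mul, mul_comm Complex.I, Complex.norm_exp_ofReal_mul_I,
    mul_one, Complex.norm_real, Real.norm_of_nonneg]
  exact (div_pos hη (weight_point_pos g h1 ht)).le

/-- Points of tubes, seen in a chart which is adapted to them. -/
theorem exists_adapted_coords (hcore : Γ.IsCore Finset.univ) (g : Γ.ToricMetric) {w W : ℝ}
    (hw : 0 < w) (hW : 0 < W)
    (hwW : ∀ (σ : Γ.Chart) (f : E), f ≠ σ.top → ∀ z : E → ℝ,
      (∀ e, 0 ≤ z e ∧ z e ≤ 1) → w ≤ g.weight σ f z ∧ g.weight σ f z ≤ W)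
    {κ ε : ℝ} (hκ : 0 < κ) (hε : 0 < ε) (hx1 : κ / W * ε ≤ 1)
    {C : Finset (Finset E)} (hflag : Γ.IsFlag C) {σ : Γ.Chart} (hC : C ⊆ σ.flag) {t : σ.Param}
    (ht : t ∈ σ.base g C (κ * ε) (κ * ε)) :
    (∃ (σ' : Γ.Chart) (c : ℂ) (z : E → ℂ), c ≠ 0 ∧ (∀ e, z e ≠ 0) ∧
      (∃ y : E → ℝ, ∀ e, 0 ≤ y e ∧ y e ≤ 1 ∧ (z e = y e ∨ (y e = 0 ∧ ‖z e‖ ≤ ε / w))) ∧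
      σ.tubeMap g C ε t = c • σ'.toProj z) ∧
    ∀ f : {f : E // f ≠ σ.top}, (f : E) ∉ σ.fibre C →
      (κ / W * ε) ^ (Fintype.card (Finset E) + 1) ≤ t f ∧
        t f ≤ ((κ / W * ε) ^ (Fintype.card (Finset E) + 1))⁻¹ := by
  have htp : t ∈ σ.posParam C := ht.1
  have hp : ∀ e, 0 < σ.point C 1 t e := point_pos htp one_pos
  set a := σ.toProj (σ.point C 1 t) with ha_def
  have ha : ∀ e, 0 < a e := toProj_pos hp
  have : Nonempty E := ⟨σ.top⟩
  obtain ⟨σ', hC', hle⟩ := hflag.exists_chart hcore a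
  set z' := σ'.coords a with hz'_def
  have hz' : ∀ e, 0 < z' e := coords_pos ha
  have hz'1 : ∀ f, f ∉ σ'.fibre C → z' f ≤ 1 := by
    intro f hf
    rw [hz'_def, coords]
    split_ifs with h
    · exact le_rfl
    · exact div_le_one_of_le₀ (hle f h hf) (ha _).le
  have hz'a : ∀ e, σ'.toProj z' e = (a σ'.top)⁻¹ * a e := fun e => by
    rw [toProj_coords ha, div_eq_inv_mul]
  have hsame : SamePoint (σ'.toProj z') a := ⟨_, inv_pos.2 (ha _), hz'a⟩
  have hcube : ∀ F, σ'.fibre C ⊆ F → ∀ e, 0 ≤ zeroOn F z' e ∧ zeroOn F z' e ≤ 1 := by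
    intro F hF e
    unfold zeroOn
    split_ifs with h
    · exact ⟨le_rfl, zero_le_one⟩
    · exact ⟨(hz' e).le, hz'1 e fun h' => h (hF h')⟩
  set x := κ / W * ε with hx_def
  have hx : 0 < x := by positivity
  have hlow : ∀ f, f ∉ σ'.fibre C → x ≤ z' f := by
    intro f hf
    by_cases h : f = σ'.top
    · rw [h, hz'_def, coords_top]; exact hx1
    · have h1 := ht.2 σ' hC' z' hz' hsame f h hf
      have h2 := (hwW σ' f h _ (hcube _ (Finset.subset_insert f _))).2
      have h3 : κ * ε ≤ z' f * W := by
        refine le_trans ?_ (h1.trans (mul_le_mul_of_nonneg_left h2 (hz' f).le))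
        unfold cutoff
        split_ifs <;> exact le_rfl
      rw [hx_def, div_mul_eq_mul_div]
      exact (div_le_iff₀ hW).2 h3
  -- The fibre coordinate is 1 in `σ.point C 1 t` and `z'` in the adapted chart; comparing the two
  -- lengths converts the radius ε/weight of `σ` into that of `σ'`.
  have hw' : ∀ γ ∈ C, g.weight σ (σ.edge γ) (σ.point C 0 t) =
      z' (σ'.edge γ) * g.weight σ' (σ'.edge γ) (zeroOn (σ'.fibre C) z') := by
    intro γ hγ
    have hsame' : SamePoint a (σ'.toProj z') :=
      ⟨a σ'.top, ha _, fun e => by rw [hz'a, mul_inv_cancel_left₀ (ha _).ne']⟩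
    have := glue_fibre g hC hC' hp hz' hsame' hγ
    rw [zeroOn_point hC] at this
    rw [← this]
    simp [point, edge_ne_top (hC hγ), fibre, Finset.mem_image_of_mem _ hγ]
  constructor
  · set l : Finset E → ℂ := fun γ => σ.tubeCoord g C ε t (σ.edge γ) with hl_def
    have hl : ∀ γ, l γ ≠ 0 := fun γ => tubeCoord_ne_zero g hε htp _
    refine ⟨σ', (a σ'.top : ℂ), σ'.scaleFibre C l fun e => (z' e : ℂ), ?_, ?_, ?_, ?_⟩
    · exact Complex.ofReal_ne_zero.2 (ha _).ne'
    · intro e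
      exact mul_ne_zero (Complex.ofReal_ne_zero.2 (hz' e).ne')
        (Finset.prod_ne_zero_iff.2 fun γ _ => hl γ)
    · refine ⟨zeroOn (σ'.fibre C) z', fun e => ⟨(hcube _ subset_rfl e).1,
        (hcube _ subset_rfl e).2, ?_⟩⟩
      by_cases he : e ∈ σ'.fibre C
      · right
        obtain ⟨γ, hγ, rfl⟩ := Finset.mem_image.1 he
        refine ⟨if_pos he, ?_⟩
        rw [scaleFibre_edge hC' _ _ hγ, norm_mul, Complex.norm_real,
          Real.norm_of_nonneg (hz' _).le, hl_def, norm_tubeCoord_edge g hC hε htp hγ, hw' γ hγ,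
          ← mul_div_assoc, mul_div_mul_left _ _ (hz' _).ne']
        exact div_le_div_of_nonneg_left hε.le hw
          (hwW σ' _ (edge_ne_top (hC' hγ)) _ (hcube _ subset_rfl)).1
      · left
        rw [scaleFibre_of_notMem _ _ he, zeroOn, if_neg he]
    · rw [tubeMap_eq]
      funext e
      simp only [Pi.smul_apply, smul_eq_mul]
      rw [tubeCoord_eq_scaleFibre g hC, toProj_scaleFibre hC, toProj_scaleFibre hC',
        toProj_ofReal, toProj_ofReal, hz'a, ← mul_assoc, ← Complex.ofReal_mul,
        mul_inv_cancel_left₀ (ha _).ne']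
  · intro f hf
    -- The fibre coordinates of `z'` are not controlled, so they are replaced by 1. This does not
    -- affect t_f: `f` and its parent lie in the same members of `C`, so the fibre factors cancel in
    -- the quotient.
    set y : E → ℝ := fun e => if e ∈ σ'.fibre C then 1 else z' e with hy_def
    have hy : ∀ e, x ≤ y e ∧ y e ≤ 1 := by
      intro e
      simp only [hy_def]
      split_ifs with h
      · exact ⟨hx1, le_rfl⟩
      · exact ⟨hlow e h, hz'1 e h⟩
    have hscale : z' = σ'.scaleFibre C (fun γ => z' (σ'.edge γ)) y := by
      funext e
      by_cases he : e ∈ σ'.fibre C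
      · obtain ⟨γ, hγ, rfl⟩ := Finset.mem_image.1 he
        rw [scaleFibre_edge hC' _ _ hγ, hy_def]
        simp [he]
      · rw [scaleFibre_of_notMem _ _ he, hy_def]
        simp [he]
    have hfilter : (C.filter fun γ => (f : E) ∈ γ) = C.filter fun γ => σ.parent f ∈ γ := by
      refine Finset.filter_congr fun γ hγ => ?_
      rw [parent_mem_iff f.2 (flag_subset_layers (hC hγ))]
      exact ⟨fun h => ⟨h, fun h' => hf (h' ▸ Finset.mem_image_of_mem _ hγ)⟩, fun h => h.1⟩
    have hb := fun e => toProj_bounds (σ := σ') hx hx1 hy e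
    have hbp : ∀ e, 0 < σ'.toProj y e := fun e => (pow_pos hx _).trans_le (hb e).1
    have htf : t f = σ'.toProj y f / σ'.toProj y (σ.parent f) := by
      have h1 : t f = σ.point C 1 t f := by simp [point, f.2, hf]
      have h2 : a f / a (σ.parent f) = σ'.toProj z' f / σ'.toProj z' (σ.parent f) := by
        rw [hz'a, hz'a, mul_div_mul_left _ _ (inv_pos.2 (ha _)).ne']
      rw [h1, coord_eq_div hp f.2, ← ha_def, h2, hscale, toProj_scaleFibre hC',
        toProj_scaleFibre hC', hfilter, mul_div_mul_right]
      exact (Finset.prod_pos fun γ _ => hz' _).ne'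
    rw [htf]
    constructor
    · rw [le_div_iff₀ (hbp _)]
      exact (mul_le_of_le_one_right (pow_pos hx _).le (hb _).2).trans (hb _).1
    · rw [div_le_iff₀ (hbp _)]
      refine (hb _).2.trans ?_
      rw [inv_mul_eq_div, one_le_div (pow_pos hx _)]
      exact (hb _).1

end Chart


open MeasureTheory

/-! ### Integration over tubes -/

/-- Domination on a set which need not be measurable. -/
theorem integral_le_of_continuousOn {X : Type*} [TopologicalSpace X] [MeasurableSpace X]
    [BorelSpace X] {μ : Measure X} {U B D : Set X} {f : X → ℂ} {h : X → ℝ} (hU : IsOpen U)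
    (hf : ContinuousOn f U) (hh : ContinuousOn h U) (hB : MeasurableSet B)
    (hint : IntegrableOn h B μ) (h0 : ∀ x ∈ B, 0 ≤ h x) (hDU : D ⊆ U) (hDB : D ⊆ B)
    (hle : ∀ x ∈ D, ‖f x‖ ≤ h x) :
    IntegrableOn f D μ ∧ ‖∫ x in D, f x ∂μ‖ ≤ ∫ x in B, h x ∂μ := by
  -- `D` need not be measurable, so domination is first proved on this measurable set between `D`
  -- and `B`; it is relatively closed in the open set `U`, intersected with `B`.
  set S : Set X := (U ∩ (fun x => h x - ‖f x‖) ⁻¹' Set.Ici 0) ∩ B with hS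
  have hSm : MeasurableSet S := by
    refine MeasurableSet.inter ?_ hB
    obtain ⟨u, hu, h'⟩ := (continuousOn_iff_isClosed.1 (hh.sub hf.norm)) _
      (isClosed_Ici (a := (0 : ℝ)))
    have hm := hu.measurableSet.inter hU.measurableSet
    rw [← h'] at hm
    rw [Set.inter_comm]
    exact hm
  have hDS : D ⊆ S := fun x hx => ⟨⟨hDU hx, sub_nonneg.2 (hle x hx)⟩, hDB hx⟩
  have hae : ∀ᵐ x ∂μ.restrict S, ‖f x‖ ≤ h x :=
    ae_restrict_of_forall_mem hSm fun x hx => sub_nonneg.1 hx.1.2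
  have hfm : AEStronglyMeasurable f (μ.restrict S) := by
    have h1 : AEMeasurable f (μ.restrict U) := hf.aemeasurable hU.measurableSet
    exact (h1.mono_measure (Measure.restrict_mono (fun x hx => hx.1.1) le_rfl)).aestronglyMeasurable
  have hfS : IntegrableOn f S μ := Integrable.mono' (hint.mono_set Set.inter_subset_right) hfm hae
  refine ⟨hfS.mono_set hDS, ?_⟩
  calc ‖∫ x in D, f x ∂μ‖ ≤ ∫ x in D, h x ∂μ :=
        norm_integral_le_of_norm_le (hint.mono_set hDB)
          (ae_restrict_of_ae_restrict_of_subset hDS hae)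
    _ ≤ ∫ x in B, h x ∂μ := setIntegral_mono_set hint
        (ae_restrict_of_forall_mem hB h0) (Filter.Eventually.of_forall hDB)

/-- The integral of `∏ dt_i / t_i` over a box, with additional angular variables. -/
theorem integral_box_le {ι : Type*} [Fintype ι] (p : ι → Prop) [DecidablePred p] {x : ℝ}
    (hx : 0 < x) (hx1 : x ≤ 1) :
    let B : Set (ι → ℝ) := Set.univ.pi fun i =>
      if p i then Set.Icc 0 (2 * Real.pi) else Set.Icc x x⁻¹
    let h : (ι → ℝ) → ℝ := fun t => ∏ i, if p i then 1 else (t i)⁻¹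
    IntegrableOn h B ∧ ∫ t in B, h t ≤ (2 * Real.pi + 2 * (-Real.log x)) ^ Fintype.card ι := by
  intro B h
  have hlog : 0 ≤ -Real.log x := neg_nonneg.2 (Real.log_nonpos hx.le hx1)
  have hxx : x ≤ x⁻¹ := hx1.trans ((one_le_inv₀ hx).2 hx1)
  let s : ι → Set ℝ := fun i => if p i then Set.Icc 0 (2 * Real.pi) else Set.Icc x x⁻¹
  let u : ι → ℝ → ℝ := fun i y => if p i then 1 else y⁻¹
  have hrestrict : (volume : Measure (ι → ℝ)).restrict B =
      Measure.pi fun i => (volume : Measure ℝ).restrict (s i) := Measure.restrict_pi_pi _ s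
  have hu : ∀ i, IntegrableOn (u i) (s i) := by
    intro i
    by_cases hi : p i
    · simp only [u, s, if_pos hi]
      exact integrableOn_const measure_Icc_lt_top.ne
    · simp only [u, s, if_neg hi]
      refine ContinuousOn.integrableOn_Icc (continuousOn_inv₀.mono fun y hy => ?_)
      exact (hx.trans_le hy.1).ne'
  have hle : ∀ i, ∫ y in s i, u i y ≤ 2 * Real.pi + 2 * (-Real.log x) := by
    intro i
    by_cases hi : p i
    · simp only [u, s, if_pos hi]
      have : (0 : ℝ) ≤ 2 * Real.pi := by positivity
      simp [this]
      linarith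
    · simp only [u, s, if_neg hi]
      rw [integral_Icc_eq_integral_Ioc, ← intervalIntegral.integral_of_le hxx,
        integral_inv_of_pos hx (inv_pos.2 hx), Real.log_div (inv_ne_zero hx.ne') hx.ne',
        Real.log_inv]
      linarith [Real.pi_pos]
  have hnn : ∀ i, 0 ≤ ∫ y in s i, u i y := by
    intro i
    have hsm : MeasurableSet (s i) := by
      simp only [s]; split_ifs <;> exact measurableSet_Icc
    refine setIntegral_nonneg hsm fun y hy => ?_
    by_cases hi : p i
    · simp only [u, if_pos hi]; exact zero_le_one
    · simp only [u, s, if_neg hi] at hy ⊢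
      exact inv_nonneg.2 (hx.le.trans hy.1)
  constructor
  · rw [IntegrableOn, hrestrict]
    exact Integrable.fintype_prod (f := u) hu
  · rw [hrestrict]
    -- An angle contributes 2π and a base variable -2 log x; each is at most the sum of the two.
    refine (integral_fintype_prod_eq_prod (𝕜 := ℝ) u).trans_le ?_
    exact (Finset.prod_le_prod (fun i _ => hnn i) fun i _ => hle i).trans
      (by rw [Finset.prod_const, Finset.card_univ])

theorem IntegralBound.mono {G : MvPolynomial E ℂ} {m : ℕ} {e₀ : E}
    {Φ : ({f : E // f ≠ e₀} → ℝ) → E → ℂ} {D : Set ({f : E // f ≠ e₀} → ℝ)} {M M' : ℝ}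
    (h : Γ.IntegralBound G m e₀ Φ D M) (hM : M ≤ M') : Γ.IntegralBound G m e₀ Φ D M' :=
  ⟨h.1, h.2.1, h.2.2.trans hM⟩

theorem one_le_neg_log {ε : ℝ} (hε : 0 < ε) (h : ε < Real.exp (-1)) : 1 ≤ -Real.log ε := by
  have := (Real.log_lt_iff_lt_exp hε).2 h
  linarith

theorem abs_log_abs {ε : ℝ} (hε : 0 < ε) (h : ε < Real.exp (-1)) :
    |Real.log (|ε|)| = -Real.log ε := by
  have := one_le_neg_log hε h
  rw [abs_of_pos hε, abs_of_nonpos (by linarith)]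

namespace Chart

/-- With the coefficient bounded by `M`, the integrand is dominated by a constant times ∏ 1/t_f over
the base variables on a box. -/
theorem integralBound_tube {σ : Γ.Chart} (g : Γ.ToricMetric) {C : Finset (Finset E)}
    (hC : C ⊆ σ.flag) {G : MvPolynomial E ℂ} {m : ℕ} {ε x M : ℝ} (hε : 0 < ε) (hx : 0 < x)
    (hx1 : x ≤ 1) (hM : 0 ≤ M) {D : Set σ.Param} (hpos : D ⊆ σ.posParam C)
    (hang : D ⊆ σ.angles C)
    (hψ : ∀ t ∈ D, MvPolynomial.eval (σ.tubeMap g C ε t) Γ.psi ≠ 0)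
    (hF : ∀ t ∈ D, ‖Γ.logCoeff G m (σ.tubeMap g C ε t)‖ ≤ M)
    (hbox : ∀ t ∈ D, ∀ f : {f : E // f ≠ σ.top}, (f : E) ∉ σ.fibre C → x ≤ t f ∧ t f ≤ x⁻¹) :
    Γ.IntegralBound G m σ.top (σ.tubeMap g C ε) D
      (M * ‖(Matrix.of σ.exponents).det‖ *
        (2 * Real.pi + 2 * (-Real.log x)) ^ Fintype.card E) := by
  classical
  set K := ‖(Matrix.of σ.exponents).det‖ with hK
  have hlog : 0 ≤ -Real.log x := neg_nonneg.2 (Real.log_nonpos hx.le hx1)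
  obtain ⟨hint, hintle⟩ := integral_box_le
    (fun f : {f : E // f ≠ σ.top} => (f : E) ∈ σ.fibre C) hx hx1
  set B : Set σ.Param := Set.univ.pi fun f : {f : E // f ≠ σ.top} =>
    if (f : E) ∈ σ.fibre C then Set.Icc 0 (2 * Real.pi) else Set.Icc x x⁻¹ with hB
  set h : σ.Param → ℝ := fun t => ∏ f : {f : E // f ≠ σ.top},
    if (f : E) ∈ σ.fibre C then 1 else (t f)⁻¹ with hh
  set U : Set σ.Param := σ.posParam C ∩
    (fun t => MvPolynomial.eval (σ.tubeMap g C ε t) Γ.psi) ⁻¹' {0}ᶜ with hU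
  have hcontψ : ContinuousOn (fun t => MvPolynomial.eval (σ.tubeMap g C ε t) Γ.psi)
      (σ.posParam C) :=
    (MvPolynomial.continuous_eval Γ.psi).comp_continuousOn (continuousOn_tubeMap g C ε)
  have hUo : IsOpen U :=
    hcontψ.isOpen_inter_preimage (σ.isOpen_posParam C) isOpen_compl_singleton
  have hBm : MeasurableSet B := MeasurableSet.univ_pi fun f => by
    split_ifs <;> exact measurableSet_Icc
  have hBpos : ∀ t ∈ B, ∀ f : {f : E // f ≠ σ.top}, (f : E) ∉ σ.fibre C → 0 < t f := by
    intro t ht f hf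
    have := ht f (Set.mem_univ _)
    simp only [if_neg hf] at this
    exact hx.trans_le this.1
  have hcf : ContinuousOn (Γ.pullback G m σ.top (σ.tubeMap g C ε)) U := by
    have h1 : ContinuousOn (fun t : σ.Param =>
        Γ.logCoeff G m (σ.tubeMap g C ε t) * ((Matrix.of σ.exponents).det *
          ∏ f : {f : E // f ≠ σ.top}, if (f : E) ∈ σ.fibre C then Complex.I else (t f : ℂ)⁻¹)) U := by
      have hct : ContinuousOn (σ.tubeMap g C ε) U := (continuousOn_tubeMap g C ε).mono fun t ht => ht.1
      refine ContinuousOn.mul ?_ (continuousOn_const.mul (continuousOn_finsetProd _ fun f _ => ?_))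
      · unfold logCoeff
        refine ContinuousOn.div (ContinuousOn.mul ?_ (continuousOn_finsetProd _ fun e _ => ?_)) ?_ ?_
        · exact (MvPolynomial.continuous_eval G).comp_continuousOn hct
        · exact continuousOn_pi.1 hct e
        · exact (hcontψ.mono fun t ht => ht.1).pow m
        · exact fun t ht => pow_ne_zero _ ht.2
      · split_ifs with hf
        · exact continuousOn_const
        · refine ContinuousOn.inv₀ (by fun_prop) fun t ht => ?_
          exact Complex.ofReal_ne_zero.2 (ht.1 f hf).ne'
    exact h1.congr fun t ht => pullback_tubeMap g hC hε G m ht.1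
  have hch : ContinuousOn (fun t => M * K * h t) U := by
    refine continuousOn_const.mul (continuousOn_finsetProd _ fun f _ => ?_)
    split_ifs with hf
    · exact continuousOn_const
    · exact ContinuousOn.inv₀ (by fun_prop) fun t ht => (ht.1 f hf).ne'
  have hmain := integral_le_of_continuousOn (μ := volume) (D := D) hUo hcf hch hBm
    (hint.const_mul (M * K)) ?_ (fun t ht => ⟨hpos ht, hψ t ht⟩) ?_ ?_
  · refine ⟨hψ, hmain.1, hmain.2.trans ?_⟩
    rw [integral_const_mul]
    refine mul_le_mul_of_nonneg_left (hintle.trans ?_) (by positivity)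
    refine pow_le_pow_right₀ ?_ (Fintype.card_subtype_le _)
    linarith [Real.pi_gt_three]
  · intro t ht
    refine mul_nonneg (by positivity) (Finset.prod_nonneg fun f _ => ?_)
    split_ifs with hf
    · exact zero_le_one
    · exact (inv_pos.2 (hBpos t ht f hf)).le
  · intro t ht f _
    by_cases hf : (f : E) ∈ σ.fibre C
    · simp only [if_pos hf]; exact hang ht f hf
    · simp only [if_neg hf]; exact hbox t ht f hf
  · intro t ht
    rw [pullback_tubeMap g hC hε G m (hpos ht), norm_mul, norm_mul, norm_prod, mul_assoc M]
    have : ∏ f : {f : E // f ≠ σ.top},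
        ‖if (f : E) ∈ σ.fibre C then Complex.I else (t f : ℂ)⁻¹‖ = h t := by
      refine Finset.prod_congr rfl fun f _ => ?_
      split_ifs with hf
      · exact Complex.norm_I
      · rw [norm_inv, Complex.norm_real, Real.norm_of_nonneg (hpos ht f hf).le]
    rw [this]
    refine mul_le_mul_of_nonneg_right (hF t ht) (mul_nonneg (norm_nonneg _) ?_)
    rw [← this]
    exact Finset.prod_nonneg fun _ _ => norm_nonneg _

end Chart

/-- Logarithmic growth of the integrals over tubes with a base which keeps a distance of at least
`κ ε` from the boundary. -/
theorem exists_tube_bound (hconn : Γ.Connected) (hcore : Γ.IsCore Finset.univ)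
    (g : Γ.ToricMetric) {G : MvPolynomial E ℂ} {d m : ℕ} (hhom : G.IsHomogeneous d)
    (hd : d + Fintype.card E = m * Γ.h1 Finset.univ) (hG : ∀ σ : Γ.Chart, σ.LogDivides G m)
    {κ : ℝ} (hκ : 0 < κ) :
    ∃ M ε₀ : ℝ, 0 < ε₀ ∧ ∀ ε : ℝ, 0 < ε → ε < ε₀ →
      ∀ C : Finset (Finset E), Γ.IsFlag C → ∀ σ : Γ.Chart, C ⊆ σ.flag → ∀ D : Set σ.Param,
        D ⊆ σ.base g C (κ * ε) (κ * ε) ∩ σ.angles C →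
        Γ.IntegralBound G m σ.top (σ.tubeMap g C ε) D
          (M * |Real.log (|ε|)| ^ Fintype.card E) := by
  obtain ⟨δ, M, hδ, hM, hbound⟩ := exists_bound hconn hcore hhom hd hG
  obtain ⟨w, W, hw, hW, hwW⟩ := g.exists_weight_bounds
  obtain ⟨K, hK⟩ := Finite.exists_le fun σ : Γ.Chart => ‖(Matrix.of σ.exponents).det‖
  set N := Fintype.card (Finset E) + 1 with hN
  set L := 2 * Real.pi + 2 * N * (|Real.log (κ / W)| + 1) with hL
  -- Thresholds for ε: exp(-1) gives -log ε ≥ 1, W/κ gives κε/W ≤ 1, and w and wδ put the fibre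
  -- coordinates, of size at most ε/w, in the unit disc and within δ of 0.
  refine ⟨M * max K 0 * L ^ Fintype.card E,
    min (min (Real.exp (-1)) (W / κ)) (min w (w * δ)), by positivity, ?_⟩
  intro ε hε hε' C hflag σ hC D hD
  simp only [lt_min_iff] at hε'
  obtain ⟨⟨he1, he2⟩, he3, he4⟩ := hε'
  have hκW : 0 < κ / W := div_pos hκ hW
  have hx1 : κ / W * ε ≤ 1 := by
    rw [lt_div_iff₀ hκ] at he2
    rw [div_mul_eq_mul_div, div_le_one hW, mul_comm]
    exact he2.le
  have hx : 0 < κ / W * ε := by positivity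
  have hpt := fun t (ht : t ∈ D) =>
    Chart.exists_adapted_coords hcore g hw hW hwW hκ hε hx1 hflag hC (hD ht).1
  have hF : ∀ t ∈ D, MvPolynomial.eval (σ.tubeMap g C ε t) Γ.psi ≠ 0 ∧
      ‖Γ.logCoeff G m (σ.tubeMap g C ε t)‖ ≤ M := by
    intro t ht
    obtain ⟨⟨σ', c, z, hc, hz, ⟨y, hy⟩, heq⟩, -⟩ := hpt t ht
    rw [heq]
    refine hbound σ' c z hc hz (fun e => ?_) ⟨y, fun e => ⟨(hy e).1, (hy e).2.1, ?_⟩⟩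
    · rcases (hy e).2.2 with h | ⟨-, h⟩
      · rw [h, Complex.norm_real, Real.norm_of_nonneg (hy e).1]
        exact (hy e).2.1
      · exact h.trans ((div_le_one hw).2 he3.le)
    · rcases (hy e).2.2 with h | ⟨h0, h⟩
      · rw [h, sub_self, norm_zero]; exact hδ
      · rw [h0, Complex.ofReal_zero, sub_zero]
        exact h.trans_lt ((div_lt_iff₀ hw).2 (by linarith))
  refine (Chart.integralBound_tube g hC hε (pow_pos hx N) (pow_le_one₀ hx.le hx1) hM
    (fun t ht => (hD ht).1.1) (fun t ht => (hD ht).2) (fun t ht => (hF t ht).1)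
    (fun t ht => (hF t ht).2) (fun t ht => (hpt t ht).2)).mono ?_
  have hl := one_le_neg_log hε he1
  have hlogx : -Real.log ((κ / W * ε) ^ N) ≤ N * (|Real.log (κ / W)| + 1) * (-Real.log ε) := by
    rw [Real.log_pow, Real.log_mul hκW.ne' hε.ne']
    have h1 := neg_abs_le (Real.log (κ / W))
    have h2 : |Real.log (κ / W)| ≤ |Real.log (κ / W)| * (-Real.log ε) :=
      le_mul_of_one_le_right (abs_nonneg _) hl
    have h3 : (0 : ℝ) ≤ N := Nat.cast_nonneg N
    nlinarith
  have hnn : 0 ≤ -Real.log ((κ / W * ε) ^ N) :=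
    neg_nonneg.2 (Real.log_nonpos (by positivity) (pow_le_one₀ hx.le hx1))
  have hfac : 2 * Real.pi + 2 * (-Real.log ((κ / W * ε) ^ N)) ≤ L * (-Real.log ε) := by
    have : 2 * Real.pi ≤ 2 * Real.pi * (-Real.log ε) :=
      le_mul_of_one_le_right (by positivity) hl
    rw [hL]
    nlinarith
  rw [abs_log_abs hε he1, mul_assoc (M * max K 0), ← mul_pow]
  refine mul_le_mul ?_ ?_ (by positivity) (by positivity)
  · exact mul_le_mul_of_nonneg_left ((hK σ).trans (le_max_left _ _)) hM
  · exact pow_le_pow_left₀ (by positivity) hfac _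


/-! ### Integration over a simplex -/

section Simplex

variable {ι : Type*} [Fintype ι] [DecidableEq ι]

theorem integral_Icc_inv_add {x : ℝ} (hx : 0 < x) :
    IntegrableOn (fun y : ℝ => (y + x)⁻¹) (Set.Icc 0 1) ∧
      ∫ y in Set.Icc 0 1, (y + x)⁻¹ = Real.log ((1 + x) / x) := by
  constructor
  · refine ContinuousOn.integrableOn_Icc (ContinuousOn.inv₀ (by fun_prop) fun y hy => ?_)
    have := hy.1
    positivity
  · rw [integral_Icc_eq_integral_Ioc, ← intervalIntegral.integral_of_le zero_le_one,
      intervalIntegral.integral_comp_add_right (fun y => y⁻¹), zero_add,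
      integral_inv_of_pos hx (by positivity)]

theorem integral_cube_prod_inv {x : ℝ} (hx : 0 < x) :
    IntegrableOn (fun t : ι → ℝ => ∏ i, (t i + x)⁻¹) (Set.univ.pi fun _ => Set.Icc 0 1) ∧
      ∫ t in Set.univ.pi fun _ => Set.Icc 0 1, ∏ i : ι, (t i + x)⁻¹ =
        Real.log ((1 + x) / x) ^ Fintype.card ι := by
  have hrestrict : (volume : Measure (ι → ℝ)).restrict (Set.univ.pi fun _ => Set.Icc 0 1) =
      Measure.pi fun _ => (volume : Measure ℝ).restrict (Set.Icc 0 1) :=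
    Measure.restrict_pi_pi _ _
  obtain ⟨h1, h2⟩ := integral_Icc_inv_add hx
  constructor
  · rw [IntegrableOn, hrestrict]
    exact Integrable.fintype_prod (f := fun _ y => (y + x)⁻¹) fun _ => h1
  · rw [hrestrict]
    refine (integral_fintype_prod_eq_prod (𝕜 := ℝ) fun _ y => (y + x)⁻¹).trans ?_
    rw [h2, Finset.prod_const, Finset.card_univ]

/-- The standard simplex in barycentric coordinates of which one is omitted. -/
def stdSimplexParam (ι : Type*) [Fintype ι] : Set (ι → ℝ) := {t | (∀ i, 0 ≤ t i) ∧ ∑ i, t i ≤ 1}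

theorem measurableSet_stdSimplexParam : MeasurableSet (stdSimplexParam ι) := by
  have h1 : IsClosed {t : ι → ℝ | ∀ i, 0 ≤ t i} := by
    simp only [Set.ofPred_forall]
    exact isClosed_iInter fun i => isClosed_le continuous_const (continuous_apply i)
  have h2 : IsClosed {t : ι → ℝ | ∑ i, t i ≤ 1} := isClosed_le (by fun_prop) continuous_const
  exact (h1.inter h2).measurableSet

theorem stdSimplexParam_subset_cube :
    stdSimplexParam ι ⊆ Set.univ.pi fun _ => Set.Icc 0 1 := fun _ ht i _ =>
  ⟨ht.1 i, (Finset.single_le_sum (fun j _ => ht.1 j) (Finset.mem_univ i)).trans ht.2⟩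

/-- The involution exchanging the coordinate `k` and the omitted barycentric coordinate. -/
def exchange (k : ι) (t : ι → ℝ) : ι → ℝ := Function.update t k (1 - ∑ i, t i)

theorem sum_exchange (k : ι) (t : ι → ℝ) : ∑ i, exchange k t i = 1 - t k := by
  rw [exchange, Finset.sum_update_of_mem (Finset.mem_univ k),
    ← Finset.sum_sdiff (Finset.singleton_subset_iff.2 (Finset.mem_univ k)), Finset.sum_singleton]
  ring

theorem exchange_involutive (k : ι) : Function.Involutive (exchange k) := by
  intro t
  funext i
  rw [exchange, sum_exchange]
  by_cases h : i = k
  · subst h; simp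
  · simp [exchange, h]

theorem exchange_mem (k : ι) {t : ι → ℝ} (ht : t ∈ stdSimplexParam ι) :
    exchange k t ∈ stdSimplexParam ι := by
  refine ⟨fun i => ?_, ?_⟩
  · by_cases h : i = k
    · subst h; simpa [exchange] using ht.2
    · simpa [exchange, h] using ht.1 i
  · rw [sum_exchange]
    linarith [ht.1 k]

theorem measurePreserving_exchange (k : ι) :
    MeasurePreserving (exchange k) (volume : Measure (ι → ℝ)) volume := by
  let L : (ι → ℝ) →ₗ[ℝ] (ι → ℝ) :=
    { toFun := fun t => Function.update t k (-∑ i, t i)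
      map_add' := by
        intro s t; funext i
        by_cases h : i = k
        · subst h; simp [Finset.sum_add_distrib]; ring
        · simp [h]
      map_smul' := by
        intro c t; funext i
        by_cases h : i = k
        · subst h; simp [Finset.mul_sum]
        · simp [h] }
  have hL : ∀ t, exchange k t = Pi.single k 1 + L t := by
    intro t; funext i
    by_cases h : i = k
    · subst h; simp [exchange, L]; ring
    · simp [exchange, L, h]
  have hLL : L ∘ₗ L = LinearMap.id := by
    refine LinearMap.ext fun t => ?_
    have h1 : ∑ i, L t i = - t k := by
      have := sum_exchange k t
      simp only [hL, Pi.add_apply, Finset.sum_add_distrib, Finset.sum_pi_single',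
        Finset.mem_univ, if_true] at this
      linarith
    funext i
    change Function.update (L t) k (-∑ i, L t i) i = t i
    rw [h1]
    by_cases h : i = k
    · subst h; simp
    · simp [L, h]
  -- The linear part of the affine involution is itself an involution, so its determinant is ±1.
  have hdet : LinearMap.det L * LinearMap.det L = 1 := by
    rw [← LinearMap.det_comp, hLL, LinearMap.det_id]
  have hdet0 : LinearMap.det L ≠ 0 := left_ne_zero_of_mul_eq_one hdet
  have habs : |(LinearMap.det L)⁻¹| = 1 := by
    rw [abs_inv, inv_eq_one]
    have h1 : |LinearMap.det L| * |LinearMap.det L| = 1 := by rw [← abs_mul, hdet, abs_one]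
    nlinarith [abs_nonneg (LinearMap.det L)]
  have hLm : MeasurePreserving L (volume : Measure (ι → ℝ)) volume := by
    refine ⟨L.continuous_of_finiteDimensional.measurable, ?_⟩
    rw [Real.map_linearMap_volume_pi_eq_smul_volume_pi hdet0, habs, ENNReal.ofReal_one, one_smul]
  have h := (measurePreserving_add_left (volume : Measure (ι → ℝ)) (Pi.single k 1)).comp hLm
  rwa [show (fun x => Pi.single k 1 + x) ∘ L = exchange k from (funext hL).symm] at h

theorem integral_exchange (k : ι) (f : (ι → ℝ) → ℝ) (hf : IntegrableOn f (stdSimplexParam ι)) :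
    IntegrableOn (fun t => f (exchange k t)) (stdSimplexParam ι) ∧
      ∫ t in stdSimplexParam ι, f (exchange k t) = ∫ t in stdSimplexParam ι, f t := by
  have hmp := measurePreserving_exchange k
  have hemb : MeasurableEmbedding (exchange k) :=
    (MeasurableEquiv.ofInvolutive _ (exchange_involutive k) hmp.measurable).measurableEmbedding
  have hpre : exchange k ⁻¹' stdSimplexParam ι = stdSimplexParam ι := by
    ext t
    refine ⟨fun h => ?_, exchange_mem k⟩
    rw [← exchange_involutive k t]
    exact exchange_mem k h
  constructor
  · have := (hmp.integrableOn_comp_preimage hemb (f := f) (s := stdSimplexParam ι)).2 hf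
    rwa [hpre] at this
  · have := hmp.setIntegral_preimage_emb hemb f (stdSimplexParam ι)
    rwa [hpre] at this

/-- The integral of the inverse of the product of all barycentric coordinates, shifted by `x`,
grows at most logarithmically. -/
theorem exists_dominating_simplex {x : ℝ} (hx : 0 < x) :
    ∃ h : (ι → ℝ) → ℝ, ContinuousOn h {t | (∀ i, -x < t i) ∧ ∑ i, t i < 1 + x} ∧
      IntegrableOn h (stdSimplexParam ι) ∧
      (∀ t ∈ stdSimplexParam ι, ((1 - ∑ i, t i + x) * ∏ i, (t i + x))⁻¹ ≤ h t) ∧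
      ∫ t in stdSimplexParam ι, h t ≤
        (Fintype.card ι + 1) ^ 2 * Real.log ((1 + x) / x) ^ Fintype.card ι := by
  set g : (ι → ℝ) → ℝ := fun t => ∏ i, (t i + x)⁻¹ with hg
  set n : ℝ := Fintype.card ι + 1 with hn
  have hn0 : 0 < n := by positivity
  obtain ⟨hint, hval⟩ := integral_cube_prod_inv (ι := ι) hx
  have hgS : IntegrableOn g (stdSimplexParam ι) := hint.mono_set stdSimplexParam_subset_cube
  have hcubepos : ∀ t ∈ (Set.univ.pi fun _ => Set.Icc 0 1 : Set (ι → ℝ)), 0 ≤ g t := fun t ht =>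
    Finset.prod_nonneg fun i _ => inv_nonneg.2 (add_nonneg (ht i (Set.mem_univ i)).1 hx.le)
  have hgle : ∫ t in stdSimplexParam ι, g t ≤ Real.log ((1 + x) / x) ^ Fintype.card ι := by
    rw [← hval]
    exact setIntegral_mono_set hint (ae_restrict_of_forall_mem
      (MeasurableSet.univ_pi fun _ => measurableSet_Icc) hcubepos)
      (Filter.Eventually.of_forall stdSimplexParam_subset_cube)
  set P : (ι → ℝ) → ℝ := fun t => (1 - ∑ i, t i + x) * ∏ i, (t i + x) with hP
  have hPex : ∀ k t, P (exchange k t) = P t := by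
    intro k t
    simp only [hP]
    rw [sum_exchange, ← Finset.mul_prod_erase Finset.univ _ (Finset.mem_univ k),
      ← Finset.mul_prod_erase Finset.univ (fun i => t i + x) (Finset.mem_univ k)]
    have : ∏ i ∈ Finset.univ.erase k, (exchange k t i + x) =
        ∏ i ∈ Finset.univ.erase k, (t i + x) :=
      Finset.prod_congr rfl fun i hi => by simp [exchange, Finset.ne_of_mem_erase hi]
    rw [this]
    simp only [exchange, Function.update_self]
    ring
  have hPpos : ∀ t ∈ stdSimplexParam ι, 0 < P t := fun t ht =>
    mul_pos (by linarith [ht.2]) (Finset.prod_pos fun i _ => by linarith [ht.1 i])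
  have hgP : ∀ t ∈ stdSimplexParam ι, g t = (1 - ∑ i, t i + x) * (P t)⁻¹ := by
    intro t ht
    have : 1 - ∑ i, t i + x ≠ 0 := by linarith [ht.2]
    simp only [hg, hP, mul_inv, Finset.prod_inv_distrib]
    rw [mul_inv_cancel_left₀ this]
  have hgnn : ∀ t ∈ stdSimplexParam ι, 0 ≤ g t := fun t ht =>
    hcubepos t (stdSimplexParam_subset_cube ht)
  -- `P` is the product of all shifted barycentric coordinates b_k + x. Since the b_k sum to 1, 1/P
  -- ≤ ∑_k (b_k + x)/P. Each summand lacks one factor, and an exchange of coordinates reduces it to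
  -- `g`, whose integral is bounded by the one over the cube.
  refine ⟨fun t => n * (g t + ∑ k, g (exchange k t)), ?_, ?_, ?_, ?_⟩
  · have h1 : ∀ u : (ι → ℝ) → ι → ℝ, Continuous u → ContinuousOn (fun t => g (u t))
        {t | ∀ i, -x < u t i} := by
      intro u hu
      refine continuousOn_finsetProd _ fun i _ => ContinuousOn.inv₀ ?_ fun t ht => ?_
      · exact (((continuous_apply i).comp hu).add continuous_const).continuousOn
      · have := ht i
        exact (by linarith : 0 < u t i + x).ne'
    refine continuousOn_const.mul (ContinuousOn.add ?_ (continuousOn_finsetSum _ fun k _ => ?_))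
    · exact (h1 id continuous_id).mono fun t ht => ht.1
    · refine (h1 (exchange k) ?_).mono fun t ht i => ?_
      · unfold exchange
        exact continuous_id.update k (by fun_prop)
      · by_cases h : i = k
        · subst h
          simp only [exchange, Function.update_self]
          linarith [ht.2]
        · simpa [exchange, h] using ht.1 i
  · exact (hgS.add (integrable_finsetSum _ fun k _ => (integral_exchange k g hgS).1)).const_mul n
  · intro t ht
    have hPinv : 0 ≤ (P t)⁻¹ := (inv_pos.2 (hPpos t ht)).le
    have h1 : ∀ k, g (exchange k t) = (t k + x) * (P t)⁻¹ := fun k => by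
      rw [hgP _ (exchange_mem k ht), hPex, sum_exchange, sub_sub_cancel]
    simp only [h1, hgP t ht]
    rw [← Finset.sum_mul, ← add_mul, ← mul_assoc]
    change (P t)⁻¹ ≤ _
    refine le_mul_of_one_le_left hPinv ?_
    rw [Finset.sum_add_distrib]
    have h2 : 0 ≤ ∑ _i : ι, x := Finset.sum_nonneg fun _ _ => hx.le
    have h3 : (1 : ℝ) ≤ n := by rw [hn]; linarith [Nat.cast_nonneg (α := ℝ) (Fintype.card ι)]
    nlinarith
  · rw [integral_const_mul, integral_add hgS
      (integrable_finsetSum _ fun k _ => (integral_exchange k g hgS).1),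
      integral_finsetSum _ fun k _ => (integral_exchange k g hgS).1]
    simp only [(integral_exchange _ g hgS).2]
    rw [Finset.sum_const, Finset.card_univ, nsmul_eq_mul]
    calc _ = n ^ 2 * ∫ t in stdSimplexParam ι, g t := by rw [hn]; ring
      _ ≤ _ := mul_le_mul_of_nonneg_left hgle (by positivity)

end Simplex

/-- The logarithmic coefficient is bounded on positive points. -/
theorem exists_bound_pos (hconn : Γ.Connected) (hcore : Γ.IsCore Finset.univ)
    {G : MvPolynomial E ℂ} {d m : ℕ} (hhom : G.IsHomogeneous d)
    (hd : d + Fintype.card E = m * Γ.h1 Finset.univ) (hG : ∀ σ : Γ.Chart, σ.LogDivides G m)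
    [Nonempty E] : ∃ M : ℝ, 0 ≤ M ∧ ∀ a : E → ℝ, (∀ e, 0 < a e) →
      MvPolynomial.eval (fun e => (a e : ℂ)) Γ.psi ≠ 0 ∧
        ‖Γ.logCoeff G m (fun e => (a e : ℂ))‖ ≤ M := by
  obtain ⟨δ, M, hδ, hM, hbound⟩ := exists_bound hconn hcore hhom hd hG
  refine ⟨M, hM, fun a ha => ?_⟩
  -- With the empty flag no coordinate is exempt, so the chart brings all of them into the unit
  -- cube.
  have hflag : Γ.IsFlag ∅ := ⟨by simp, by simp⟩
  obtain ⟨σ, -, hle⟩ := hflag.exists_chart hcore a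
  have hz := Chart.coords_pos (σ := σ) ha
  have hz1 : ∀ e, σ.coords a e ≤ 1 := by
    intro f
    unfold Chart.coords
    split_ifs with h
    · exact le_rfl
    · exact div_le_one_of_le₀ (hle f h (by simp [Chart.fibre])) (ha _).le
  have heq : (fun e => (a e : ℂ)) =
      (a σ.top : ℂ) • σ.toProj (fun e => (σ.coords a e : ℂ)) := by
    funext e
    rw [Pi.smul_apply, Chart.toProj_ofReal, Chart.toProj_coords ha, smul_eq_mul,
      ← Complex.ofReal_mul, mul_div_cancel₀ _ (ha _).ne']
  rw [heq]
  refine hbound σ _ _ (Complex.ofReal_ne_zero.2 (ha _).ne')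
    (fun e => Complex.ofReal_ne_zero.2 (hz e).ne') (fun e => ?_)
    ⟨σ.coords a, fun e => ⟨(hz e).le, hz1 e, by simpa using hδ⟩⟩
  rw [Complex.norm_real, Real.norm_of_nonneg (hz e).le]
  exact hz1 e

/-! ### The chain `σ_ε` -/

/-- The barycentric coordinates of a point of the simplex. -/
def bary (e₀ : E) (t : {f : E // f ≠ e₀} → ℝ) (k : E) : ℝ :=
  if h : k = e₀ then 1 - ∑ f, t f else t ⟨k, h⟩

/-- The homogeneous coordinates of a point of the simplex. -/
def simplexPoint (e₀ : E) (q : E → E → ℝ) (ε : ℝ) (t : {f : E // f ≠ e₀} → ℝ) (j : E) : ℝ :=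
  ∑ k : E, bary e₀ t k * ((if k = j then 1 else 0) + ε * q k j)

theorem simplexMap_eq (e₀ : E) (q : E → E → ℝ) (ε : ℝ) :
    simplexMap e₀ q ε = fun t j => (simplexPoint e₀ q ε t j : ℂ) := rfl

theorem sum_eq_add_sum_ne {M : Type*} [AddCommMonoid M] (e₀ : E) (u : E → M) :
    ∑ k, u k = u e₀ + ∑ f : {f : E // f ≠ e₀}, u f := by
  rw [← Finset.add_sum_erase _ _ (Finset.mem_univ e₀),
    Finset.sum_subtype (p := fun f => f ≠ e₀) _ (by simp)]

theorem prod_eq_mul_prod_ne {M : Type*} [CommMonoid M] (e₀ : E) (u : E → M) :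
    ∏ k, u k = u e₀ * ∏ f : {f : E // f ≠ e₀}, u f := by
  rw [← Finset.mul_prod_erase _ _ (Finset.mem_univ e₀),
    Finset.prod_subtype (p := fun f => f ≠ e₀) _ (by simp)]

theorem bary_self (e₀ : E) (t : {f : E // f ≠ e₀} → ℝ) : bary e₀ t e₀ = 1 - ∑ f, t f :=
  dif_pos rfl

theorem bary_coe (e₀ : E) (t : {f : E // f ≠ e₀} → ℝ) (f : {f : E // f ≠ e₀}) :
    bary e₀ t f = t f := dif_neg f.2

theorem sum_bary (e₀ : E) (t : {f : E // f ≠ e₀} → ℝ) : ∑ k, bary e₀ t k = 1 := by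
  rw [sum_eq_add_sum_ne e₀, bary_self]
  simp [bary_coe]

theorem bary_nonneg {e₀ : E} {t : {f : E // f ≠ e₀} → ℝ} (ht : t ∈ simplexDomain e₀) (k : E) :
    0 ≤ bary e₀ t k := by
  unfold bary
  split_ifs
  · linarith [ht.2]
  · exact ht.1 _

theorem simplexPoint_bounds {e₀ : E} {q : E → E → ℝ} (hq : ∀ i j, 1 / 2 ≤ q i j ∧ q i j ≤ 1)
    {ε : ℝ} (hε : 0 < ε) {t : {f : E // f ≠ e₀} → ℝ} (ht : t ∈ simplexDomain e₀) (j : E) :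
    bary e₀ t j + ε / 2 ≤ simplexPoint e₀ q ε t j ∧ simplexPoint e₀ q ε t j ≤ 1 + ε := by
  have h1 : simplexPoint e₀ q ε t j = bary e₀ t j + ∑ k, bary e₀ t k * (ε * q k j) := by
    simp [simplexPoint, mul_add, Finset.sum_add_distrib]
  have h2 : ∑ k, bary e₀ t k * (ε / 2) = ε / 2 := by
    rw [← Finset.sum_mul, sum_bary, one_mul]
  have h3 : ∑ k, bary e₀ t k * ε = ε := by rw [← Finset.sum_mul, sum_bary, one_mul]
  have h4 : bary e₀ t j ≤ 1 := by
    rw [← sum_bary e₀ t]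
    exact Finset.single_le_sum (fun k _ => bary_nonneg ht k) (Finset.mem_univ j)
  have h5 : ∑ k, bary e₀ t k * (ε / 2) ≤ ∑ k, bary e₀ t k * (ε * q k j) :=
    Finset.sum_le_sum fun k _ => mul_le_mul_of_nonneg_left (by nlinarith [(hq k j).1])
      (bary_nonneg ht k)
  have h6 : ∑ k, bary e₀ t k * (ε * q k j) ≤ ∑ k, bary e₀ t k * ε :=
    Finset.sum_le_sum fun k _ => mul_le_mul_of_nonneg_left (by nlinarith [(hq k j).2])
      (bary_nonneg ht k)
  constructor <;> linarith

/-- The direction vectors of the simplex. -/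
def simplexEdge (e₀ : E) (q : E → E → ℝ) (ε : ℝ) (f j : E) : ℝ :=
  ((if f = j then 1 else 0) + ε * q f j) - ((if e₀ = j then 1 else 0) + ε * q e₀ j)

theorem simplexPoint_eq (e₀ : E) (q : E → E → ℝ) (ε : ℝ) (t : {f : E // f ≠ e₀} → ℝ) (j : E) :
    simplexPoint e₀ q ε t j = ((if e₀ = j then 1 else 0) + ε * q e₀ j) +
      ∑ f : {f : E // f ≠ e₀}, t f * simplexEdge e₀ q ε f j := by
  rw [simplexPoint, sum_eq_add_sum_ne e₀, bary_self]
  simp only [bary_coe, simplexEdge, mul_sub, Finset.sum_sub_distrib, ← Finset.sum_mul]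
  ring

theorem fderiv_simplexMap (e₀ : E) (q : E → E → ℝ) (ε : ℝ) (t : {f : E // f ≠ e₀} → ℝ)
    (f : {f : E // f ≠ e₀}) (j : E) :
    fderiv ℝ (simplexMap e₀ q ε) t (Pi.single f 1) j = (simplexEdge e₀ q ε f j : ℂ) := by
  have h1 : ∀ j, HasFDerivAt (fun t => simplexPoint e₀ q ε t j)
      (∑ f : {f : E // f ≠ e₀}, simplexEdge e₀ q ε f j •
        (ContinuousLinearMap.proj (R := ℝ) (φ := fun _ : {f : E // f ≠ e₀} => ℝ) f)) t := by
    intro j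
    simp only [simplexPoint_eq]
    refine HasFDerivAt.const_add _ (HasFDerivAt.fun_sum fun f _ => ?_)
    exact ((ContinuousLinearMap.proj (R := ℝ)
      (φ := fun _ : {f : E // f ≠ e₀} => ℝ) f).hasFDerivAt).mul_const _
  have h : HasFDerivAt (simplexMap e₀ q ε) (ContinuousLinearMap.pi fun j =>
      Complex.ofRealCLM.comp (∑ f : {f : E // f ≠ e₀}, simplexEdge e₀ q ε f j •
        (ContinuousLinearMap.proj (R := ℝ) (φ := fun _ : {f : E // f ≠ e₀} => ℝ) f))) t :=
    hasFDerivAt_pi.2 fun j => Complex.ofRealCLM.hasFDerivAt.comp t (h1 j)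
  rw [h.fderiv]
  simp [Pi.single_apply]

theorem continuous_simplexMap (e₀ : E) (q : E → E → ℝ) (ε : ℝ) :
    Continuous (simplexMap e₀ q ε) := by
  rw [simplexMap_eq]
  simp only [simplexPoint_eq]
  fun_prop

theorem pullback_simplexMap (G : MvPolynomial E ℂ) (m : ℕ) (e₀ : E) (q : E → E → ℝ) (ε : ℝ)
    (t : {f : E // f ≠ e₀} → ℝ) : Γ.pullback G m e₀ (simplexMap e₀ q ε) t =
      MvPolynomial.eval (simplexMap e₀ q ε t) G /
        (MvPolynomial.eval (simplexMap e₀ q ε t) Γ.psi) ^ m *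
      (Matrix.of fun f j : E => if f = e₀ then simplexMap e₀ q ε t j
        else (simplexEdge e₀ q ε f j : ℂ)).det := by
  rw [pullback]
  congr 2
  ext1 f j
  simp only [Matrix.of_apply]
  by_cases h : f = e₀
  · rw [dif_pos h, if_pos h]
  · rw [dif_neg h, if_neg h]
    exact fderiv_simplexMap e₀ q ε t ⟨f, h⟩ j

/-- Logarithmic growth of the integrals over simplices. -/
theorem exists_simplex_bound (hconn : Γ.Connected) (hcore : Γ.IsCore Finset.univ)
    {G : MvPolynomial E ℂ} {d m : ℕ} (hhom : G.IsHomogeneous d)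
    (hd : d + Fintype.card E = m * Γ.h1 Finset.univ) (hG : ∀ σ : Γ.Chart, σ.LogDivides G m) :
    ∃ M ε₀ : ℝ, 0 < ε₀ ∧ ∀ ε : ℝ, 0 < ε → ε < ε₀ →
      ∀ (e₀ : E) (q : E → E → ℝ), (∀ i j, 1 / 2 ≤ q i j ∧ q i j ≤ 1) →
        Γ.IntegralBound G m e₀ (simplexMap e₀ q ε) (simplexDomain e₀)
          (M * |Real.log (|ε|)| ^ Fintype.card E) := by
  rcases isEmpty_or_nonempty E with hE | hE
  · exact ⟨0, 1, one_pos, fun _ _ _ e₀ => hE.elim e₀⟩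
  obtain ⟨M, hM, hbound⟩ := exists_bound_pos hconn hcore hhom hd hG
  set n := Fintype.card E with hn
  set K : ℝ := n.factorial * 4 ^ n with hK
  -- `K` bounds an n × n determinant with entries of absolute value at most 4; n² comes from the
  -- dominating function, and 4 from log((1 + ε/2)/(ε/2)) ≤ 4 (-log ε).
  refine ⟨M * K * (n ^ 2 * 4 ^ n), Real.exp (-1), Real.exp_pos _, ?_⟩
  intro ε hε hε1 e₀ q hq
  have hl := one_le_neg_log hε hε1
  have hε2 : ε ≤ 1 := by
    refine hε1.le.trans ?_
    rw [Real.exp_le_one_iff]; norm_num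
  have hx : 0 < ε / 2 := by positivity
  obtain ⟨h, hhc, hhi, hhle, hhint⟩ :=
    exists_dominating_simplex (ι := {f : E // f ≠ e₀}) hx
  have hdom : simplexDomain e₀ = stdSimplexParam {f : E // f ≠ e₀} := rfl
  have hApos : ∀ t ∈ simplexDomain e₀, ∀ j, 0 < simplexPoint e₀ q ε t j := fun t ht j => by
    linarith [(simplexPoint_bounds hq hε ht j).1, bary_nonneg ht j]
  have hψ : ∀ t ∈ simplexDomain e₀, MvPolynomial.eval (simplexMap e₀ q ε t) Γ.psi ≠ 0 :=
    fun t ht => (hbound _ (hApos t ht)).1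
  have hedge : ∀ f j, |simplexEdge e₀ q ε f j| ≤ 4 := by
    intro f j
    have h1 : 0 ≤ ε * q f j := mul_nonneg hε.le (by linarith [(hq f j).1])
    have h2 : ε * q f j ≤ 1 := mul_le_one₀ hε2 (by linarith [(hq f j).1]) (hq f j).2
    have h3 : 0 ≤ ε * q e₀ j := mul_nonneg hε.le (by linarith [(hq e₀ j).1])
    have h4 : ε * q e₀ j ≤ 1 := mul_le_one₀ hε2 (by linarith [(hq e₀ j).1]) (hq e₀ j).2
    unfold simplexEdge
    rw [abs_le]
    split_ifs <;> constructor <;> linarith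
  have hdet : ∀ t ∈ simplexDomain e₀, ‖(Matrix.of fun f j : E =>
      if f = e₀ then simplexMap e₀ q ε t j else (simplexEdge e₀ q ε f j : ℂ)).det‖ ≤ K := by
    intro t ht
    have := Matrix.det_le (A := Matrix.of fun f j : E =>
      if f = e₀ then simplexMap e₀ q ε t j else (simplexEdge e₀ q ε f j : ℂ))
      (abv := NormedField.toAbsoluteValue ℂ) (x := 4) ?_
    · rw [nsmul_eq_mul] at this
      exact this
    · intro f j
      change ‖(Matrix.of fun f j : E => if f = e₀ then simplexMap e₀ q ε t j
        else (simplexEdge e₀ q ε f j : ℂ)) f j‖ ≤ 4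
      simp only [Matrix.of_apply]
      split_ifs
      · rw [simplexMap_eq, Complex.norm_real, Real.norm_of_nonneg (hApos t ht j).le]
        linarith [(simplexPoint_bounds hq hε ht j).2]
      · rw [Complex.norm_real]
        exact hedge f j
  set U : Set ({f : E // f ≠ e₀} → ℝ) :=
    {t | (∀ i, -(ε / 2) < t i) ∧ ∑ i, t i < 1 + ε / 2} ∩
      (fun t => MvPolynomial.eval (simplexMap e₀ q ε t) Γ.psi) ⁻¹' {0}ᶜ with hU
  have hcm := continuous_simplexMap e₀ q ε
  have hUo : IsOpen U := by
    have h1 : IsOpen {t : {f : E // f ≠ e₀} → ℝ | ∀ i, -(ε / 2) < t i} := by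
      simp only [Set.ofPred_forall]
      exact isOpen_iInter_of_finite fun i => isOpen_lt continuous_const (continuous_apply i)
    have h2 : IsOpen {t : {f : E // f ≠ e₀} → ℝ | ∑ i, t i < 1 + ε / 2} :=
      isOpen_lt (by fun_prop) continuous_const
    exact (h1.inter h2).inter
      (isOpen_compl_singleton.preimage ((MvPolynomial.continuous_eval _).comp hcm))
  have hcf : ContinuousOn (Γ.pullback G m e₀ (simplexMap e₀ q ε)) U := by
    have h1 : Γ.pullback G m e₀ (simplexMap e₀ q ε) = fun t => _ :=
      funext fun t => pullback_simplexMap G m e₀ q ε t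
    rw [h1]
    refine ContinuousOn.mul (ContinuousOn.div ?_ ?_ fun t ht => pow_ne_zero _ ht.2) ?_
    · exact ((MvPolynomial.continuous_eval _).comp hcm).continuousOn
    · exact (((MvPolynomial.continuous_eval _).comp hcm).pow m).continuousOn
    · refine (Continuous.matrix_det (continuous_matrix fun f j => ?_)).continuousOn
      simp only [Matrix.of_apply]
      split_ifs
      · exact (continuous_apply j).comp hcm
      · exact continuous_const
  have hmain := integral_le_of_continuousOn (μ := volume) (D := simplexDomain e₀)
    (B := simplexDomain e₀) (h := fun t => M * K * h t) hUo hcf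
    (continuousOn_const.mul (hhc.mono fun t ht => ht.1))
    (hdom ▸ measurableSet_stdSimplexParam) (hhi.const_mul (M * K)) ?_ ?_ subset_rfl ?_
  · refine ⟨hψ, hmain.1, hmain.2.trans ?_⟩
    rw [integral_const_mul, abs_log_abs hε hε1, mul_assoc (M * K)]
    refine mul_le_mul_of_nonneg_left (hhint.trans ?_) (by positivity)
    have hcard : Fintype.card {f : E // f ≠ e₀} + 1 = n := by
      rw [Fintype.card_subtype_compl, Fintype.card_subtype_eq]
      exact Nat.sub_add_cancel Fintype.card_pos
    have hcard' : ((Fintype.card {f : E // f ≠ e₀} : ℝ) + 1) = n := by exact_mod_cast hcard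
    rw [hcard', mul_assoc, ← mul_pow]
    refine mul_le_mul_of_nonneg_left ?_ (by positivity)
    have hratio : 1 ≤ (1 + ε / 2) / (ε / 2) := by
      rw [one_le_div hx]; linarith
    have hlog : Real.log ((1 + ε / 2) / (ε / 2)) ≤ 4 * -Real.log ε := by
      calc Real.log ((1 + ε / 2) / (ε / 2)) ≤ Real.log (4 / ε) := by
            refine Real.log_le_log (by positivity) ?_
            rw [div_le_div_iff₀ hx hε]
            nlinarith
        _ = Real.log 4 - Real.log ε := Real.log_div (by norm_num) hε.ne'
        _ ≤ 4 * -Real.log ε := by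
            have := Real.log_le_sub_one_of_pos (show (0 : ℝ) < 4 by norm_num)
            linarith
    exact (pow_le_pow_left₀ (Real.log_nonneg hratio) hlog _).trans
      (pow_le_pow_right₀ (by linarith) (by omega))
  · intro t ht
    refine mul_nonneg (by positivity) (le_trans (inv_nonneg.2 ?_) (hhle t ht))
    exact mul_nonneg (by linarith [ht.2])
      (Finset.prod_nonneg fun i _ => by linarith [ht.1 i])
  · exact fun t ht => ⟨⟨fun i => by linarith [ht.1 i], by linarith [ht.2]⟩, hψ t ht⟩
  · intro t ht
    have hprod : 0 < ∏ j, simplexPoint e₀ q ε t j := Finset.prod_pos fun j _ => hApos t ht j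
    have hprodC : ∏ j, simplexMap e₀ q ε t j ≠ 0 :=
      Finset.prod_ne_zero_iff.2 fun j _ => Complex.ofReal_ne_zero.2 (hApos t ht j).ne'
    have h1 : MvPolynomial.eval (simplexMap e₀ q ε t) G /
        (MvPolynomial.eval (simplexMap e₀ q ε t) Γ.psi) ^ m =
        Γ.logCoeff G m (simplexMap e₀ q ε t) * (∏ j, simplexMap e₀ q ε t j)⁻¹ := by
      rw [logCoeff, mul_div_right_comm, mul_inv_cancel_right₀ hprodC]
    have h2 : ‖(∏ j, simplexMap e₀ q ε t j)⁻¹‖ ≤ h t := by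
      rw [norm_inv, norm_prod]
      refine le_trans ?_ (hhle t ht)
      have h3 : ∏ j, (bary e₀ t j + ε / 2) =
          (1 - ∑ i, t i + ε / 2) * ∏ i, (t i + ε / 2) := by
        rw [prod_eq_mul_prod_ne e₀, bary_self]
        simp only [bary_coe]
      rw [← h3]
      refine inv_anti₀ (Finset.prod_pos fun j _ => by linarith [bary_nonneg ht j]) ?_
      refine Finset.prod_le_prod (fun j _ => by linarith [bary_nonneg ht j]) fun j _ => ?_
      rw [simplexMap_eq, Complex.norm_real, Real.norm_of_nonneg (hApos t ht j).le]
      exact (simplexPoint_bounds hq hε ht j).1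
    rw [pullback_simplexMap, norm_mul, h1, norm_mul]
    calc _ ≤ (M * h t) * K := by
          refine mul_le_mul (mul_le_mul (hbound _ (hApos t ht)).2 h2 (norm_nonneg _) hM)
            (hdet t ht) (norm_nonneg _) (mul_nonneg hM ((norm_nonneg _).trans h2))
      _ = M * K * h t := by ring

/-- Logarithmic growth of the integrals of forms with at most logarithmic poles. -/
theorem logGrowth_of_logDivides (hconn : Γ.Connected) (hcore : Γ.IsCore Finset.univ)
    (g : Γ.ToricMetric) {G : MvPolynomial E ℂ} {d m : ℕ} (hhom : G.IsHomogeneous d)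
    (hd : d + Fintype.card E = m * Γ.h1 Finset.univ) (hG : ∀ σ : Γ.Chart, σ.LogDivides G m) :
    Γ.LogGrowth g G m := by
  intro κ hκ
  obtain ⟨M₁, ε₁, hε₁, h₁⟩ := exists_simplex_bound hconn hcore hhom hd hG
  obtain ⟨M₂, ε₂, hε₂, h₂⟩ := exists_tube_bound hconn hcore g hhom hd hG one_pos
  obtain ⟨M₃, ε₃, hε₃, h₃⟩ := exists_tube_bound hconn hcore g hhom hd hG hκ
  set M := max M₁ (max M₂ M₃) with hM
  have hL : ∀ ε : ℝ, 0 ≤ |Real.log (|ε|)| ^ Fintype.card E := fun ε => by positivity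
  -- The bound 1/2 keeps ε₀ < 1 and turns 1 - ε₀ < q_{ij} into q_{ij} ≥ 1/2.
  refine ⟨Fintype.card E, M, min (1 / 2) (min ε₁ (min ε₂ ε₃)), by positivity,
    (min_le_left _ _).trans_lt (by norm_num), fun ε hε hlt => ?_⟩
  simp only [lt_min_iff] at hlt
  refine ⟨fun e₀ q hq => ?_, fun C hC σ hCσ => ?_, fun C hC σ hCσ B _ hB => ?_⟩
  · refine (h₁ ε hε hlt.2.1 e₀ q fun i j => ⟨?_, (hq i j).2⟩).mono
      (mul_le_mul_of_nonneg_right (le_max_left _ _) (hL ε))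
    have := (hq i j).1
    have := min_le_left (1 / 2 : ℝ) (min ε₁ (min ε₂ ε₃))
    linarith
  · refine (h₂ ε hε hlt.2.2.1 C hC σ hCσ _ ?_).mono
      (mul_le_mul_of_nonneg_right ((le_max_left _ _).trans (le_max_right _ _)) (hL ε))
    rw [one_mul]
  · exact (h₃ ε hε hlt.2.2.2 C hC σ hCσ B hB).mono
      (mul_le_mul_of_nonneg_right ((le_max_right _ _).trans (le_max_right _ _)) (hL ε))

end FeynmanGraph

end
-- Conclusion: forms with logarithmic poles, and Ω/ψ²
theorem mainTheorem10 {V E : Type*} [Fintype V] [DecidableEq V] [Fintype E] [DecidableEq E]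
    (Γ : FeynmanGraph V E) (hconn : Γ.Connected) (hcore : Γ.IsCore Finset.univ)
    (hsdd : ∀ γ : Finset E, γ.Nonempty → Γ.IsCore γ → Γ.ConnectedOn γ → Γ.sdd γ ≤ 2)
    (g : Γ.ToricMetric) :
    (∀ (d m : ℕ) (G : MvPolynomial E ℂ), G.IsHomogeneous d →
      d + Fintype.card E = m * Γ.h1 Finset.univ → Γ.HasLogPoles G m → Γ.LogGrowth g G m) ∧
    (Γ.kin = ∅ → Γ.sdd Finset.univ = 0 →
      (∀ γ : Finset E, γ.Nonempty → Γ.IsCore γ → Γ.ConnectedOn γ → Γ.sdd γ ≤ 0) →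
      Γ.LogGrowth g 1 2) := by
  refine ⟨fun d m G hG hd hlog => FeynmanGraph.logGrowth_of_logDivides hconn hcore g hG hd
    (FeynmanGraph.Chart.logDivides_of_hasLogPoles hlog), fun hkin h0 hle => ?_⟩
  have hsdd0 : ∀ γ, Γ.sdd γ = 4 * (Γ.h1 γ : ℤ) - 2 * (γ.card : ℤ) := by
    intro γ
    simp [FeynmanGraph.sdd, hkin]
  refine FeynmanGraph.logGrowth_of_logDivides hconn hcore g (MvPolynomial.isHomogeneous_one E ℂ) ?_
    (FeynmanGraph.Chart.logDivides_one_two (FeynmanGraph.two_mul_h1_le_card fun γ h1 h2 h3 => ?_))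
  -- For G = 1 and m = 2 the degree condition is n = 2 h_1(Γ), that is sdd(Γ) = 0.
  · rw [hsdd0, Finset.card_univ] at h0
    omega
  · have := hle γ h1 h2 h3
    rw [hsdd0] at this
    omega
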